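/- **Setting.** Let $(\mathcal X,\mu)$ be a $\sigma$-finite measure space (for instance $\mathbb R^M$ with Lebesgue measure, or a countable set with counting measure). Let $K^*=K_t+K_n$ with $K_n\ge 1$, and let the latent variable be $y=(y^{(11)},y^{(12)})\in\{1,\dots,L\}^{K_t}\times\{1,\dots,L\}^{K_n}$. The learning model $p(x,y|w)$, $w\in W\subseteq\mathbb R^d$ ($W$ measurable), is a jointly measurable family of probability densities with respect to $\mu\otimes\text{counting}$, and $p(x|w)=\sum_y p(x,y|w)$. The prior $\varphi$ is a probability density on $W$. The true density is $q(x,y)=p(x,y|w^*)$ (for $\mu$-a.e. $x$ and all $y$), where $w^*$ is an interior point of $W$; thus the model and the true distribution have the same latent dimension and range (the non-redundant case). Put $q(x)=\sum_y q(x,y)$, $p(x,y^{(11)}|w)=\sum_{y^{(12)}}p(x,y|w)$ and $q(x,y^{(11)})=\sum_{y^{(12)}}q(x,y)$. For $X^n=(x_1,\dots,x_n)$ and $Y^n=(y_1,\dots,y_n)$ let $$q(Y^n|X^n)=\prod_{i=1}^n\frac{q(x_i,y_i)}{q(x_i)},\qquad p(Y^n|X^n)=\frac{\int_W\prod_{i}p(x_i,y_i|w)\,\varphi(w)\,dw}{\int_W\prod_{i}p(x_i|w)\,\varphi(w)\,dw},$$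 let $q(Y^n_{11}|X^n)$ and $p(Y^n_{11}|X^n)$ be their sums over $Y^n_{12}$, and, with $E_{X^n}$ the expectation under the density $\prod_i q(x_i)$, $$D_{n1}(n)=\frac1nE_{X^n}\Big[\sum_{Y^n}q(Y^n|X^n)\ln\frac{q(Y^n|X^n)}{p(Y^n|X^n)}\Big],\qquad D_{n2}(n)=\frac1nE_{X^n}\Big[\sum_{Y^n_{11}}q(Y^n_{11}|X^n)\ln\frac{q(Y^n_{11}|X^n)}{p(Y^n_{11}|X^n)}\Big].$$ The Fisher information matrices are $$I_{XY}(w)_{ij}=E_{q}\big[\partial_i\ln p(x,y|w)\,\partial_j\ln p(x,y|w)\big],\qquad I_{XY_{11}}(w)_{ij}=E_{q}\big[\partial_i\ln p(x,y^{(11)}|w)\,\partial_j\ln p(x,y^{(11)}|w)\big].$$ **Regularity assumptions.** 1. $\varphi$ is continuous at $w^*$ and $\varphi(w^*)>0$. 2. For each of the two families $g=p(x,y|w)$ and $g=p(x,y^{(11)}|w)$ (write $t$ for the label) there are a ball $B$ around $w^*$ and functions $h$, $G$ of $(x,t)$ with $\sum_t\int h\,d\mu<\infty$ and $\sum_t\int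 G^2\,g(\cdot,t|w^*)\,d\mu<\infty$, such that for every $t$ and $\mu$-a.e. $x$: $g$ is $C^2$ in $w\in B$; and for all $w\in B$ and all $i,j$, $g(x,t|w)=0$ iff $g(x,t|w^*)=0$, $|\partial_i\partial_j g(x,t|w)|\le h(x,t)$, and $|\partial_i\partial_j\ln g(x,t|w)|\le G(x,t)$ if $g(x,t|w^*)\neq0$. 3. $I_{XY}(w^*)$ and $I_{XY_{11}}(w^*)$ are positive definite. 4. $w^*$ is identified by $p(x,y^{(11)}|w)$: if a net $(w_\alpha)$ in $W$ satisfies $\int_A p(x,y^{(11)}|w_\alpha)\,d\mu\to\int_A p(x,y^{(11)}|w^*)\,d\mu$ for every measurable $A$ and every $y^{(11)}$, then $w_\alpha\to w^*$. (In particular $w^*$ is the only $w\in W$ with $p(x,y^{(11)}|w)=q(x,y^{(11)})$ for all $y^{(11)}$ and $\mu$-a.e. $x$; for compact $W$ and densities continuous in $w\in W$ this uniqueness is equivalent to the condition.) **Corollary (asymptotic difference between the joint-type and the marginal-type error).** The expectations defining $D_{n1}(n)$ and $D_{n2}(n)$ are finite for every $n$, and as $n\to\infty$ $$D_{n1}(n)-D_{n2}(n)=\frac1{2n}\ln\det\big(I_{XY}(w^*)\,I_{XY_{11}}(w^*)^{-1}\big)+o\Big(\frac1n\Big).$$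 -/

import Mathlib

open MeasureTheory Filter Topology Asymptotics

namespace LatentBayes

/-- The parameters `w`, a vector of dimension `d`. -/
abbrev Param (d : ℕ) : Type := EuclideanSpace ℝ (Fin d)

/-- The `K`-dimensional discrete labels, `{1, …, L}^K`. -/
abbrev Label (K L : ℕ) : Type := Fin K → Fin L

/-- The partial derivative of `f` in the `i`-th coordinate of `w`. -/
noncomputable def partialDeriv {d : ℕ} (i : Fin d) (f : Param d → ℝ) (w : Param d) : ℝ :=
  fderiv ℝ f w (EuclideanSpace.single i 1)

section Families

variable {d : ℕ} {X T : Type*} [MeasurableSpace X] [Fintype T]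

/-- `g w x t` is, for every `w` in the parameter set `W`, a joint density in `(x, t)` with respect
to the product of `μ` and the counting measure of the finite set `T`. -/
structure IsDensityFamily (μ : Measure X) (W : Set (Param d)) (g : Param d → X → T → ℝ) :
    Prop where
  measurable : ∀ t, Measurable fun a : Param d × X => g a.1 a.2 t
  nonneg : ∀ w ∈ W, ∀ x t, 0 ≤ g w x t
  integral_eq_one : ∀ w ∈ W, ∫ x, ∑ t, g w x t ∂μ = 1

/-- The Fisher information matrix of the family `g` at `w`; the expectation is taken under `q`. -/
noncomputable def fisherInfo (μ : Measure X) (q : X → T → ℝ) (g : Param d → X → T → ℝ)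
    (w : Param d) : Matrix (Fin d) (Fin d) ℝ :=
  Matrix.of fun i j => ∫ x, ∑ t,
    partialDeriv i (fun v => Real.log (g v x t)) w *
      partialDeriv j (fun v => Real.log (g v x t)) w * q x t ∂μ

/-- The classical regularity of a family of densities at the parameter `w₀`. On a ball around
`w₀`: the support does not depend on the parameter, the densities are twice continuously
differentiable with second derivatives dominated by an integrable function, and the second
derivatives of the log density are dominated by a function that is square integrable under
the density at `w₀`. -/
def IsRegularAt (μ : Measure X) (g : Param d → X → T → ℝ) (w₀ : Param d) : Prop :=
  ∃ r > 0, ∃ h G : X → T → ℝ,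
    (∀ t, Integrable (fun x => h x t) μ) ∧
    (∀ t, Integrable (fun x => G x t ^ 2 * g w₀ x t) μ) ∧
    ∀ t, ∀ᵐ x ∂μ,
      ContDiffOn ℝ 2 (fun w => g w x t) (Metric.ball w₀ r) ∧
      ∀ w ∈ Metric.ball w₀ r,
        (g w x t = 0 ↔ g w₀ x t = 0) ∧
        ∀ i j,
          |partialDeriv i (partialDeriv j fun v => g v x t) w| ≤ h x t ∧
          (g w₀ x t ≠ 0 →
            |partialDeriv i (partialDeriv j fun v => Real.log (g v x t)) w| ≤ G x t)

/-- `w₀` is identified by the family `g` on `W`: if `w` varies in `W` in such a way that the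
distribution with density `g w` converges on every event to the one with density `g w₀`,
then `w` converges to `w₀`. (With `l` the principal filter of a point: `w₀` is the only parameter
in `W` with its distribution.) -/
def IsIdentifiedAt (μ : Measure X) (W : Set (Param d)) (g : Param d → X → T → ℝ)
    (w₀ : Param d) : Prop :=
  ∀ l : Filter (Param d), l ≤ 𝓟 W →
    (∀ (t : T) (A : Set X), MeasurableSet A →
      Tendsto (fun w => ∫ x in A, g w x t ∂μ) l (𝓝 (∫ x in A, g w₀ x t ∂μ))) →
    l ≤ 𝓝 w₀

end Families

/-- `φ` is a probability density on the parameter set `W`. -/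
structure IsPrior {d : ℕ} (W : Set (Param d)) (φ : Param d → ℝ) : Prop where
  nonneg : ∀ w ∈ W, 0 ≤ φ w
  integral_eq_one : ∫ w in W, φ w = 1

section Errors

variable {d : ℕ} {X : Type*}

/-- The marginal `q(x, y⁽¹¹⁾) = ∑_{y⁽¹²⁾} q(x, y⁽¹¹⁾, y⁽¹²⁾)` over the nuisance dimensions. -/
def margLabel {Kt Kn L : ℕ} (q : X → Label (Kt + Kn) L → ℝ) (x : X) (y : Label Kt L) : ℝ :=
  ∑ z : Label Kn L, q x (Fin.append y z)

/-- The marginal likelihood `Z(Xⁿ) = ∫ ∏ᵢ p(xᵢ | w) φ(w) dw`. -/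
noncomputable def evidence {K L : ℕ} (W : Set (Param d)) (p : Param d → X → Label K L → ℝ)
    (φ : Param d → ℝ) {n : ℕ} (x : Fin n → X) : ℝ :=
  ∫ w in W, (∏ i, ∑ y, p w (x i) y) * φ w

/-- The marginal likelihood `Z(Xⁿ, Yⁿ) = ∫ ∏ᵢ p(xᵢ, yᵢ | w) φ(w) dw` of the complete data. -/
noncomputable def jointEvidence {K L : ℕ} (W : Set (Param d)) (p : Param d → X → Label K L → ℝ)
    (φ : Param d → ℝ) {n : ℕ} (x : Fin n → X) (y : Fin n → Label K L) : ℝ :=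
  ∫ w in W, (∏ i, p w (x i) (y i)) * φ w

/-- The Bayesian estimate `p(Yⁿ | Xⁿ) = Z(Xⁿ, Yⁿ) / Z(Xⁿ)`. -/
noncomputable def estPosterior {K L : ℕ} (W : Set (Param d)) (p : Param d → X → Label K L → ℝ)
    (φ : Param d → ℝ) {n : ℕ} (x : Fin n → X) (y : Fin n → Label K L) : ℝ :=
  jointEvidence W p φ x y / evidence W p φ x

/-- The true distribution `q(Yⁿ | Xⁿ) = ∏ᵢ q(xᵢ, yᵢ) / q(xᵢ)`. -/
noncomputable def truePosterior {K L : ℕ} (q : X → Label K L → ℝ) {n : ℕ} (x : Fin n → X)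
    (y : Fin n → Label K L) : ℝ :=
  ∏ i, q (x i) (y i) / ∑ z, q (x i) z

/-- The marginal over `Yⁿ₁₂` of a function of `Yⁿ = (Yⁿ₁₁, Yⁿ₁₂)`. -/
def margSeq {Kt Kn L n : ℕ} (f : (Fin n → Label (Kt + Kn) L) → ℝ) (y : Fin n → Label Kt L) : ℝ :=
  ∑ z : Fin n → Label Kn L, f fun i => Fin.append (y i) (z i)

/-- The Kullback-Leibler sum `∑ₛ a(s) ln (a(s) / b(s))` over a finite set. -/
noncomputable def klSum {S : Type*} [Fintype S] (a b : S → ℝ) : ℝ :=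
  ∑ s, a s * Real.log (a s / b s)

/-- The function of `Xⁿ` that is integrated in the joint-type error:
`∑_{Yⁿ} q(Yⁿ|Xⁿ) ln (q(Yⁿ|Xⁿ) / p(Yⁿ|Xⁿ)) · q(Xⁿ)`. -/
noncomputable def jointIntegrand {K L : ℕ} (W : Set (Param d)) (p : Param d → X → Label K L → ℝ)
    (φ : Param d → ℝ) (q : X → Label K L → ℝ) (n : ℕ) (x : Fin n → X) : ℝ :=
  klSum (truePosterior q x) (estPosterior W p φ x) * ∏ i, ∑ y, q (x i) y

/-- The function of `Xⁿ` that is integrated in the marginal-type error: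
`∑_{Yⁿ₁₁} q(Yⁿ₁₁|Xⁿ) ln (q(Yⁿ₁₁|Xⁿ) / p(Yⁿ₁₁|Xⁿ)) · q(Xⁿ)`. -/
noncomputable def margIntegrand {Kt Kn L : ℕ} (W : Set (Param d))
    (p : Param d → X → Label (Kt + Kn) L → ℝ) (φ : Param d → ℝ)
    (q : X → Label (Kt + Kn) L → ℝ) (n : ℕ) (x : Fin n → X) : ℝ :=
  klSum (margSeq (truePosterior q x)) (margSeq (estPosterior W p φ x)) * ∏ i, ∑ y, q (x i) y

/-- The joint-type error `D_{n1}(n)`. -/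
noncomputable def jointError [MeasurableSpace X] {K L : ℕ} (μ : Measure X) (W : Set (Param d))
    (p : Param d → X → Label K L → ℝ) (φ : Param d → ℝ) (q : X → Label K L → ℝ) (n : ℕ) : ℝ :=
  1 / (n : ℝ) * ∫ x, jointIntegrand W p φ q n x ∂(Measure.pi fun _ : Fin n => μ)

/-- The marginal-type error `D_{n2}(n)`. -/
noncomputable def margError [MeasurableSpace X] {Kt Kn L : ℕ} (μ : Measure X)
    (W : Set (Param d)) (p : Param d → X → Label (Kt + Kn) L → ℝ) (φ : Param d → ℝ)
    (q : X → Label (Kt + Kn) L → ℝ) (n : ℕ) : ℝ :=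
  1 / (n : ℝ) * ∫ x, margIntegrand W p φ q n x ∂(Measure.pi fun _ : Fin n => μ)

end Errors

end LatentBayes

open LatentBayes

/-! Let `Q` be the true density of a sample of size `n` and `Z` its Bayes mixture, both for the
complete data `(x, y)` and, summed over the labels, for `x` alone. For almost every `x` the chain
rule for relative entropy (`klSum_normalize_mul`) turns the integrand of the joint-type error into
`∑ y, Q(x,y) log (Q(x,y) / Z(x,y))` minus the observed loss `Q(x) log (Q(x) / Z(x))`. The
marginal-type error is the same expression for the family summed over the nuisance labels
(`margIntegrand_ae_eq`), and its observed loss is literally the same function. Hence the observed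
losses cancel in the difference. Nothing is needed about the asymptotics of `p(x|w)`, which may be a
singular model; only integrability of the observed loss is used, and `jointIntegrand_eq` provides
the bounds for it.

What remains is the Clarke-Barron expansion of the expected loss for each of the two regular
families, `evidenceLoss_asymptotics`: it equals `(d/2) log n - (d/2) log 2π - d/2 + (1/2) log det I
- log φ(w₀) + o(1)`. Everything except the two determinants cancels.

For the expansion, a linear change `w = w₀ + A u` with `Aᵀ I A = 1` makes the information matrix the
identity and gives the prior the density `φ(w₀) |det A|` at the origin (`exists_whitening`,
`localPrior_density`). Near the origin the log likelihood ratio is then `√n ⟪T, u⟫ - (n/2)(1 ±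
e)‖u‖²`, where `T` is the normalised score and `e` a small random error. So `Z / Q` is about `φ₀
(2π/n)^(d/2) exp (‖T‖²/2)`, and `E‖T‖² = d` gives the constant `d/2`. Convergence of expectations,
not merely convergence in probability, is required.

The lower bound (`eventually_lower`) localises the integral at a clipped version of `T`, so that `e`
enters linearly with a bounded factor; the clipped second moments are recovered by the central limit
theorem. The upper bound (`eventually_upper_aux`) discards an event of probability `o(1 / log n)`,
on which `E[Z/Q] ≤ 1` suffices, and bounds the mass away from the origin by exponentially consistent
tests. The tests come from identifiability: setwise convergence is governed by finitely many events
at a time, and Hoeffding's inequality applies to their frequencies. The dominating function `h`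
allows two differentiations under the integral (mean zero score, information identity); the function
`G` makes the Hessian of the log likelihood and the Taylor remainder square integrable. -/

namespace LatentBayes

/-! ### Gaussian integrals over balls -/

section GaussianBounds

variable {d : ℕ}

/-- The integral of the unnormalised standard Gaussian over the ball of radius `R`. -/
noncomputable def gaussBall (d : ℕ) (R : ℝ) : ℝ :=
  ∫ v in Metric.ball (0 : Param d) R, Real.exp (-(1 / 2) * ‖v‖ ^ 2)

theorem integrable_exp_neg_mul_norm_sq {b : ℝ} (hb : 0 < b) :
    Integrable fun v : Param d => Real.exp (-b * ‖v‖ ^ 2) := by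
  by_contra h
  have h1 := GaussianFourier.integral_rexp_neg_mul_sq_norm (V := Param d) hb
  rw [integral_undef h] at h1
  have : 0 < (Real.pi / b) ^ (Module.finrank ℝ (Param d) / 2 : ℝ) := by positivity
  exact this.ne h1

theorem integral_exp_neg_mul_norm_sq {b : ℝ} (hb : 0 < b) :
    ∫ v : Param d, Real.exp (-b * ‖v‖ ^ 2) = (Real.pi / b) ^ ((d : ℝ) / 2) := by
  rw [GaussianFourier.integral_rexp_neg_mul_sq_norm hb]
  simp

theorem tendsto_gaussBall :
    Tendsto (gaussBall d) atTop (𝓝 ((2 * Real.pi) ^ ((d : ℝ) / 2))) := by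
  have h : ∫ v : Param d, Real.exp (-(1 / 2) * ‖v‖ ^ 2) = (2 * Real.pi) ^ ((d : ℝ) / 2) := by
    rw [integral_exp_neg_mul_norm_sq (by norm_num)]
    congr 1
    ring
  rw [← h]
  have hu : (⋃ R : ℝ, Metric.ball (0 : Param d) R) = Set.univ :=
    Set.eq_univ_of_forall fun v => Set.mem_iUnion.2 ⟨‖v‖ + 1, by simp⟩
  have := tendsto_setIntegral_of_monotone (μ := (volume : Measure (Param d)))
    (s := fun R : ℝ => Metric.ball (0 : Param d) R)
    (f := fun v : Param d => Real.exp (-(1 / 2) * ‖v‖ ^ 2)) (fun _ => Metric.isOpen_ball.measurableSet)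
    (fun a b hab => Metric.ball_subset_ball hab)
    ((integrable_exp_neg_mul_norm_sq (by norm_num)).integrableOn)
  rw [hu, setIntegral_univ] at this
  exact this

theorem integrableOn_ball_of_continuous {f : Param d → ℝ} (hf : Continuous f) (c : Param d) (R : ℝ) :
    IntegrableOn f (Metric.ball c R) :=
  (hf.continuousOn.integrableOn_compact (isCompact_closedBall c R)).mono_set
    Metric.ball_subset_closedBall

theorem gaussBall_pos {R : ℝ} (hR : 0 < R) : 0 < gaussBall d R := by
  rw [gaussBall, setIntegral_pos_iff_support_of_nonneg_ae]
  · have : Function.support (fun v : Param d => Real.exp (-(1 / 2) * ‖v‖ ^ 2)) = Set.univ :=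
      Set.eq_univ_of_forall fun v => (Real.exp_pos _).ne'
    rw [this, Set.univ_inter]
    exact Metric.measure_ball_pos _ _ hR
  · exact Eventually.of_forall fun v => (Real.exp_pos _).le
  · exact integrableOn_ball_of_continuous (by fun_prop) _ _

/-- By symmetry, a linear tilt does not decrease the Gaussian integral over a centred ball. -/
theorem gaussBall_le_integral_tilt (b : Param d) (R : ℝ) :
    gaussBall d R ≤ ∫ v in Metric.ball (0 : Param d) R,
      Real.exp (inner ℝ b v - (1 / 2) * ‖v‖ ^ 2) := by
  have hodd : ∫ v in Metric.ball (0 : Param d) R,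
      inner ℝ b v * Real.exp (-(1 / 2) * ‖v‖ ^ 2) = 0 := by
    have h := integral_neg_eq_self (fun v => (Metric.ball (0 : Param d) R).indicator
      (fun v => inner ℝ b v * Real.exp (-(1 / 2) * ‖v‖ ^ 2)) v) (volume : Measure (Param d))
    have h2 : ∀ v : Param d, (Metric.ball (0 : Param d) R).indicator
        (fun v => inner ℝ b v * Real.exp (-(1 / 2) * ‖v‖ ^ 2)) (-v) =
        - (Metric.ball (0 : Param d) R).indicator
        (fun v => inner ℝ b v * Real.exp (-(1 / 2) * ‖v‖ ^ 2)) v := by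
      intro v
      by_cases hv : v ∈ Metric.ball (0 : Param d) R
      · have hv' : -v ∈ Metric.ball (0 : Param d) R := by simpa using hv
        simp [Set.indicator_of_mem hv, Set.indicator_of_mem hv']
      · have hv' : -v ∉ Metric.ball (0 : Param d) R := by simpa using hv
        simp [Set.indicator_of_notMem hv, Set.indicator_of_notMem hv']
    simp_rw [h2] at h
    rw [integral_neg, integral_indicator Metric.isOpen_ball.measurableSet] at h
    linarith
  have i1 : IntegrableOn (fun v : Param d => Real.exp (-(1 / 2) * ‖v‖ ^ 2))
      (Metric.ball 0 R) := integrableOn_ball_of_continuous (by fun_prop) _ _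
  have i2 : IntegrableOn (fun v : Param d => inner ℝ b v * Real.exp (-(1 / 2) * ‖v‖ ^ 2))
      (Metric.ball 0 R) := integrableOn_ball_of_continuous (by fun_prop) _ _
  have h3 : gaussBall d R = ∫ v in Metric.ball (0 : Param d) R,
      (Real.exp (-(1 / 2) * ‖v‖ ^ 2) + inner ℝ b v * Real.exp (-(1 / 2) * ‖v‖ ^ 2)) := by
    rw [integral_add i1 i2, hodd, add_zero, gaussBall]
  rw [h3]
  -- Pointwise this is `1 + x ≤ exp x` with `x = ⟪b, v⟫`; the linear term is odd and has integral
  -- zero.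
  refine setIntegral_mono (i1.add i2)
    (integrableOn_ball_of_continuous (by fun_prop) _ _) fun v => ?_
  have h4 := Real.add_one_le_exp (inner ℝ b v)
  have h5 : Real.exp (inner ℝ b v - 1 / 2 * ‖v‖ ^ 2) =
      Real.exp (inner ℝ b v) * Real.exp (-(1 / 2) * ‖v‖ ^ 2) := by
    rw [← Real.exp_add]; congr 1; ring
  rw [h5]
  have := (Real.exp_pos (-(1 / 2) * ‖v‖ ^ 2)).le
  nlinarith

/-- The substitution `u = (c + v) / √N`, which puts the Laplace integral on the scale of the
posterior fluctuations. -/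
theorem integral_comp_add_div_sqrt (N : ℝ) (f : Param d → ℝ) (c : Param d) :
    ∫ v, f ((√N)⁻¹ • (c + v)) = √N ^ d * ∫ u, f u := by
  rw [integral_add_left_eq_self (fun v => f ((√N)⁻¹ • v)) c,
    Measure.integral_comp_inv_smul_of_nonneg _ _ (Real.sqrt_nonneg _)]
  simp

theorem lan_quadratic_rescale {N : ℝ} (hN : 0 < N) (a : ℝ) (T x : Param d) :
    √N * inner ℝ T ((√N)⁻¹ • x) - N / 2 * a * ‖(√N)⁻¹ • x‖ ^ 2 =
      inner ℝ T x - 1 / 2 * a * ‖x‖ ^ 2 := by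
  have hs : 0 < √N := Real.sqrt_pos.2 hN
  rw [inner_smul_right, norm_smul, mul_pow, Real.norm_eq_abs, sq_abs, inv_pow, Real.sq_sqrt hN.le]
  field_simp

/-- Lower bound for a Laplace integral: localisation at a shifted centre `c`. -/
theorem ofReal_le_lintegral_of_lan {π : Measure (Param d)} {φm δ N e R : ℝ} {T c : Param d}
    {g : Param d → ENNReal} (hφm : 0 < φm) (hN : 0 < N) (he : 0 ≤ e)
    (hπ : ENNReal.ofReal φm • (volume.restrict (Metric.ball (0 : Param d) δ)) ≤ π)
    (hcR : ‖c‖ + R ≤ δ * √N)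
    (hg : ∀ u ∈ Metric.ball (0 : Param d) δ,
      ENNReal.ofReal (Real.exp (√N * inner ℝ T u - N / 2 * (1 + e) * ‖u‖ ^ 2)) ≤ g u) :
    ENNReal.ofReal ((√N ^ d)⁻¹ * φm * Real.exp (inner ℝ T c - 1 / 2 * ‖c‖ ^ 2
      - 1 / 2 * e * (‖c‖ + R) ^ 2) * gaussBall d R) ≤ ∫⁻ u, g u ∂π := by
  have hs : 0 < √N := Real.sqrt_pos.2 hN
  set Q : Param d → ℝ := fun u => Real.exp (√N * inner ℝ T u - N / 2 * (1 + e) * ‖u‖ ^ 2) with hQ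
  have hQc : Continuous Q := by fun_prop
  have hQi : IntegrableOn Q (Metric.ball 0 δ) := integrableOn_ball_of_continuous hQc _ _
  have hdom : ENNReal.ofReal (φm * ∫ u in Metric.ball (0 : Param d) δ, Q u) ≤ ∫⁻ u, g u ∂π := by
    calc ENNReal.ofReal (φm * ∫ u in Metric.ball (0 : Param d) δ, Q u)
        = ENNReal.ofReal φm * ∫⁻ u in Metric.ball (0 : Param d) δ, ENNReal.ofReal (Q u) := by
          rw [ENNReal.ofReal_mul hφm.le, ofReal_integral_eq_lintegral_ofReal hQi
            (Eventually.of_forall fun u => (Real.exp_pos _).le)]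
      _ ≤ ENNReal.ofReal φm * ∫⁻ u in Metric.ball (0 : Param d) δ, g u := by
          gcongr 1
          exact setLIntegral_mono' Metric.isOpen_ball.measurableSet hg
      _ = ∫⁻ u, g u ∂(ENNReal.ofReal φm • (volume.restrict (Metric.ball (0 : Param d) δ))) := by
          rw [lintegral_smul_measure, smul_eq_mul]
      _ ≤ ∫⁻ u, g u ∂π := lintegral_mono' hπ le_rfl
  refine le_trans (ENNReal.ofReal_le_ofReal ?_) hdom
  set B := Metric.ball (0 : Param d) R
  have hmem : ∀ v ∈ B, (√N)⁻¹ • (c + v) ∈ Metric.ball (0 : Param d) δ := by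
    intro v hv
    rw [mem_ball_zero_iff] at hv ⊢
    rw [norm_smul, Real.norm_eq_abs, abs_of_pos (inv_pos.2 hs), inv_mul_lt_iff₀ hs]
    calc ‖c + v‖ ≤ ‖c‖ + ‖v‖ := norm_add_le _ _
      _ < ‖c‖ + R := by linarith
      _ ≤ √N * δ := by linarith
  -- Only the image of the ball of radius `R` under `v ↦ (c + v) / √N` is kept; `hcR` places it
  -- inside the ball of radius `δ`.
  have hscale : (√N ^ d)⁻¹ * ∫ v in B, Q ((√N)⁻¹ • (c + v)) ≤
      ∫ u in Metric.ball (0 : Param d) δ, Q u := by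
    have h1 := integral_comp_add_div_sqrt N ((Metric.ball (0 : Param d) δ).indicator Q) c
    rw [integral_indicator Metric.isOpen_ball.measurableSet] at h1
    rw [inv_mul_le_iff₀ (by positivity), ← h1]
    rw [← integral_indicator Metric.isOpen_ball.measurableSet]
    refine integral_mono_of_nonneg (Eventually.of_forall fun v => ?_) ?_
      (Eventually.of_forall fun v => ?_)
    · exact Set.indicator_nonneg (fun _ _ => (Real.exp_pos _).le) _
    · have : Integrable ((Metric.ball (0 : Param d) δ).indicator Q) :=
        hQi.integrable_indicator Metric.isOpen_ball.measurableSet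
      exact (this.comp_smul (inv_ne_zero hs.ne')).comp_add_left c
    · by_cases hv : v ∈ B
      · rw [Set.indicator_of_mem hv]
        exact (Set.indicator_of_mem (hmem v hv) Q).ge
      · rw [Set.indicator_of_notMem hv]
        exact Set.indicator_nonneg (fun _ _ => (Real.exp_pos _).le) _
  -- In the variable `v` the exponent is `⟪T, c⟫ - ‖c‖²/2 + ⟪T - c, v⟫ - ‖v‖²/2 - (e/2)‖c + v‖²`.
  -- The tilt by `T - c` is dropped by symmetry, so the centre `c` is free and need not be `T`
  -- itself.
  have hgauss : Real.exp (inner ℝ T c - 1 / 2 * ‖c‖ ^ 2 - 1 / 2 * e * (‖c‖ + R) ^ 2) * gaussBall d R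
      ≤ ∫ v in B, Q ((√N)⁻¹ • (c + v)) := by
    calc _ ≤ Real.exp (inner ℝ T c - 1 / 2 * ‖c‖ ^ 2 - 1 / 2 * e * (‖c‖ + R) ^ 2) *
          ∫ v in B, Real.exp (inner ℝ (T - c) v - (1 / 2) * ‖v‖ ^ 2) := by
          gcongr
          exact gaussBall_le_integral_tilt _ _
      _ = ∫ v in B, Real.exp (inner ℝ T c - 1 / 2 * ‖c‖ ^ 2 - 1 / 2 * e * (‖c‖ + R) ^ 2) *
          Real.exp (inner ℝ (T - c) v - (1 / 2) * ‖v‖ ^ 2) := by rw [integral_const_mul]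
      _ ≤ _ := by
          refine setIntegral_mono_on (integrableOn_ball_of_continuous (by fun_prop) _ _)
            (integrableOn_ball_of_continuous (by fun_prop) _ _)
            Metric.isOpen_ball.measurableSet fun v hv => ?_
          rw [hQ, ← Real.exp_add]
          simp only
          rw [Real.exp_le_exp, lan_quadratic_rescale hN]
          have hv' : ‖v‖ < R := by simpa [B] using hv
          have h1 : ‖c + v‖ ^ 2 = ‖c‖ ^ 2 + 2 * inner ℝ c v + ‖v‖ ^ 2 := norm_add_sq_real c v
          have h2 : ‖c + v‖ ^ 2 ≤ (‖c‖ + R) ^ 2 := by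
            have : ‖c + v‖ ≤ ‖c‖ + R := (norm_add_le _ _).trans (by linarith)
            gcongr
          have h3 : e * ‖c + v‖ ^ 2 ≤ e * (‖c‖ + R) ^ 2 := by gcongr
          rw [inner_add_right, inner_sub_left]
          nlinarith
  calc _ = φm * ((√N ^ d)⁻¹ * (Real.exp (inner ℝ T c - 1 / 2 * ‖c‖ ^ 2
      - 1 / 2 * e * (‖c‖ + R) ^ 2) * gaussBall d R)) := by ring
    _ ≤ _ := by gcongr; exact le_trans (by gcongr) hscale

/-- Complete the square at `u = T / (a √N)`. -/
theorem integral_exp_inner_sub_norm_sq {N a : ℝ} (hN : 0 < N) (ha : 0 < a) (T : Param d) :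
    Integrable (fun u : Param d => Real.exp (√N * inner ℝ T u - N / 2 * a * ‖u‖ ^ 2)) ∧
    ∫ u : Param d, Real.exp (√N * inner ℝ T u - N / 2 * a * ‖u‖ ^ 2) =
      (√N ^ d)⁻¹ * ((2 * Real.pi / a) ^ ((d : ℝ) / 2) * Real.exp (‖T‖ ^ 2 / (2 * a))) := by
  have hs : 0 < √N := Real.sqrt_pos.2 hN
  set Q : Param d → ℝ := fun u => Real.exp (√N * inner ℝ T u - N / 2 * a * ‖u‖ ^ 2) with hQ
  have hfun : (fun v => Q ((√N)⁻¹ • (a⁻¹ • T + v))) =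
      fun v => Real.exp (‖T‖ ^ 2 / (2 * a)) * Real.exp (-(a / 2) * ‖v‖ ^ 2) := by
    funext v
    rw [hQ]
    simp only
    rw [lan_quadratic_rescale hN, ← Real.exp_add, norm_add_sq_real, inner_add_right,
      inner_smul_right, inner_smul_left, norm_smul, real_inner_self_eq_norm_sq, mul_pow,
      Real.norm_eq_abs, sq_abs]
    congr 1
    simp only [map_inv₀, conj_trivial]
    field_simp
    ring
  have hG := integrable_exp_neg_mul_norm_sq (d := d) (b := a / 2) (by positivity)
  have hi : Integrable (fun v => Q ((√N)⁻¹ • (a⁻¹ • T + v))) := by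
    rw [hfun]; exact hG.const_mul _
  constructor
  · have h1 := hi.comp_add_left (-(a⁻¹ • T))
    simp only [add_neg_cancel_left] at h1
    have h2 := h1.comp_smul hs.ne'
    simpa [smul_smul, hs.ne'] using h2
  · have h := integral_comp_add_div_sqrt N Q (a⁻¹ • T)
    rw [hfun, integral_const_mul, integral_exp_neg_mul_norm_sq (by positivity)] at h
    rw [eq_inv_mul_iff_mul_eq₀ (by positivity), ← h, mul_comm]
    congr 2
    field_simp

/-- Upper bound for a Laplace integral near its centre. -/
theorem setLIntegral_le_ofReal_of_lan {π : Measure (Param d)} {φp δ N e a : ℝ} {T : Param d}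
    {g : Param d → ENNReal} (hφp : 0 < φp) (hN : 0 < N) (ha : 0 < a) (hea : a ≤ 1 - e)
    (hπ : π.restrict (Metric.ball (0 : Param d) δ) ≤ ENNReal.ofReal φp • volume)
    (hg : ∀ u ∈ Metric.ball (0 : Param d) δ,
      g u ≤ ENNReal.ofReal (Real.exp (√N * inner ℝ T u - N / 2 * (1 - e) * ‖u‖ ^ 2))) :
    ∫⁻ u in Metric.ball 0 δ, g u ∂π ≤ ENNReal.ofReal (φp * ((√N ^ d)⁻¹ *
      ((2 * Real.pi / a) ^ ((d : ℝ) / 2) * Real.exp (‖T‖ ^ 2 / (2 * a))))) := by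
  obtain ⟨h1, h2⟩ := integral_exp_inner_sub_norm_sq hN ha T
  calc ∫⁻ u in Metric.ball 0 δ, g u ∂π
      ≤ ∫⁻ u in Metric.ball 0 δ,
        ENNReal.ofReal (Real.exp (√N * inner ℝ T u - N / 2 * a * ‖u‖ ^ 2)) ∂π := by
        refine setLIntegral_mono' Metric.isOpen_ball.measurableSet fun u hu => (hg u hu).trans ?_
        gcongr
    _ ≤ ∫⁻ u, ENNReal.ofReal (Real.exp (√N * inner ℝ T u - N / 2 * a * ‖u‖ ^ 2))
          ∂(ENNReal.ofReal φp • (volume : Measure (Param d))) := lintegral_mono' hπ le_rfl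
    _ = _ := by
        rw [lintegral_smul_measure, smul_eq_mul, ← ofReal_integral_eq_lintegral_ofReal h1
          (Eventually.of_forall fun u => (Real.exp_pos _).le), h2, ENNReal.ofReal_mul hφp.le]

end GaussianBounds


/-! ### Asymptotics of the expected log evidence in a locally asymptotically normal model -/

section AbstractEvidence

/-- A sequence of likelihood ratios `ρ n u`, `u ∈ ℝᵈ`, against probability measures `P n`, with a
prior `π` of local density `φ₀` at the origin, that is locally asymptotically normal at the origin
with identity information matrix, in the quantitative form that controls expectations of the log
evidence. -/
structure IsLocallyNormal {d : ℕ} {Ω : ℕ → Type*} [∀ n, MeasurableSpace (Ω n)]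
    (P : ∀ n, Measure (Ω n)) (π : Measure (Param d)) (ρ : ∀ n, Param d → Ω n → ℝ)
    (T : ∀ n, Ω n → Param d) (φ₀ : ℝ) : Prop where
  measurable : ∀ n, Measurable (Function.uncurry (ρ n))
  lintegral_le : ∀ n, ∀ᵐ u ∂π, ∫⁻ ω, ENNReal.ofReal (ρ n u ω) ∂P n ≤ 1
  density_pos : 0 < φ₀
  density : ∀ φm φp, 0 < φm → φm < φ₀ → φ₀ < φp → ∃ δ > 0,
    ENNReal.ofReal φm • (volume.restrict (Metric.ball (0 : Param d) δ)) ≤ π ∧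
    π.restrict (Metric.ball (0 : Param d) δ) ≤ ENNReal.ofReal φp • volume
  score_memLp : ∀ n i, MemLp (fun ω => T n ω i) 2 (P n)
  score_sq : ∀ n : ℕ, 1 ≤ n → ∀ i, ∫ ω, T n ω i ^ 2 ∂P n ≤ 1
  score_clip : ∀ η > 0, ∃ M > 0, ∀ i, ∀ᶠ n in atTop,
    1 - η ≤ ∫ ω, min (T n ω i ^ 2) (M ^ 2) ∂P n
  lan : ∀ ε > 0, ∃ δ > 0, ∃ e : ∀ n, Ω n → ℝ,
    (∀ n, Integrable (e n) (P n) ∧ ∀ ω, 0 ≤ e n ω) ∧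
    (∀ᶠ n in atTop, ∫ ω, e n ω ∂P n ≤ ε) ∧
    Tendsto (fun n : ℕ => (P n).real {ω | ε < e n ω} * Real.log n) atTop (𝓝 0) ∧
    ∀ n : ℕ, 1 ≤ n → ∀ᵐ ω ∂P n, ∀ u ∈ Metric.ball (0 : Param d) δ,
      Real.exp (√n * inner ℝ (T n ω) u - n / 2 * (1 + e n ω) * ‖u‖ ^ 2) ≤ ρ n u ω ∧
      ρ n u ω ≤ Real.exp (√n * inner ℝ (T n ω) u - n / 2 * (1 - e n ω) * ‖u‖ ^ 2)
  tests : ∀ δ > 0, ∃ c > 0, ∃ C : ℝ, ∃ A : ∀ n, Set (Ω n), (∀ n, MeasurableSet (A n)) ∧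
    Tendsto (fun n : ℕ => (P n).real (A n)ᶜ * Real.log n) atTop (𝓝 0) ∧
    ∀ n, ∀ᵐ u ∂π, δ ≤ ‖u‖ →
      ∫⁻ ω in A n, ENNReal.ofReal (ρ n u ω) ∂P n ≤ ENNReal.ofReal (C * Real.exp (-c * n))

variable {d : ℕ} {Ω : ℕ → Type*} [∀ n, MeasurableSpace (Ω n)]
  {P : ∀ n, Measure (Ω n)} [∀ n, IsProbabilityMeasure (P n)]
  {π : Measure (Param d)} [IsProbabilityMeasure π] {ρ : ∀ n, Param d → Ω n → ℝ}
  {T : ∀ n, Ω n → Param d} {φ₀ : ℝ}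

namespace IsLocallyNormal

omit [∀ n, IsProbabilityMeasure (P n)] in
theorem measurable_evidence (h : IsLocallyNormal P π ρ T φ₀) (n : ℕ) (s : Set (Param d)) :
    Measurable fun ω => ∫⁻ u in s, ENNReal.ofReal (ρ n u ω) ∂π := by
  have := (h.measurable n).ennreal_ofReal
  exact Measurable.lintegral_prod_left' (f := fun a : Param d × Ω n =>
    ENNReal.ofReal (ρ n a.1 a.2)) this

theorem setLIntegral_evidence_swap (h : IsLocallyNormal P π ρ T φ₀) (n : ℕ) (s : Set (Param d))
    (A : Set (Ω n)) :
    ∫⁻ ω in A, ∫⁻ u in s, ENNReal.ofReal (ρ n u ω) ∂π ∂P n =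
      ∫⁻ u in s, ∫⁻ ω in A, ENNReal.ofReal (ρ n u ω) ∂P n ∂π := by
  rw [lintegral_lintegral_swap]
  have := ((h.measurable n).comp measurable_swap).ennreal_ofReal
  exact this.aemeasurable

/-- By Tonelli the evidence is a mixture of likelihood ratios, each of mean at most one. This is the
only control of the evidence on exceptional events. -/
theorem lintegral_evidence_le (h : IsLocallyNormal P π ρ T φ₀) (n : ℕ) :
    ∫⁻ ω, ∫⁻ u, ENNReal.ofReal (ρ n u ω) ∂π ∂P n ≤ 1 := by
  have h1 := h.setLIntegral_evidence_swap n Set.univ Set.univ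
  simp only [Measure.restrict_univ] at h1
  rw [h1]
  calc _ ≤ ∫⁻ _, 1 ∂π := lintegral_mono_ae (h.lintegral_le n)
    _ = 1 := by simp

theorem ae_evidence_lt_top (h : IsLocallyNormal P π ρ T φ₀) (n : ℕ) :
    ∀ᵐ ω ∂P n, ∫⁻ u, ENNReal.ofReal (ρ n u ω) ∂π < ⊤ := by
  refine ae_lt_top ?_ ((h.lintegral_evidence_le n).trans_lt ENNReal.one_lt_top).ne
  simpa using h.measurable_evidence n Set.univ

theorem integrable_evidence (h : IsLocallyNormal P π ρ T φ₀) (n : ℕ) :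
    Integrable (fun ω => (∫⁻ u, ENNReal.ofReal (ρ n u ω) ∂π).toReal) (P n) := by
  refine integrable_toReal_of_lintegral_ne_top ?_
    ((h.lintegral_evidence_le n).trans_lt ENNReal.one_lt_top).ne
  simpa using (h.measurable_evidence n Set.univ).aemeasurable

theorem integral_evidence_le (h : IsLocallyNormal P π ρ T φ₀) (n : ℕ) :
    ∫ ω, (∫⁻ u, ENNReal.ofReal (ρ n u ω) ∂π).toReal ∂P n ≤ 1 := by
  rw [integral_toReal]
  · exact ENNReal.toReal_le_of_le_ofReal zero_le_one (by simpa using h.lintegral_evidence_le n)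
  · simpa using (h.measurable_evidence n Set.univ).aemeasurable
  · exact h.ae_evidence_lt_top n

theorem log_sqrt_pow {d : ℕ} (n : ℕ) : Real.log (√(n : ℝ) ^ d) = (d : ℝ) / 2 * Real.log n := by
  rw [Real.log_pow, Real.log_sqrt (Nat.cast_nonneg n)]
  ring

omit [∀ n, MeasurableSpace (Ω n)] [∀ n, IsProbabilityMeasure (P n)] [IsProbabilityMeasure π] in
/-- The pointwise lower bound of the log evidence. -/
theorem le_log_evidence {n : ℕ} (hn : 1 ≤ n) {φm δ R e M : ℝ}
    {c T : Param d} {ω : Ω n} (hφm : 0 < φm) (hR : 0 < R) (he : 0 ≤ e) (hc : ‖c‖ ≤ M)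
    (hM : M + R ≤ δ * √n)
    (hπ : ENNReal.ofReal φm • (volume.restrict (Metric.ball (0 : Param d) δ)) ≤ π)
    (hfin : ∫⁻ u, ENNReal.ofReal (ρ n u ω) ∂π < ⊤)
    (hlan : ∀ u ∈ Metric.ball (0 : Param d) δ,
      Real.exp (√n * inner ℝ T u - n / 2 * (1 + e) * ‖u‖ ^ 2) ≤ ρ n u ω) :
    0 < (∫⁻ u, ENNReal.ofReal (ρ n u ω) ∂π).toReal ∧
    -((d : ℝ) / 2 * Real.log n) + Real.log φm + (inner ℝ T c - 1 / 2 * ‖c‖ ^ 2)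
      - 1 / 2 * e * (M + R) ^ 2 + Real.log (gaussBall d R) ≤
      Real.log (∫⁻ u, ENNReal.ofReal (ρ n u ω) ∂π).toReal := by
  have hn0 : (0 : ℝ) < n := by exact_mod_cast hn
  have hs : 0 < √(n : ℝ) := Real.sqrt_pos.2 hn0
  have h1 := ofReal_le_lintegral_of_lan (π := π) (T := T) (c := c) (e := e) (R := R) hφm hn0 he hπ
    (by linarith) (g := fun u => ENNReal.ofReal (ρ n u ω))
    fun u hu => ENNReal.ofReal_le_ofReal (hlan u hu)
  rw [ENNReal.ofReal_le_iff_le_toReal hfin.ne] at h1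
  have hJ := gaussBall_pos (d := d) hR
  refine ⟨lt_of_lt_of_le (by positivity) h1, ?_⟩
  refine le_trans ?_ (Real.log_le_log (by positivity) h1)
  rw [Real.log_mul (by positivity) hJ.ne', Real.log_mul (by positivity) (Real.exp_pos _).ne',
    Real.log_mul (by positivity) hφm.ne', Real.log_inv, log_sqrt_pow, Real.log_exp]
  have : e * (‖c‖ + R) ^ 2 ≤ e * (M + R) ^ 2 := by
    have := norm_nonneg c
    gcongr
  linarith

/-- Finiteness for every `n ≥ 1`, not only for large `n`. From below, localisation at the centre `0`
with the full radius `δ √n` gives a bound that is affine in the integrable error; from above, `log Z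
≤ Z - 1` and `Z` is integrable. -/
theorem ae_evidence_pos_and_integrable_log (h : IsLocallyNormal P π ρ T φ₀) {n : ℕ} (hn : 1 ≤ n) :
    (∀ᵐ ω ∂P n, 0 < (∫⁻ u, ENNReal.ofReal (ρ n u ω) ∂π).toReal) ∧
    Integrable (fun ω => Real.log (∫⁻ u, ENNReal.ofReal (ρ n u ω) ∂π).toReal) (P n) := by
  have hn0 : (0 : ℝ) < n := by exact_mod_cast hn
  have hs : 0 < √(n : ℝ) := Real.sqrt_pos.2 hn0
  obtain ⟨δ₁, hδ₁, e, he, -, -, hlan⟩ := h.lan 1 one_pos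
  have hφ := h.density_pos
  obtain ⟨δ₂, hδ₂, hπ, -⟩ := h.density (φ₀ / 2) (φ₀ + 1) (by linarith) (by linarith) (by linarith)
  set δ := min δ₁ δ₂
  have hδ : 0 < δ := lt_min hδ₁ hδ₂
  have hπ' : ENNReal.ofReal (φ₀ / 2) • (volume.restrict (Metric.ball (0 : Param d) δ)) ≤ π := by
    refine le_trans ?_ hπ
    gcongr
    exact min_le_right _ _
  have key : ∀ᵐ ω ∂P n, 0 < (∫⁻ u, ENNReal.ofReal (ρ n u ω) ∂π).toReal ∧
    -((d : ℝ) / 2 * Real.log n) + Real.log (φ₀ / 2) + 0 - 1 / 2 * e n ω * (0 + δ * √n) ^ 2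
      + Real.log (gaussBall d (δ * √n)) ≤
      Real.log (∫⁻ u, ENNReal.ofReal (ρ n u ω) ∂π).toReal := by
    filter_upwards [hlan n hn, h.ae_evidence_lt_top n] with ω h1 h2
    have := le_log_evidence hn (c := 0) (T := T n ω) (R := δ * √n) (M := 0) (e := e n ω)
      (half_pos hφ) (by positivity) ((he n).2 ω) (by simp) (by simp) hπ' h2
      fun u hu => (h1 u (Metric.ball_subset_ball (min_le_left _ _) hu)).1
    simpa using this
  refine ⟨key.mono fun ω hω => hω.1, ?_⟩
  have hi := h.integrable_evidence n
  refine Integrable.mono' (g := fun ω => (∫⁻ u, ENNReal.ofReal (ρ n u ω) ∂π).toReal +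
    (|-((d : ℝ) / 2 * Real.log n) + Real.log (φ₀ / 2) + Real.log (gaussBall d (δ * √n))| +
      1 / 2 * e n ω * (0 + δ * √n) ^ 2)) ?_ ?_ ?_
  · exact hi.add ((integrable_const _).add (((he n).1.const_mul _).mul_const _))
  · exact (Real.measurable_log.comp_aemeasurable hi.aemeasurable).aestronglyMeasurable
  · filter_upwards [key] with ω hω
    have h1 := Real.log_le_sub_one_of_pos hω.1
    have h2 := neg_abs_le (-((d : ℝ) / 2 * Real.log n) + Real.log (φ₀ / 2) +
      Real.log (gaussBall d (δ * √n)))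
    have h3 : 0 ≤ 1 / 2 * e n ω * (0 + δ * √n) ^ 2 := by
      have := (he n).2 ω
      positivity
    rw [Real.norm_eq_abs, abs_le]
    constructor
    · linarith [hω.2, hω.1]
    · have := abs_nonneg (-((d : ℝ) / 2 * Real.log n) + Real.log (φ₀ / 2) +
        Real.log (gaussBall d (δ * √n)))
      linarith

/-- Take `c` to be `t` clipped to `[-M, M]` in each coordinate. Where `|t i| ≤ M` the quadratic is
maximal with value `t i ^ 2 / 2`; elsewhere it is `|t i| M - M² / 2 ≥ M² / 2`. -/
theorem exists_clip (M : ℝ) (hM : 0 < M) (t : Param d) : ∃ c : Param d, ‖c‖ ≤ √d * M ∧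
    1 / 2 * ∑ i, min (t i ^ 2) (M ^ 2) ≤ inner ℝ t c - 1 / 2 * ‖c‖ ^ 2 := by
  refine ⟨WithLp.toLp 2 fun i => max (-M) (min (t i) M), ?_, ?_⟩
  · rw [EuclideanSpace.norm_eq, Real.sqrt_le_left (by positivity), mul_pow,
      Real.sq_sqrt (Nat.cast_nonneg d)]
    calc _ ≤ ∑ _i : Fin d, M ^ 2 := by
          refine Finset.sum_le_sum fun i _ => ?_
          simp only [Real.norm_eq_abs, sq_abs]
          refine sq_le_sq' (le_max_left _ _) (max_le (by linarith) (min_le_right _ _))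
      _ = _ := by simp
  · rw [EuclideanSpace.norm_sq_eq, PiLp.inner_apply, Finset.mul_sum, Finset.mul_sum,
      ← Finset.sum_sub_distrib]
    refine Finset.sum_le_sum fun i _ => ?_
    simp only [Real.norm_eq_abs, sq_abs, RCLike.inner_apply, conj_trivial]
    rcases le_total (t i) M with h1 | h1
    · rw [min_eq_left h1]
      rcases le_total (-M) (t i) with h2 | h2
      · rw [max_eq_right h2]
        have := min_le_left (t i ^ 2) (M ^ 2)
        nlinarith
      · rw [max_eq_left h2]
        have := min_le_right (t i ^ 2) (M ^ 2)
        nlinarith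
    · rw [min_eq_right h1, max_eq_right (by linarith)]
      have := min_le_right (t i ^ 2) (M ^ 2)
      nlinarith

/-- The error term is `e (‖c‖ + R)²` and `e` is controlled only in mean. A clipped centre bounds the
second factor by a constant `S²`, at the price of replacing `‖T‖²` by truncated squares, whose means
are almost `1`. -/
theorem eventually_lower (h : IsLocallyNormal P π ρ T φ₀) {y : ℝ}
    (hy : y < Real.log φ₀ + (d : ℝ) / 2 * Real.log (2 * Real.pi) + d / 2) :
    ∀ᶠ n : ℕ in atTop, y ≤ (d : ℝ) / 2 * Real.log n +
      ∫ ω, Real.log (∫⁻ u, ENNReal.ofReal (ρ n u ω) ∂π).toReal ∂P n := by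
  have hφ := h.density_pos
  set lim := Real.log φ₀ + (d : ℝ) / 2 * Real.log (2 * Real.pi) + d / 2 with hlim
  -- One quarter of the gap each for the local density, the Gaussian mass outside radius `R`, the
  -- clipping and the quadratic error.
  set η := (lim - y) / 4 with hη
  have hηpos : 0 < η := by rw [hη]; linarith
  -- the local density
  obtain ⟨φm, hφm0, hφm1, hφm⟩ : ∃ φm, 0 < φm ∧ φm < φ₀ ∧ Real.log φ₀ - η ≤ Real.log φm := by
    refine ⟨φ₀ * Real.exp (-η), by positivity, ?_, ?_⟩
    · have : Real.exp (-η) < 1 := by rw [Real.exp_lt_one_iff]; linarith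
      nlinarith
    · rw [Real.log_mul hφ.ne' (Real.exp_pos _).ne', Real.log_exp]
      linarith
  -- the radius
  obtain ⟨R, hR, hJ⟩ : ∃ R > 0, (d : ℝ) / 2 * Real.log (2 * Real.pi) - η ≤
      Real.log (gaussBall d R) := by
    have h1 : Tendsto (fun R => Real.log (gaussBall d R)) atTop
        (𝓝 (Real.log ((2 * Real.pi) ^ ((d : ℝ) / 2)))) :=
      (Real.continuousAt_log (by positivity)).tendsto.comp tendsto_gaussBall
    rw [Real.log_rpow (by positivity)] at h1
    obtain ⟨R, h2, h3⟩ := ((h1.eventually (eventually_ge_nhds (sub_lt_self _ hηpos))).and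
      (eventually_gt_atTop 0)).exists
    exact ⟨R, h3, h2⟩
  -- Over `d` coordinates the loss is at most `2 * η`, halved by the factor `1 / 2` of the quadratic
  -- form; `d + 1` also covers `d = 0`.
  obtain ⟨M, hM, hclip⟩ := h.score_clip (2 * η / (d + 1)) (by positivity)
  set S := √d * M + R with hS
  have hSpos : 0 < S := by positivity
  obtain ⟨δ₁, hδ₁, e, he, hemean, -, hlan⟩ := h.lan (2 * η / S ^ 2) (by positivity)
  obtain ⟨δ₂, hδ₂, hπ, -⟩ := h.density φm (φ₀ + 1) hφm0 hφm1 (by linarith)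
  set δ := min δ₁ δ₂
  have hδ : 0 < δ := lt_min hδ₁ hδ₂
  have hπ' : ENNReal.ofReal φm • (volume.restrict (Metric.ball (0 : Param d) δ)) ≤ π := by
    refine le_trans ?_ hπ
    gcongr
    exact min_le_right _ _
  have hlarge : ∀ᶠ n : ℕ in atTop, S ≤ δ * √n :=
    ((Real.tendsto_sqrt_atTop.comp tendsto_natCast_atTop_atTop).const_mul_atTop
      hδ).eventually_ge_atTop S
  have hclip' : ∀ᶠ n in atTop, ∀ i, 1 - 2 * η / (d + 1) ≤ ∫ ω, min (T n ω i ^ 2) (M ^ 2) ∂P n :=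
    eventually_all.2 hclip
  filter_upwards [hlarge, hclip', hemean, eventually_ge_atTop 1] with n h1 h2 h3 hn
  obtain ⟨-, hint⟩ := h.ae_evidence_pos_and_integrable_log hn
  have hminint : ∀ i, Integrable (fun ω => min (T n ω i ^ 2) (M ^ 2)) (P n) := fun i =>
    (h.score_memLp n i).integrable_sq.inf (integrable_const _)
  have hptw : ∀ᵐ ω ∂P n, (-((d : ℝ) / 2 * Real.log n) + Real.log φm + Real.log (gaussBall d R)) +
      1 / 2 * ∑ i, min (T n ω i ^ 2) (M ^ 2) - 1 / 2 * S ^ 2 * e n ω ≤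
      Real.log (∫⁻ u, ENNReal.ofReal (ρ n u ω) ∂π).toReal := by
    filter_upwards [hlan n hn, h.ae_evidence_lt_top n] with ω g1 g2
    obtain ⟨c, hc1, hc2⟩ := exists_clip M hM (T n ω)
    have := (le_log_evidence hn (c := c) (T := T n ω) (R := R) (M := √d * M) (e := e n ω)
      hφm0 hR ((he n).2 ω) hc1 h1 hπ' g2
      fun u hu => (g1 u (Metric.ball_subset_ball (min_le_left _ _) hu)).1).2
    rw [← hS] at this
    linarith
  have i1 : Integrable (fun ω => (-((d : ℝ) / 2 * Real.log n) + Real.log φm +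
      Real.log (gaussBall d R)) + 1 / 2 * ∑ i, min (T n ω i ^ 2) (M ^ 2)) (P n) :=
    (integrable_const _).add ((integrable_finsetSum _ fun i _ => hminint i).const_mul _)
  have i2 := (he n).1.const_mul (1 / 2 * S ^ 2)
  have hmono := integral_mono_ae (i1.sub i2) hint hptw
  simp only [Pi.sub_apply] at hmono
  rw [integral_sub i1 i2, integral_add (integrable_const _)
    ((integrable_finsetSum _ fun i _ => hminint i).const_mul _), integral_const_mul,
    integral_const_mul, integral_finsetSum _ fun i _ => hminint i, integral_const] at hmono
  simp only [probReal_univ, one_smul] at hmono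
  have hsum : (d : ℝ) - 2 * η ≤ ∑ i, ∫ ω, min (T n ω i ^ 2) (M ^ 2) ∂P n := by
    calc (d : ℝ) - 2 * η ≤ d * (1 - 2 * η / (d + 1)) := by
          have : (d : ℝ) * (2 * η / (d + 1)) ≤ 2 * η := by
            rw [mul_div_assoc', div_le_iff₀ (by positivity)]
            nlinarith
          rw [mul_sub]
          linarith
      _ = ∑ _i : Fin d, (1 - 2 * η / (d + 1)) := by
          simp only [Finset.sum_const, Finset.card_univ, Fintype.card_fin, nsmul_eq_mul]
      _ ≤ _ := Finset.sum_le_sum fun i _ => h2 i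
  have hee : 1 / 2 * S ^ 2 * ∫ ω, e n ω ∂P n ≤ η := by
    calc 1 / 2 * S ^ 2 * ∫ ω, e n ω ∂P n ≤ 1 / 2 * S ^ 2 * (2 * η / S ^ 2) := by gcongr
      _ = η := by field_simp
  have : y = lim - 4 * η := by rw [hη]; ring
  linarith

/-- Off a bad event the evidence is at most `1 + ε` times the Gaussian integral near the origin. On
the bad event the favourable term `-(d/2) log n` is lost, which costs its probability times `(d/2)
log n`; this is why all exceptional probabilities must be `o(1 / log n)`. -/
theorem eventually_upper_aux (h : IsLocallyNormal P π ρ T φ₀) {ε : ℝ} (hε : 0 < ε) (hε1 : ε < 1) :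
    ∀ᶠ n : ℕ in atTop, (d : ℝ) / 2 * Real.log n +
      ∫ ω, Real.log (∫⁻ u, ENNReal.ofReal (ρ n u ω) ∂π).toReal ∂P n ≤
      Real.log (1 + ε) + Real.log (φ₀ + ε) + (d : ℝ) / 2 * Real.log (2 * Real.pi / (1 - ε)) +
        d / (2 * (1 - ε)) + 2 * ε := by
  have hφ := h.density_pos
  set a := 1 - ε with ha
  have hapos : 0 < a := by linarith
  obtain ⟨δ₁, hδ₁, e, he, -, hebad, hlan⟩ := h.lan ε hε
  obtain ⟨δ₂, hδ₂, -, hπ⟩ := h.density (φ₀ / 2) (φ₀ + ε) (by linarith) (by linarith) (by linarith)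
  set δ := min δ₁ δ₂
  have hδ : 0 < δ := lt_min hδ₁ hδ₂
  have hπ' : π.restrict (Metric.ball (0 : Param d) δ) ≤ ENNReal.ofReal (φ₀ + ε) • volume :=
    le_trans (Measure.restrict_mono (Metric.ball_subset_ball (min_le_right _ _)) le_rfl) hπ
  obtain ⟨c, hc, C, A, hA, hAbad, htest⟩ := h.tests δ hδ
  set F : ∀ n, Ω n → ENNReal := fun n ω =>
    ∫⁻ u in (Metric.ball (0 : Param d) δ)ᶜ, ENNReal.ofReal (ρ n u ω) ∂π with hF
  have hFm : ∀ n, Measurable (F n) := fun n => h.measurable_evidence n _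
  -- Half of the exponential rate: the far mass has mean at most `C exp (-c n)` on `A n`, so by
  -- Markov it exceeds `t n` there with probability at most `C⁺ t n`, with `C⁺ = max C 0`, while `t
  -- n` is still negligible against `n ^ (-d/2)`.
  set t : ℕ → ℝ := fun n => Real.exp (-(c / 2) * n) with ht
  set D : ∀ n, Set (Ω n) := fun n => {ω | ENNReal.ofReal (t n) ≤ F n ω} ∩ A n with hD
  set B : ∀ n, Set (Ω n) := fun n => {ω | ε < e n ω} ∪ (A n)ᶜ ∪ D n with hB
  have hBm : ∀ n, NullMeasurableSet (B n) (P n) := fun n =>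
    ((nullMeasurableSet_lt aemeasurable_const (he n).1.aemeasurable).union
      (hA n).compl.nullMeasurableSet).union
      ((measurableSet_le measurable_const (hFm n)).inter (hA n)).nullMeasurableSet
  have hfar : ∀ n, ∫⁻ ω in A n, F n ω ∂P n ≤ ENNReal.ofReal (C * Real.exp (-c * n)) := by
    intro n
    rw [hF, h.setLIntegral_evidence_swap]
    calc _ ≤ ∫⁻ u in (Metric.ball (0 : Param d) δ)ᶜ, ENNReal.ofReal (C * Real.exp (-c * n)) ∂π := by
          refine setLIntegral_mono_ae' Metric.isOpen_ball.measurableSet.compl ?_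
          filter_upwards [htest n] with u hu hu'
          exact hu (by simpa using hu')
      _ ≤ _ := by
          rw [setLIntegral_const]
          exact mul_le_of_le_one_right' prob_le_one
  have hDbad : ∀ n, (P n).real (D n) ≤ max C 0 * t n := by
    intro n
    have h1 : ENNReal.ofReal (t n) * (P n) (D n) ≤ ENNReal.ofReal (C * Real.exp (-c * n)) := by
      have := mul_meas_ge_le_lintegral (μ := (P n).restrict (A n)) (hFm n) (ENNReal.ofReal (t n))
      rw [Measure.restrict_apply (measurableSet_le measurable_const (hFm n))] at this
      exact this.trans (hfar n)
    have h2 := ENNReal.toReal_mono ENNReal.ofReal_ne_top h1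
    have htpos : 0 < t n := Real.exp_pos _
    rw [ENNReal.toReal_mul, ENNReal.toReal_ofReal htpos.le] at h2
    have h3 : (ENNReal.ofReal (C * Real.exp (-c * n))).toReal ≤ max C 0 * (t n * t n) := by
      have : t n * t n = Real.exp (-c * n) := by rw [ht, ← Real.exp_add]; ring_nf
      rw [this]
      refine ENNReal.toReal_le_of_le_ofReal (by positivity) (ENNReal.ofReal_le_ofReal ?_)
      gcongr
      exact le_max_left _ _
    have h4 : t n * (P n).real (D n) ≤ t n * (max C 0 * t n) := by
      rw [Measure.real]; linarith
    exact le_of_mul_le_mul_left h4 htpos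
  have hpow : ∀ k : ℕ, Tendsto (fun n : ℕ => (n : ℝ) ^ k * t n) atTop (𝓝 0) := by
    intro k
    have h1 := (Real.tendsto_pow_mul_exp_neg_atTop_nhds_zero k).comp
      (tendsto_natCast_atTop_atTop.const_mul_atTop (half_pos hc))
    have h2 := h1.const_mul (((c / 2) ^ k)⁻¹)
    rw [mul_zero] at h2
    refine h2.congr fun n => ?_
    simp only [Function.comp, ht, mul_pow]
    field_simp
  have hDlog : Tendsto (fun n : ℕ => (P n).real (D n) * Real.log n) atTop (𝓝 0) := by
    have h1 := (hpow 1).const_mul (max C 0)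
    rw [mul_zero] at h1
    refine squeeze_zero' ?_ ?_ h1
    · filter_upwards with n
      exact mul_nonneg measureReal_nonneg (Real.log_natCast_nonneg n)
    · filter_upwards with n
      calc _ ≤ (max C 0 * t n) * n := by
            gcongr
            · exact hDbad n
            · exact Real.log_le_self (Nat.cast_nonneg n)
        _ = _ := by ring
  have hBlog : Tendsto (fun n : ℕ => (P n).real (B n) * Real.log n) atTop (𝓝 0) := by
    have h1 := (hebad.add hAbad).add hDlog
    simp only [add_zero] at h1
    refine squeeze_zero' ?_ ?_ h1
    · filter_upwards with n
      exact mul_nonneg measureReal_nonneg (Real.log_natCast_nonneg n)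
    · filter_upwards with n
      rw [← add_mul, ← add_mul]
      refine mul_le_mul_of_nonneg_right ?_ (Real.log_natCast_nonneg n)
      exact (measureReal_union_le _ _).trans (by gcongr; exact measureReal_union_le _ _)
  have hB0 : Tendsto (fun n : ℕ => (P n).real (B n)) atTop (𝓝 0) := by
    refine squeeze_zero' (Eventually.of_forall fun n => measureReal_nonneg) ?_ hBlog
    have := (Real.tendsto_log_atTop.comp tendsto_natCast_atTop_atTop).eventually_ge_atTop 1
    filter_upwards [this] with n hn
    exact le_mul_of_one_le_right measureReal_nonneg hn
  set G : ℝ := (2 * Real.pi / a) ^ ((d : ℝ) / 2) with hG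
  have hGpos : 0 < G := by positivity
  set K : ℝ := Real.log (1 + ε) + Real.log (φ₀ + ε) + Real.log G with hK
  -- Makes the far mass at most `ε` times the near bound `X`; the integer power `n ^ d` dominates
  -- `√n ^ d`.
  have hsmall : ∀ᶠ n : ℕ in atTop, (n : ℝ) ^ d * t n ≤ ε * (φ₀ + ε) * G :=
    (hpow d).eventually_le_const (by positivity)
  have hlimsmall : Tendsto (fun n : ℕ => (P n).real (B n) * |K| +
      (d : ℝ) / 2 * ((P n).real (B n) * Real.log n) + (P n).real (B n) * (-Real.log ε)) atTop
      (𝓝 0) := by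
    have := ((hB0.mul_const |K|).add (hBlog.const_mul ((d : ℝ) / 2))).add
      (hB0.mul_const (-Real.log ε))
    simpa using this
  filter_upwards [hsmall, hlimsmall.eventually_le_const hε, eventually_ge_atTop 1] with n h1 h2 hn
  have hn0 : (0 : ℝ) < n := by exact_mod_cast hn
  have hs : 0 < √(n : ℝ) := Real.sqrt_pos.2 hn0
  obtain ⟨hpos, hint⟩ := h.ae_evidence_pos_and_integrable_log hn
  have hT2 : Integrable (fun ω => ‖T n ω‖ ^ 2) (P n) := by
    simp_rw [EuclideanSpace.norm_sq_eq, Real.norm_eq_abs, sq_abs]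
    exact integrable_finsetSum _ fun i _ => (h.score_memLp n i).integrable_sq
  have hT2le : ∫ ω, ‖T n ω‖ ^ 2 ∂P n ≤ d := by
    simp_rw [EuclideanSpace.norm_sq_eq, Real.norm_eq_abs, sq_abs]
    rw [integral_finsetSum _ fun i _ => (h.score_memLp n i).integrable_sq]
    calc _ ≤ ∑ _i : Fin d, (1 : ℝ) := Finset.sum_le_sum fun i _ => h.score_sq n hn i
      _ = d := by simp
  set b : Ω n → ℝ := fun ω => (-((d : ℝ) / 2 * Real.log n) + K) + (2 * a)⁻¹ * ‖T n ω‖ ^ 2 with hb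
  have hbint : Integrable b (P n) := (integrable_const _).add (hT2.const_mul _)
  have hgood : ∀ᵐ ω ∂P n, ω ∈ (B n)ᶜ →
      Real.log (∫⁻ u, ENNReal.ofReal (ρ n u ω) ∂π).toReal ≤ b ω := by
    filter_upwards [hpos, hlan n hn] with ω hpos hlan hω
    simp only [hB, hD, Set.compl_union, Set.mem_inter_iff, Set.mem_compl_iff, Set.mem_ofPred_eq,
      not_lt, not_and, not_not] at hω
    obtain ⟨⟨g1, g2⟩, g3⟩ := hω
    have g4 : F n ω < ENNReal.ofReal (t n) := by
      by_contra hcon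
      exact g3 (not_lt.1 hcon) g2
    have hnear := setLIntegral_le_ofReal_of_lan (π := π) (φp := φ₀ + ε) (δ := δ) (N := n)
      (e := e n ω) (a := a) (T := T n ω) (g := fun u => ENNReal.ofReal (ρ n u ω)) (by linarith)
      hn0 hapos (by linarith) hπ' fun u hu => ENNReal.ofReal_le_ofReal
        (hlan u (Metric.ball_subset_ball (min_le_left _ _) hu)).2
    set X := (φ₀ + ε) * ((√n ^ d)⁻¹ * (G * Real.exp (‖T n ω‖ ^ 2 / (2 * a)))) with hX
    have hXpos : 0 < X := by positivity
    have htX : t n ≤ ε * X := by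
      have e1 : √(n : ℝ) ^ d ≤ (n : ℝ) ^ d := by
        gcongr
        rw [Real.sqrt_le_left hn0.le]
        have : (1 : ℝ) ≤ n := by exact_mod_cast hn
        nlinarith
      have htp : 0 < t n := Real.exp_pos _
      have e2 : √(n : ℝ) ^ d * t n ≤ ε * (φ₀ + ε) * G := le_trans (by gcongr) h1
      have e3 : (1 : ℝ) ≤ Real.exp (‖T n ω‖ ^ 2 / (2 * a)) := Real.one_le_exp (by positivity)
      calc t n = (√n ^ d)⁻¹ * (√(n : ℝ) ^ d * t n) := by field_simp
        _ ≤ (√n ^ d)⁻¹ * (ε * (φ₀ + ε) * G) := by gcongr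
        _ ≤ (√n ^ d)⁻¹ * (ε * (φ₀ + ε) * G) * Real.exp (‖T n ω‖ ^ 2 / (2 * a)) :=
          le_mul_of_one_le_right (by positivity) e3
        _ = _ := by rw [hX]; ring
    have htot : (∫⁻ u, ENNReal.ofReal (ρ n u ω) ∂π).toReal ≤ (1 + ε) * X := by
      refine ENNReal.toReal_le_of_le_ofReal (by positivity) ?_
      rw [← lintegral_add_compl _ (Metric.isOpen_ball (x := (0 : Param d)) (ε := δ)).measurableSet]
      calc _ ≤ ENNReal.ofReal X + ENNReal.ofReal (t n) := add_le_add hnear g4.le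
        _ = ENNReal.ofReal (X + t n) := (ENNReal.ofReal_add hXpos.le (Real.exp_pos _).le).symm
        _ ≤ _ := ENNReal.ofReal_le_ofReal (by linarith)
    refine (Real.log_le_log hpos htot).trans (le_of_eq ?_)
    rw [hX, Real.log_mul (by positivity) (by positivity),
      Real.log_mul (by positivity) (by positivity), Real.log_mul (by positivity) (by positivity),
      Real.log_mul (by positivity) (by positivity), Real.log_inv, log_sqrt_pow, Real.log_exp]
    simp only [hb, hK]
    field_simp
    ring
  -- `log x ≤ x - 1` at `x = ε Z`. As `E Z ≤ 1`, the linear part contributes at most `ε`, and the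
  -- large constant `-log ε` is multiplied by the probability of the bad event.
  have hbad : ∀ᵐ ω ∂P n, Real.log (∫⁻ u, ENNReal.ofReal (ρ n u ω) ∂π).toReal ≤
      ε * (∫⁻ u, ENNReal.ofReal (ρ n u ω) ∂π).toReal - Real.log ε := by
    filter_upwards [hpos] with ω hpos
    have := Real.log_le_sub_one_of_pos (mul_pos hε hpos)
    rw [Real.log_mul hε.ne' hpos.ne'] at this
    linarith
  have hZi := h.integrable_evidence n
  have hZ1 := h.integral_evidence_le n
  have hPB := hBm n
  have I1 : ∫ ω in (B n)ᶜ, Real.log (∫⁻ u, ENNReal.ofReal (ρ n u ω) ∂π).toReal ∂P n ≤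
      (1 - (P n).real (B n)) * (-((d : ℝ) / 2 * Real.log n) + K) + d / (2 * a) := by
    calc _ ≤ ∫ ω in (B n)ᶜ, b ω ∂P n := by
          refine setIntegral_mono_ae_restrict hint.integrableOn hbint.integrableOn ?_
          rw [EventuallyLE, ae_restrict_iff'₀ hPB.compl]
          exact hgood
      _ = (P n).real (B n)ᶜ * (-((d : ℝ) / 2 * Real.log n) + K) +
          ∫ ω in (B n)ᶜ, (2 * a)⁻¹ * ‖T n ω‖ ^ 2 ∂P n := by
          rw [hb, integral_add (integrable_const _) (hT2.const_mul _).integrableOn,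
            setIntegral_const, smul_eq_mul]
      _ ≤ _ := by
          rw [measureReal_compl₀ hPB, probReal_univ]
          gcongr
          calc _ ≤ ∫ ω, (2 * a)⁻¹ * ‖T n ω‖ ^ 2 ∂P n :=
                setIntegral_le_integral (hT2.const_mul _)
                  (Eventually.of_forall fun ω => by positivity)
            _ ≤ (2 * a)⁻¹ * d := by rw [integral_const_mul]; gcongr
            _ = _ := by rw [mul_comm, ← div_eq_mul_inv]
  have I2 : ∫ ω in B n, Real.log (∫⁻ u, ENNReal.ofReal (ρ n u ω) ∂π).toReal ∂P n ≤
      ε + (P n).real (B n) * (-Real.log ε) := by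
    calc _ ≤ ∫ ω in B n, (ε * (∫⁻ u, ENNReal.ofReal (ρ n u ω) ∂π).toReal - Real.log ε) ∂P n :=
          setIntegral_mono_ae hint.integrableOn
            ((hZi.const_mul _).sub (integrable_const _)).integrableOn hbad
      _ = ∫ ω in B n, ε * (∫⁻ u, ENNReal.ofReal (ρ n u ω) ∂π).toReal ∂P n +
          (P n).real (B n) * (-Real.log ε) := by
          rw [integral_sub (hZi.const_mul _).integrableOn (integrable_const _), setIntegral_const,
            smul_eq_mul]
          ring
      _ ≤ _ := by
          gcongr
          calc _ ≤ ∫ ω, ε * (∫⁻ u, ENNReal.ofReal (ρ n u ω) ∂π).toReal ∂P n :=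
                setIntegral_le_integral (hZi.const_mul _)
                  (Eventually.of_forall fun ω => mul_nonneg hε.le ENNReal.toReal_nonneg)
            _ ≤ ε := by rw [integral_const_mul]; nlinarith
  have hsplit := integral_add_compl₀ hPB hint
  have hKabs : -((P n).real (B n) * K) ≤ (P n).real (B n) * |K| := by
    have h5 := neg_abs_le K
    have h6 : 0 ≤ (P n).real (B n) := measureReal_nonneg
    nlinarith
  have hlogG : Real.log G = (d : ℝ) / 2 * Real.log (2 * Real.pi / a) := by
    rw [hG, Real.log_rpow (by positivity)]
  rw [← hsplit, ← hlogG]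
  have hK' : K = Real.log (1 + ε) + Real.log (φ₀ + ε) + Real.log G := hK
  nlinarith

/-- The expected log evidence of a locally asymptotically normal model. -/
theorem tendsto_log_evidence (h : IsLocallyNormal P π ρ T φ₀) :
    Tendsto (fun n : ℕ => (d : ℝ) / 2 * Real.log n +
      ∫ ω, Real.log (∫⁻ u, ENNReal.ofReal (ρ n u ω) ∂π).toReal ∂P n) atTop
      (𝓝 (Real.log φ₀ + (d : ℝ) / 2 * Real.log (2 * Real.pi) + d / 2)) := by
  have hφ := h.density_pos
  refine tendsto_order.2 ⟨fun y hy => ?_, fun y hy => ?_⟩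
  · obtain ⟨y', h1, h2⟩ := exists_between hy
    filter_upwards [h.eventually_lower h2] with n hn using h1.trans_le hn
  -- The upper bound is continuous in `ε`, and its value at `ε = 0` is the asserted limit.
  · have hc : ContinuousAt (fun ε : ℝ => Real.log (1 + ε) + Real.log (φ₀ + ε) +
        (d : ℝ) / 2 * Real.log (2 * Real.pi / (1 - ε)) + d / (2 * (1 - ε)) + 2 * ε) 0 := by
      have h1 : (1 : ℝ) + 0 ≠ 0 := by norm_num
      have h2 : φ₀ + 0 ≠ 0 := by simpa using hφ.ne'
      have h3 : (1 : ℝ) - 0 ≠ 0 := by norm_num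
      have h4 : 2 * Real.pi / (1 - 0) ≠ 0 := by simp [Real.pi_ne_zero]
      have h5 : (2 : ℝ) * (1 - 0) ≠ 0 := by norm_num
      fun_prop (disch := assumption)
    have hlt : ∀ᶠ ε : ℝ in 𝓝 0, Real.log (1 + ε) + Real.log (φ₀ + ε) +
        (d : ℝ) / 2 * Real.log (2 * Real.pi / (1 - ε)) + d / (2 * (1 - ε)) + 2 * ε < y := by
      refine hc.eventually_lt_const ?_
      simpa using hy
    have h1 : ∀ᶠ ε : ℝ in 𝓝[>] 0, 0 < ε := self_mem_nhdsWithin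
    have h2 : ∀ᶠ ε : ℝ in 𝓝[>] 0, ε < 1 :=
      mem_nhdsWithin_of_mem_nhds (gt_mem_nhds one_pos)
    obtain ⟨ε, h3, h4, h5⟩ := ((hlt.filter_mono nhdsWithin_le_nhds).and (h1.and h2)).exists
    filter_upwards [h.eventually_upper_aux h4 h5] with n hn using hn.trans_lt h3

end IsLocallyNormal

end AbstractEvidence


/-! ### Independent samples -/

section IidSamples

/-- Tonelli's theorem for a product of functions of the single coordinates. -/
theorem lintegral_pi_prod {Ω : Type*} [MeasurableSpace Ω] {μ : Measure Ω} [SigmaFinite μ] {n : ℕ}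
    (f : Fin n → Ω → ENNReal) (hf : ∀ i, AEMeasurable (f i) μ) :
    ∫⁻ x, ∏ i, f i (x i) ∂(Measure.pi fun _ : Fin n => μ) = ∏ i, ∫⁻ x, f i x ∂μ := by
  induction n with
  | zero => simp
  | succ n ih =>
    have e := (measurePreserving_piFinSuccAbove (fun _ : Fin (n + 1) => μ) 0).symm
    rw [← e.lintegral_comp_emb (MeasurableEquiv.measurableEmbedding _)]
    simp_rw [MeasurableEquiv.piFinSuccAbove_symm_apply, Fin.insertNthEquiv, Fin.prod_univ_succ,
      Fin.insertNth_zero, Equiv.coe_fn_mk, Fin.cons_succ, Fin.cons_zero,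
      cast_eq]
    have hm : AEMeasurable (fun y : Fin n → Ω => ∏ i, f (Fin.succ i) (y i))
        (Measure.pi fun _ : Fin n => μ) :=
      Finset.aemeasurable_fun_prod _ fun i _ =>
        (hf i.succ).comp_quasiMeasurePreserving (Measure.quasiMeasurePreserving_eval _ i)
    rw [lintegral_prod_mul (μ := μ) (ν := Measure.pi fun _ : Fin n => μ) (hf 0) hm,
      ih _ fun i => hf i.succ]

variable {Ω : Type*} [MeasurableSpace Ω] {P : Measure Ω} [IsProbabilityMeasure P]

/-- The average of `f` over a sample. -/
noncomputable def sampleMean (f : Ω → ℝ) (n : ℕ) (ω : Fin n → Ω) : ℝ :=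
  (n : ℝ)⁻¹ * ∑ k, f (ω k)

theorem integrable_pi_eval {f : Ω → ℝ} (hf : Integrable f P) (n : ℕ) (k : Fin n) :
    Integrable (fun ω : Fin n → Ω => f (ω k)) (Measure.pi fun _ : Fin n => P) :=
  (measurePreserving_eval (fun _ : Fin n => P) k).integrable_comp_of_integrable hf

theorem integral_pi_eval {f : Ω → ℝ} (hf : AEStronglyMeasurable f P) (n : ℕ) (k : Fin n) :
    ∫ ω : Fin n → Ω, f (ω k) ∂(Measure.pi fun _ : Fin n => P) = ∫ ω, f ω ∂P := by
  have h := measurePreserving_eval (fun _ : Fin n => P) k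
  rw [← h.map_eq] at hf
  have := integral_map h.measurable.aemeasurable hf
  rw [h.map_eq] at this
  exact this.symm

theorem ae_pi_eval {p : Ω → Prop} (hp : ∀ᵐ ω ∂P, p ω) (n : ℕ) :
    ∀ᵐ ω ∂(Measure.pi fun _ : Fin n => P), ∀ k, p (ω k) :=
  ae_all_iff.2 fun k => (Measure.quasiMeasurePreserving_eval (fun _ : Fin n => P) k).ae hp

theorem memLp_sampleMean {f : Ω → ℝ} (hf : MemLp f 2 P) (n : ℕ) :
    MemLp (sampleMean f n) 2 (Measure.pi fun _ : Fin n => P) :=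
  (memLp_finsetSum _ fun k _ =>
    hf.comp_measurePreserving (measurePreserving_eval (fun _ : Fin n => P) k)).const_mul _

theorem integral_sampleMean {f : Ω → ℝ} (hf : Integrable f P) {n : ℕ} (hn : 1 ≤ n) :
    ∫ ω, sampleMean f n ω ∂(Measure.pi fun _ : Fin n => P) = ∫ ω, f ω ∂P := by
  simp only [sampleMean]
  rw [integral_const_mul, integral_finsetSum _ fun k _ => integrable_pi_eval hf n k]
  simp_rw [integral_pi_eval hf.aestronglyMeasurable]
  have : (n : ℝ) ≠ 0 := by positivity
  simp [this]

theorem variance_sum_sample {f : Ω → ℝ} (hf : MemLp f 2 P) (n : ℕ) :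
    ProbabilityTheory.variance (fun ω : Fin n → Ω => ∑ k, f (ω k)) (Measure.pi fun _ : Fin n => P) =
      n * ProbabilityTheory.variance f P := by
  have := ProbabilityTheory.variance_sum_pi (ι := Fin n) (μ := fun _ => P) (X := fun _ => f)
    fun _ => hf
  simp only [Finset.sum_const, Finset.card_univ, Fintype.card_fin, nsmul_eq_mul] at this
  rw [← this]
  congr 1
  ext ω
  simp

theorem variance_sampleMean {f : Ω → ℝ} (hf : MemLp f 2 P) (n : ℕ) :
    ProbabilityTheory.variance (sampleMean f n) (Measure.pi fun _ : Fin n => P) =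
      ProbabilityTheory.variance f P / n := by
  have h := ProbabilityTheory.variance_const_mul (n : ℝ)⁻¹ (fun ω : Fin n → Ω => ∑ k, f (ω k))
    (Measure.pi fun _ : Fin n => P)
  rw [variance_sum_sample hf] at h
  rw [show sampleMean f n = fun ω => (n : ℝ)⁻¹ * ∑ k, f (ω k) from rfl, h]
  rcases eq_or_ne (n : ℝ) 0 with h0 | h0
  · simp [h0]
  · field_simp

/-- Errors that vanish in mean, and in probability faster than `1 / log n`. -/
structure IsNegligible {Ω : ℕ → Type*} [∀ n, MeasurableSpace (Ω n)] (P : ∀ n, Measure (Ω n))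
    (Y : ∀ n, Ω n → ℝ) : Prop where
  nonneg : ∀ n ω, 0 ≤ Y n ω
  integrable : ∀ n, Integrable (Y n) (P n)
  tendsto_integral : Tendsto (fun n => ∫ ω, Y n ω ∂P n) atTop (𝓝 0)
  tendsto_prob : ∀ t > 0,
    Tendsto (fun n : ℕ => (P n).real {ω | t < Y n ω} * Real.log n) atTop (𝓝 0)

theorem IsNegligible.add {Ω : ℕ → Type*} [∀ n, MeasurableSpace (Ω n)] {P : ∀ n, Measure (Ω n)}
    [∀ n, IsFiniteMeasure (P n)] {Y Z : ∀ n, Ω n → ℝ} (hY : IsNegligible P Y)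
    (hZ : IsNegligible P Z) : IsNegligible P fun n ω => Y n ω + Z n ω where
  nonneg n ω := add_nonneg (hY.nonneg n ω) (hZ.nonneg n ω)
  integrable n := (hY.integrable n).add (hZ.integrable n)
  tendsto_integral := by
    have := hY.tendsto_integral.add hZ.tendsto_integral
    rw [add_zero] at this
    exact this.congr fun n => (integral_add (hY.integrable n) (hZ.integrable n)).symm
  tendsto_prob t ht := by
    have := (hY.tendsto_prob (t / 2) (half_pos ht)).add (hZ.tendsto_prob (t / 2) (half_pos ht))
    rw [add_zero] at this
    refine squeeze_zero (fun n => mul_nonneg measureReal_nonneg (Real.log_natCast_nonneg n))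
      (fun n => ?_) this
    rw [← add_mul]
    refine mul_le_mul_of_nonneg_right ?_ (Real.log_natCast_nonneg n)
    refine le_trans (measureReal_mono ?_) (measureReal_union_le _ _)
    intro ω hω
    by_contra hcon
    simp only [Set.mem_union, Set.mem_ofPred_eq, not_or, not_lt] at hcon hω
    linarith

theorem IsNegligible.zero {Ω : ℕ → Type*} [∀ n, MeasurableSpace (Ω n)] {P : ∀ n, Measure (Ω n)} :
    IsNegligible P fun _ _ => 0 where
  nonneg _ _ := le_rfl
  integrable _ := integrable_zero _ _ _
  tendsto_integral := by simp
  tendsto_prob t ht := by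
    have : ∀ n, {_ω : Ω n | t < 0} = ∅ := fun n =>
      Set.eq_empty_of_forall_notMem fun ω hω => ht.not_gt hω
    simp [this]

theorem IsNegligible.sum {Ω : ℕ → Type*} [∀ n, MeasurableSpace (Ω n)] {P : ∀ n, Measure (Ω n)}
    [∀ n, IsFiniteMeasure (P n)] {ι : Type*} (s : Finset ι) {Y : ι → ∀ n, Ω n → ℝ}
    (hY : ∀ i, IsNegligible P (Y i)) : IsNegligible P fun n ω => ∑ i ∈ s, Y i n ω := by
  classical
  induction s using Finset.induction_on with
  | empty => simpa using IsNegligible.zero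
  | insert i s hi ih =>
    simp only [Finset.sum_insert hi]
    exact (hY i).add ih

/-- The variance of the mean is `V / n`. Chebyshev gives probabilities of order `1 / n`, which beats
`1 / log n`; the mean deviation follows from `|s| ≤ y / 2 + s ^ 2 / (2 * y)`. -/
theorem isNegligible_sampleMean_sub {f : Ω → ℝ} (hf : MemLp f 2 P) :
    IsNegligible (fun n => Measure.pi fun _ : Fin n => P)
      fun n ω => |sampleMean f n ω - ∫ ω, f ω ∂P| := by
  set V := ProbabilityTheory.variance f P with hV
  have hV0 : 0 ≤ V := ProbabilityTheory.variance_nonneg _ _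
  have hlog : Tendsto (fun n : ℕ => Real.log n / (n : ℝ)) atTop (𝓝 0) := by
    have := (Real.isLittleO_log_id_atTop.tendsto_div_nhds_zero).comp tendsto_natCast_atTop_atTop
    exact this
  have hmem : ∀ n, MemLp (fun ω => sampleMean f n ω - ∫ ω, f ω ∂P) 2
      (Measure.pi fun _ : Fin n => P) := fun n => (memLp_sampleMean hf n).sub (memLp_const _)
  have hint : ∀ n, Integrable (fun ω => |sampleMean f n ω - ∫ ω, f ω ∂P|)
      (Measure.pi fun _ : Fin n => P) := fun n => ((hmem n).integrable one_le_two).abs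
  have hsq : ∀ n, 1 ≤ n → ∫ ω, (sampleMean f n ω - ∫ ω, f ω ∂P) ^ 2
      ∂(Measure.pi fun _ : Fin n => P) = V / n := by
    intro n hn
    rw [hV, ← variance_sampleMean hf,
      ProbabilityTheory.variance_eq_integral (memLp_sampleMean hf n).aemeasurable,
      integral_sampleMean (hf.integrable one_le_two) hn]
  refine ⟨fun n ω => abs_nonneg _, hint, ?_, fun t ht => ?_⟩
  · refine tendsto_order.2 ⟨fun y hy => ?_, fun y hy => ?_⟩
    · filter_upwards with n
      exact hy.trans_le (integral_nonneg fun ω => abs_nonneg _)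
    · have h1 : Tendsto (fun n : ℕ => y / 2 + (2 * y)⁻¹ * (V / n)) atTop (𝓝 (y / 2 + (2 * y)⁻¹ * 0)) :=
        tendsto_const_nhds.add ((tendsto_const_div_atTop_nhds_zero_nat V).const_mul _)
      filter_upwards [h1.eventually_lt_const (show _ < y by linarith), eventually_ge_atTop 1] with n h2 hn
      refine lt_of_le_of_lt ?_ h2
      rw [← hsq n hn]
      have i2 := ((hmem n).integrable_sq.const_mul (2 * y)⁻¹)
      calc _ ≤ ∫ ω, (y / 2 + (2 * y)⁻¹ * (sampleMean f n ω - ∫ ω, f ω ∂P) ^ 2)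
              ∂(Measure.pi fun _ : Fin n => P) := by
            refine integral_mono (hint n) ((integrable_const _).add i2) fun ω => ?_
            simp only
            rw [← sq_abs (sampleMean f n ω - _)]
            have := sq_nonneg (y - |sampleMean f n ω - ∫ ω, f ω ∂P|)
            field_simp
            nlinarith
        _ = _ := by
            rw [integral_add (integrable_const _) i2, integral_const_mul]
            simp
  · have h1 := (hlog.const_mul (V / t ^ 2))
    rw [mul_zero] at h1
    refine squeeze_zero' (Eventually.of_forall fun n =>
      mul_nonneg measureReal_nonneg (Real.log_natCast_nonneg n)) ?_ h1
    filter_upwards [eventually_ge_atTop 1] with n hn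
    have h2 := ProbabilityTheory.meas_ge_le_variance_div_sq (memLp_sampleMean hf n) ht
    rw [integral_sampleMean (hf.integrable one_le_two) hn, variance_sampleMean hf n] at h2
    have h3 : (Measure.pi fun _ : Fin n => P).real {ω | t < |sampleMean f n ω - ∫ ω, f ω ∂P|} ≤
        V / n / t ^ 2 := by
      refine ENNReal.toReal_le_of_le_ofReal (by positivity) (le_trans (measure_mono ?_) h2)
      intro ω (hω : t < _)
      exact hω.le
    calc _ ≤ V / n / t ^ 2 * Real.log n := by
          gcongr
      _ = _ := by ring

/-- The truncated second moment of a standard Gaussian. -/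
theorem tendsto_integral_min_sq_gaussian :
    Tendsto (fun M : ℕ => ∫ x, min (x ^ 2) ((M : ℝ) ^ 2) ∂(ProbabilityTheory.gaussianReal 0 1)) atTop
      (𝓝 1) := by
  have hi : Integrable (fun x : ℝ => x ^ 2) (ProbabilityTheory.gaussianReal 0 1) :=
    (ProbabilityTheory.memLp_id_gaussianReal (μ := 0) (v := 1) 2).integrable_sq
  have h1 : ∫ x, x ^ 2 ∂(ProbabilityTheory.gaussianReal 0 1) = 1 := by
    have h2 := ProbabilityTheory.variance_fun_id_gaussianReal (μ := 0) (v := 1)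
    rw [ProbabilityTheory.variance_eq_integral (by fun_prop),
      ProbabilityTheory.integral_id_gaussianReal] at h2
    simpa using h2
  rw [← h1]
  refine tendsto_integral_of_dominated_convergence (fun x => x ^ 2)
    (fun M => by fun_prop) hi (fun M => ?_) ?_
  · filter_upwards with x
    rw [Real.norm_eq_abs, abs_of_nonneg (by positivity)]
    exact min_le_left _ _
  · filter_upwards with x
    refine tendsto_const_nhds.congr' ?_
    obtain ⟨k, hk⟩ := exists_nat_ge |x|
    filter_upwards [eventually_ge_atTop k] with M hM
    rw [min_eq_left]
    rw [← sq_abs x]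
    have : (k : ℝ) ≤ M := by exact_mod_cast hM
    gcongr
    linarith

/-- The central limit theorem, as convergence of truncated second moments. -/
theorem tendsto_integral_min_sq_sum {f : Ω → ℝ} (hfm : Measurable f) (h0 : ∫ ω, f ω ∂P = 0)
    (h1 : ∫ ω, f ω ^ 2 ∂P = 1) (M : ℝ) :
    Tendsto (fun n : ℕ => ∫ ω, min (((√n)⁻¹ * ∑ k, f (ω k)) ^ 2) (M ^ 2)
      ∂(Measure.pi fun _ : Fin n => P)) atTop
      (𝓝 (∫ x, min (x ^ 2) (M ^ 2) ∂(ProbabilityTheory.gaussianReal 0 1))) := by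
  -- The central limit theorem concerns one sequence on a fixed space, hence the infinite product;
  -- its first `n` coordinates have the law `Measure.pi`.
  set Q := Measure.infinitePi fun _ : ℕ => P
  have heval : ∀ k : ℕ, MeasurePreserving (fun ω : ℕ → Ω => ω k) Q P := fun k =>
    ⟨measurable_pi_apply k, Measure.infinitePi_map_eval _ k⟩
  have hfk : ∀ k : ℕ, Measurable fun ω : ℕ → Ω => f (ω k) := fun k => hfm.comp (heval k).measurable
  have hclt := ProbabilityTheory.tendstoInDistribution_inv_sqrt_mul_sum (P := Q)
    (P' := ProbabilityTheory.gaussianReal 0 1) (Y := id) (X := fun k ω => f (ω k))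
    ⟨by fun_prop, by simp⟩ ?_ ?_
    (ProbabilityTheory.iIndepFun_infinitePi (P := fun _ : ℕ => P) (X := fun _ => f) fun _ => hfm) ?_
  rotate_left
  · rw [← h0, ← (heval 0).map_eq,
      integral_map (heval 0).measurable.aemeasurable hfm.aestronglyMeasurable]
  · simp only [Pi.pow_apply]
    rw [← h1, ← (heval 0).map_eq,
      integral_map (heval 0).measurable.aemeasurable (hfm.pow_const 2).aestronglyMeasurable]
  · intro k
    refine ⟨(hfk k).aemeasurable, (hfk 0).aemeasurable, ?_⟩
    have : ∀ k, Q.map (fun ω : ℕ → Ω => f (ω k)) = P.map f := fun k => by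
      rw [← (heval k).map_eq, Measure.map_map hfm (heval k).measurable]
      rfl
    rw [this, this]
  -- The truncation makes the square a bounded continuous test function for convergence in
  -- distribution.
  have hg : Continuous fun x : ℝ => min (x ^ 2) (M ^ 2) := by fun_prop
  have hbdd : ∀ x : ℝ, ‖min (x ^ 2) (M ^ 2)‖ ≤ M ^ 2 := fun x => by
    rw [Real.norm_eq_abs, abs_of_nonneg (by positivity)]
    exact min_le_right _ _
  have := (ProbabilityMeasure.tendsto_iff_forall_integral_tendsto.1 hclt.tendsto)
    (BoundedContinuousFunction.ofNormedAddCommGroup _ hg _ hbdd)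
  simp only [BoundedContinuousFunction.coe_ofNormedAddCommGroup, ProbabilityMeasure.coe_mk,
    Measure.map_id] at this
  refine this.congr fun n => ?_
  have hsum : Measurable fun ω : ℕ → Ω => (√n)⁻¹ * ∑ k ∈ Finset.range n, f (ω k) :=
    (Finset.measurable_fun_sum _ fun k _ => hfk k).const_mul _
  have hsum' : Measurable fun ω : Fin n → Ω => (√n)⁻¹ * ∑ k, f (ω k) :=
    (Finset.measurable_fun_sum _ fun k _ => hfm.comp (measurable_pi_apply k)).const_mul _
  rw [integral_map hsum.aemeasurable hg.aestronglyMeasurable]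
  have hmap : Q.map (fun ω (k : Fin n) => ω k) = Measure.pi fun _ : Fin n => P := by
    rw [← Measure.infinitePi_eq_pi]
    exact Measure.map_infinitePi_infinitePi_of_inj (P := fun _ : ℕ => P) Fin.val_injective
  rw [← hmap, integral_map (measurable_pi_lambda _ fun k => measurable_pi_apply _).aemeasurable
    (hg.measurable.comp hsum').aestronglyMeasurable]
  simp_rw [Finset.sum_range]

end IidSamples


/-! ### Independent samples of a regular model are locally asymptotically normal -/

section StandardModel

/-- A model for one observation, given by its likelihood ratios `r u` against the probability
measure `P`, that has at the origin the score `τ` with identity information matrix and the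
Hessian `H` of the log likelihood, and whose samples admit exponentially consistent tests of
the origin. -/
structure IsStandardModel {d : ℕ} {Ω : Type*} [MeasurableSpace Ω] (P : Measure Ω)
    (π : Measure (Param d)) (r : Param d → Ω → ℝ) (τ : Fin d → Ω → ℝ)
    (H : Fin d → Fin d → Ω → ℝ) (φ₀ : ℝ) : Prop where
  measurable : Measurable (Function.uncurry r)
  nonneg : ∀ᵐ u ∂π, ∀ ω, 0 ≤ r u ω
  lintegral_le : ∀ᵐ u ∂π, ∫⁻ ω, ENNReal.ofReal (r u ω) ∂P ≤ 1
  density_pos : 0 < φ₀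
  density : ∀ φm φp, 0 < φm → φm < φ₀ → φ₀ < φp → ∃ δ > 0,
    ENNReal.ofReal φm • (volume.restrict (Metric.ball (0 : Param d) δ)) ≤ π ∧
    π.restrict (Metric.ball (0 : Param d) δ) ≤ ENNReal.ofReal φp • volume
  score_measurable : ∀ i, Measurable (τ i)
  score_memLp : ∀ i, MemLp (τ i) 2 P
  score_mean : ∀ i, ∫ ω, τ i ω ∂P = 0
  score_sq : ∀ i, ∫ ω, τ i ω ^ 2 ∂P = 1
  hess_memLp : ∀ i j, MemLp (H i j) 2 P
  hess_mean : ∀ i j, ∫ ω, H i j ω ∂P = if i = j then -1 else 0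
  taylor : ∀ ε > 0, ∃ δ > 0, ∃ m : Ω → ℝ, MemLp m 2 P ∧ ∫ ω, m ω ∂P ≤ ε ∧
    ∀ᵐ ω ∂P, ∀ u ∈ Metric.ball (0 : Param d) δ, 0 < r u ω ∧
      |Real.log (r u ω) - ∑ i, u i * τ i ω - 1 / 2 * ∑ i, ∑ j, u i * u j * H i j ω| ≤
        1 / 2 * m ω * ‖u‖ ^ 2
  tests : ∀ δ > 0, ∃ c > 0, ∃ C : ℝ, ∃ A : ∀ n : ℕ, Set (Fin n → Ω), (∀ n, MeasurableSet (A n)) ∧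
    Tendsto (fun n : ℕ => (Measure.pi fun _ : Fin n => P).real (A n)ᶜ * Real.log n) atTop (𝓝 0) ∧
    ∀ n : ℕ, ∀ᵐ u ∂π, δ ≤ ‖u‖ →
      ∫⁻ ω in A n, ENNReal.ofReal (∏ k, r u (ω k)) ∂(Measure.pi fun _ : Fin n => P) ≤
        ENNReal.ofReal (C * Real.exp (-c * n))

variable {d : ℕ} {Ω : Type*} [MeasurableSpace Ω] {P : Measure Ω} [IsProbabilityMeasure P]
  {π : Measure (Param d)} {r : Param d → Ω → ℝ} {τ : Fin d → Ω → ℝ} {H : Fin d → Fin d → Ω → ℝ}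
  {φ₀ : ℝ}

/-- The normalised score of a sample. -/
noncomputable def sampleScore (τ : Fin d → Ω → ℝ) (n : ℕ) (ω : Fin n → Ω) : Param d :=
  WithLp.toLp 2 fun i => (√n)⁻¹ * ∑ k, τ i (ω k)

theorem abs_quadratic_le (u : Param d) (A : Fin d → Fin d → ℝ) :
    |∑ i, ∑ j, u i * u j * A i j| ≤ (∑ i, ∑ j, |A i j|) * ‖u‖ ^ 2 := by
  have hu : ∀ i, |u i| ≤ ‖u‖ := fun i => by
    simpa using PiLp.norm_apply_le u i
  rw [Finset.sum_mul]
  refine (Finset.abs_sum_le_sum_abs _ _).trans (Finset.sum_le_sum fun i _ => ?_)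
  rw [Finset.sum_mul]
  refine (Finset.abs_sum_le_sum_abs _ _).trans (Finset.sum_le_sum fun j _ => ?_)
  rw [abs_mul, abs_mul, mul_comm, sq]
  have := mul_le_mul (hu i) (hu j) (abs_nonneg _) (norm_nonneg _)
  gcongr

omit [MeasurableSpace Ω] in
/-- Summation of the one-observation Taylor expansions. -/
theorem abs_log_prod_sub_le {n : ℕ} (hn : 1 ≤ n) {m : Ω → ℝ} {u : Param d} {ω : Fin n → Ω}
    {h : Fin d → Fin d → ℝ} (hh : ∀ i j, h i j = if i = j then -1 else 0)
    (hT : ∀ k, 0 < r u (ω k) ∧ |Real.log (r u (ω k)) - ∑ i, u i * τ i (ω k) -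
      1 / 2 * ∑ i, ∑ j, u i * u j * H i j (ω k)| ≤ 1 / 2 * m (ω k) * ‖u‖ ^ 2) :
    |Real.log (∏ k, r u (ω k)) - (√n * inner ℝ (sampleScore τ n ω) u - n / 2 * ‖u‖ ^ 2)| ≤
      n / 2 * (sampleMean m n ω + ∑ i, ∑ j, |sampleMean (H i j) n ω - h i j|) * ‖u‖ ^ 2 := by
  have hn0 : (0 : ℝ) < n := by exact_mod_cast hn
  have hs : 0 < √(n : ℝ) := Real.sqrt_pos.2 hn0
  have e1 : √n * inner ℝ (sampleScore τ n ω) u = ∑ k, ∑ i, u i * τ i (ω k) := by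
    rw [PiLp.inner_apply, Finset.mul_sum, Finset.sum_comm]
    refine Finset.sum_congr rfl fun i _ => ?_
    simp only [sampleScore, RCLike.inner_apply, conj_trivial]
    rw [← Finset.mul_sum]
    field_simp
  have e2 : ∑ k, ∑ i, ∑ j, u i * u j * H i j (ω k) =
      n * ∑ i, ∑ j, u i * u j * sampleMean (H i j) n ω := by
    rw [Finset.sum_comm, Finset.mul_sum]
    refine Finset.sum_congr rfl fun i _ => ?_
    rw [Finset.sum_comm, Finset.mul_sum]
    refine Finset.sum_congr rfl fun j _ => ?_
    rw [← Finset.mul_sum, sampleMean]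
    field_simp
  have e3 : ∑ i, ∑ j, u i * u j * h i j = - ‖u‖ ^ 2 := by
    rw [EuclideanSpace.norm_sq_eq, ← Finset.sum_neg_distrib]
    refine Finset.sum_congr rfl fun i _ => ?_
    simp [hh, sq]
  have e4 : ∑ k, m (ω k) = n * sampleMean m n ω := by
    rw [sampleMean]
    field_simp
  have key : Real.log (∏ k, r u (ω k)) - (√n * inner ℝ (sampleScore τ n ω) u - n / 2 * ‖u‖ ^ 2) =
      ∑ k, (Real.log (r u (ω k)) - ∑ i, u i * τ i (ω k) -
        1 / 2 * ∑ i, ∑ j, u i * u j * H i j (ω k)) +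
      n / 2 * ∑ i, ∑ j, u i * u j * (sampleMean (H i j) n ω - h i j) := by
    simp_rw [mul_sub, Finset.sum_sub_distrib]
    rw [← Finset.mul_sum, e2, e3, Real.log_prod fun k _ => (hT k).1.ne', e1]
    ring
  rw [key]
  calc _ ≤ ∑ k, 1 / 2 * m (ω k) * ‖u‖ ^ 2 +
        n / 2 * ((∑ i, ∑ j, |sampleMean (H i j) n ω - h i j|) * ‖u‖ ^ 2) := by
        refine (abs_add_le _ _).trans (add_le_add ?_ ?_)
        · exact (Finset.abs_sum_le_sum_abs _ _).trans (Finset.sum_le_sum fun k _ => (hT k).2)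
        · rw [abs_mul, abs_of_pos (by positivity)]
          gcongr
          exact abs_quadratic_le u _
    _ = _ := by
        rw [← Finset.sum_mul, ← Finset.mul_sum, e4]
        ring

/-- Summing the Taylor expansions, the error is at most the sample mean of the remainder `m` plus
the deviations of the sample means of the Hessian entries. The mean of `m` takes `ε / 2`; all
deviations from means form a negligible `Y`, and `ε / 2 + Y` serves as the random error `e`. -/
theorem IsStandardModel.isLocallyNormal (h : IsStandardModel P π r τ H φ₀) :
    IsLocallyNormal (fun n : ℕ => Measure.pi fun _ : Fin n => P) π
      (fun n u ω => ∏ k : Fin n, r u (ω k)) (sampleScore τ) φ₀ where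
  measurable n := by
    have : Measurable fun a : Param d × (Fin n → Ω) => ∏ k, r a.1 (a.2 k) :=
      Finset.measurable_fun_prod _ fun k _ => h.measurable.comp
        (measurable_fst.prodMk ((measurable_pi_apply k).comp measurable_snd))
    exact this
  lintegral_le n := by
    filter_upwards [h.lintegral_le, h.nonneg] with u hu hu0
    simp_rw [fun ω : Fin n → Ω => ENNReal.ofReal_prod_of_nonneg (s := Finset.univ)
      (f := fun k => r u (ω k)) fun k _ => hu0 (ω k)]
    rw [lintegral_pi_prod (fun _ ω => ENNReal.ofReal (r u ω)) fun _ =>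
      (h.measurable.comp measurable_prodMk_left).ennreal_ofReal.aemeasurable]
    exact Finset.prod_le_one' fun _ _ => hu
  density_pos := h.density_pos
  density := h.density
  score_memLp n i := (memLp_finsetSum _ fun k _ => (h.score_memLp i).comp_measurePreserving
    (measurePreserving_eval (fun _ : Fin n => P) k)).const_mul _
  score_sq n hn i := by
    have hn0 : (n : ℝ) ≠ 0 := by positivity
    have h1 := variance_sum_sample (h.score_memLp i) n
    have hmem : MemLp (fun ω : Fin n → Ω => ∑ k, τ i (ω k)) 2 (Measure.pi fun _ : Fin n => P) :=
      memLp_finsetSum _ fun k _ => (h.score_memLp i).comp_measurePreserving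
        (measurePreserving_eval (fun _ : Fin n => P) k)
    have h0 : ∫ ω : Fin n → Ω, ∑ k, τ i (ω k) ∂(Measure.pi fun _ : Fin n => P) = 0 := by
      rw [integral_finsetSum _ fun k _ =>
        integrable_pi_eval ((h.score_memLp i).integrable one_le_two) n k]
      simp_rw [integral_pi_eval (h.score_memLp i).aestronglyMeasurable, h.score_mean]
      simp
    rw [ProbabilityTheory.variance_of_integral_eq_zero hmem.aemeasurable h0,
      ProbabilityTheory.variance_of_integral_eq_zero (h.score_memLp i).aemeasurable
        (h.score_mean i)] at h1
    simp only [h.score_sq] at h1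
    simp only [sampleScore, mul_pow]
    rw [integral_const_mul, h1, inv_pow, Real.sq_sqrt (Nat.cast_nonneg n)]
    simp [hn0]
  score_clip η hη := by
    -- The level `M` is chosen for the Gaussian limit, hence independently of `n`; the sample size
    -- is then taken large.
    obtain ⟨M, h1, h2⟩ := ((tendsto_integral_min_sq_gaussian.eventually
      (eventually_gt_nhds (sub_lt_self 1 hη))).and (eventually_gt_atTop 0)).exists
    refine ⟨M, by exact_mod_cast h2, fun i => ?_⟩
    have := tendsto_integral_min_sq_sum (h.score_measurable i) (h.score_mean i) (h.score_sq i) M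
    filter_upwards [this.eventually (eventually_gt_nhds h1)] with n hn
    exact hn.le
  lan ε hε := by
    obtain ⟨δ, hδ, m, hm, hmean, htaylor⟩ := h.taylor (ε / 2) (half_pos hε)
    set Y : ∀ n : ℕ, (Fin n → Ω) → ℝ := fun n ω => |sampleMean m n ω - ∫ ω, m ω ∂P| +
      ∑ i, ∑ j, |sampleMean (H i j) n ω - ∫ ω, H i j ω ∂P| with hY
    have hneg : IsNegligible (fun n => Measure.pi fun _ : Fin n => P) Y :=
      (isNegligible_sampleMean_sub hm).add (IsNegligible.sum _ fun i => IsNegligible.sum _ fun j =>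
        isNegligible_sampleMean_sub (h.hess_memLp i j))
    refine ⟨δ, hδ, fun n ω => ε / 2 + Y n ω, fun n => ⟨(integrable_const _).add
      (hneg.integrable n), fun ω => add_nonneg (half_pos hε).le (hneg.nonneg n ω)⟩, ?_, ?_, ?_⟩
    · filter_upwards [hneg.tendsto_integral.eventually (eventually_lt_nhds (half_pos hε))] with n hn
      rw [integral_add (integrable_const _) (hneg.integrable n)]
      simp only [integral_const, probReal_univ, one_smul]
      linarith
    · refine (hneg.tendsto_prob (ε / 2) (half_pos hε)).congr fun n => ?_
      congr 2
      ext ω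
      simp only [Set.mem_ofPred_eq]
      constructor <;> intro h <;> linarith
    · intro n hn
      filter_upwards [ae_pi_eval htaylor n] with ω hω u hu
      have hpos : 0 < ∏ k, r u (ω k) := Finset.prod_pos fun k _ => (hω k u hu).1
      have h1 := abs_log_prod_sub_le hn (h := fun i j => ∫ ω, H i j ω ∂P) h.hess_mean
        fun k => hω k u hu
      have h2 : sampleMean m n ω + ∑ i, ∑ j, |sampleMean (H i j) n ω - ∫ ω, H i j ω ∂P| ≤
          ε / 2 + Y n ω := by
        have := le_abs_self (sampleMean m n ω - ∫ ω, m ω ∂P)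
        simp only [hY]
        linarith
      have h3 : (n : ℝ) / 2 * (sampleMean m n ω +
          ∑ i, ∑ j, |sampleMean (H i j) n ω - ∫ ω, H i j ω ∂P|) * ‖u‖ ^ 2 ≤
          n / 2 * (ε / 2 + Y n ω) * ‖u‖ ^ 2 := by gcongr
      have h4 := abs_le.1 (h1.trans h3)
      constructor
      · rw [← Real.le_log_iff_exp_le hpos]
        linarith [h4.1]
      · rw [← Real.log_le_iff_le_exp hpos]
        linarith [h4.2]
  tests := h.tests

end StandardModel


/-! ### Products with a counting measure, densities of product measures -/

section ProductMeasures

variable {X T : Type*} [MeasurableSpace X] [Fintype T] [MeasurableSpace T]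
  [MeasurableSingletonClass T] {μ : Measure X} [SigmaFinite μ]

omit [MeasurableSingletonClass T] in
-- Reduces integrals and almost-everywhere statements on `X × T` to one copy of `μ` for each label.
theorem prod_count_eq_sum :
    μ.prod (Measure.count : Measure T) = ∑ t, μ.map fun x => (x, t) := by
  rw [Measure.count, Measure.prod_sum_right, Measure.sum_fintype]
  simp_rw [Measure.prod_dirac]

theorem ae_prod_count_iff {p : X × T → Prop} :
    (∀ᵐ ω ∂μ.prod (Measure.count : Measure T), p ω) ↔ ∀ t, ∀ᵐ x ∂μ, p (x, t) := by
  rw [prod_count_eq_sum, ae_finsetSum_measure_iff]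
  simp only [Finset.mem_univ, forall_true_left]
  exact forall_congr' fun t => (measurableEmbedding_prod_mk_right t).ae_map_iff

theorem lintegral_prod_count (F : X × T → ENNReal) :
    ∫⁻ ω, F ω ∂μ.prod (Measure.count : Measure T) = ∑ t, ∫⁻ x, F (x, t) ∂μ := by
  rw [prod_count_eq_sum, lintegral_finsetSum_measure]
  exact Finset.sum_congr rfl fun t _ => (measurableEmbedding_prod_mk_right t).lintegral_map _

theorem integrable_prod_count_iff {F : X × T → ℝ} :
    Integrable F (μ.prod (Measure.count : Measure T)) ↔ ∀ t, Integrable (fun x => F (x, t)) μ := by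
  rw [prod_count_eq_sum, integrable_finsetSum_measure]
  simp only [Finset.mem_univ, forall_true_left]
  exact forall_congr' fun t => (measurableEmbedding_prod_mk_right t).integrable_map_iff

theorem integral_prod_count {F : X × T → ℝ}
    (hF : Integrable F (μ.prod (Measure.count : Measure T))) :
    ∫ ω, F ω ∂μ.prod (Measure.count : Measure T) = ∫ x, ∑ t, F (x, t) ∂μ := by
  rw [integral_finsetSum _ fun t _ => integrable_prod_count_iff.1 hF t]
  rw [prod_count_eq_sum] at hF ⊢
  rw [integral_finsetSum_measure (integrable_finsetSum_measure.1 hF)]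
  exact Finset.sum_congr rfl fun t _ => (measurableEmbedding_prod_mk_right t).integral_map _

/-- A sequence of pairs as a pair of sequences, for the measures `(μ ⊗ count)ⁿ`. -/
theorem measurePreserving_pi_prod_count (n : ℕ) :
    MeasurePreserving (MeasurableEquiv.arrowProdEquivProdArrow X T (Fin n))
      (Measure.pi fun _ : Fin n => μ.prod (Measure.count : Measure T))
      ((Measure.pi fun _ : Fin n => μ).prod (Measure.count : Measure (Fin n → T))) := by
  have h : (Measure.pi fun _ : Fin n => (Measure.count : Measure T)) = Measure.count := by
    rw [Measure.ext_iff_singleton]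
    intro a
    simp
  have := measurePreserving_arrowProdEquivProdArrow X T (Fin n) (fun _ => μ)
    (fun _ => (Measure.count : Measure T))
  rwa [h] at this

variable {Ω : Type*} [MeasurableSpace Ω] {ν : Measure Ω} [SigmaFinite ν]

/-- The product of measures with a density. -/
theorem pi_withDensity {f : Ω → ENNReal} (hf : Measurable f) [SigmaFinite (ν.withDensity f)]
    (n : ℕ) :
    (Measure.pi fun _ : Fin n => ν.withDensity f) =
      (Measure.pi fun _ : Fin n => ν).withDensity fun ω => ∏ k, f (ω k) := by
  refine Measure.pi_eq fun s hs => ?_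
  rw [withDensity_apply _ (MeasurableSet.univ_pi hs), ← lintegral_indicator (MeasurableSet.univ_pi hs)]
  have : (Set.univ.pi s).indicator (fun ω : Fin n → Ω => ∏ k, f (ω k)) =
      fun ω => ∏ k, (s k).indicator f (ω k) := by
    funext ω
    by_cases h : ω ∈ Set.univ.pi s
    · rw [Set.indicator_of_mem h]
      exact Finset.prod_congr rfl fun k _ => (Set.indicator_of_mem (h k (Set.mem_univ k)) _).symm
    · rw [Set.indicator_of_notMem h]
      simp only [Set.mem_pi, Set.mem_univ, forall_true_left, not_forall] at h
      obtain ⟨k, hk⟩ := h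
      exact (Finset.prod_eq_zero (Finset.mem_univ k) (Set.indicator_of_notMem hk _)).symm
  rw [this, lintegral_pi_prod (fun k => (s k).indicator f) fun k => (hf.indicator (hs k)).aemeasurable]
  refine Finset.prod_congr rfl fun k _ => ?_
  rw [lintegral_indicator (hs k), withDensity_apply _ (hs k)]

end ProductMeasures

/-! ### Exponentially consistent tests -/

section Tests

variable {Ω : Type*} [MeasurableSpace Ω]

/-- Hoeffding's inequality for the empirical frequency of an event. -/
theorem measureReal_le_abs_sampleMean_sub {Q : Measure Ω} [IsProbabilityMeasure Q] {B : Set Ω}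
    (hB : MeasurableSet B) {ε : ℝ} (hε : 0 ≤ ε) (n : ℕ) :
    (Measure.pi fun _ : Fin n => Q).real {ω | ε ≤ |sampleMean (B.indicator 1) n ω - Q.real B|} ≤
      2 * Real.exp (-(2 * ε ^ 2) * n) := by
  rcases Nat.eq_zero_or_pos n with rfl | hn
  · simp only [Nat.cast_zero, mul_zero, Real.exp_zero, mul_one]
    exact measureReal_le_one.trans one_le_two
  have hn0 : (0 : ℝ) < n := by exact_mod_cast hn
  set g : Ω → ℝ := B.indicator 1 with hg
  have hgm : Measurable g := measurable_one.indicator hB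
  have hgmean : ∀ k : Fin n, ∫ ω : Fin n → Ω, g (ω k) ∂(Measure.pi fun _ : Fin n => Q) = Q.real B := by
    intro k
    rw [integral_pi_eval hgm.aestronglyMeasurable, hg, integral_indicator_one hB]
  have hg01 : ∀ ω, g ω ∈ Set.Icc (0 : ℝ) 1 := fun ω =>
    ⟨Set.indicator_nonneg (fun _ _ => zero_le_one) ω, Set.indicator_le_self' (fun _ _ => zero_le_one) ω⟩
  have hsub : ∀ k : Fin n, ProbabilityTheory.HasSubgaussianMGF
      (fun ω : Fin n → Ω => g (ω k) - Q.real B) ((‖(1 : ℝ) - 0‖₊ / 2) ^ 2)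
      (Measure.pi fun _ : Fin n => Q) := by
    intro k
    have := ProbabilityTheory.hasSubgaussianMGF_of_mem_Icc (μ := Measure.pi fun _ : Fin n => Q)
      (X := fun ω : Fin n → Ω => g (ω k)) (a := 0) (b := 1)
      (hgm.comp (measurable_pi_apply k)).aemeasurable (Eventually.of_forall fun ω => hg01 _)
    rwa [hgmean] at this
  have hind : ProbabilityTheory.iIndepFun (fun (k : Fin n) (ω : Fin n → Ω) => g (ω k) - Q.real B)
      (Measure.pi fun _ : Fin n => Q) :=
    ProbabilityTheory.iIndepFun_pi (X := fun _ ω => g ω - Q.real B)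
      fun _ => (hgm.sub_const _).aemeasurable
  have hind' : ProbabilityTheory.iIndepFun (fun (k : Fin n) (ω : Fin n → Ω) => -(g (ω k) - Q.real B))
      (Measure.pi fun _ : Fin n => Q) :=
    ProbabilityTheory.iIndepFun_pi (X := fun _ ω => -(g ω - Q.real B))
      fun _ => (hgm.sub_const _).neg.aemeasurable
  have h1 := ProbabilityTheory.HasSubgaussianMGF.measure_sum_ge_le_of_iIndepFun hind
    (s := Finset.univ) (fun k _ => hsub k) (ε := n * ε) (by positivity)
  have h2 := ProbabilityTheory.HasSubgaussianMGF.measure_sum_ge_le_of_iIndepFun hind'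
    (s := Finset.univ) (fun k _ => (hsub k).neg) (ε := n * ε) (by positivity)
  -- Variables in `[0, 1]` have variance proxy `1 / 4`, so `n` of them give `(n ε)² / (2 · n / 4) =
  -- 2 ε² n`.
  have hexp : Real.exp (-(n * ε) ^ 2 /
      (2 * ((∑ _k : Fin n, (‖(1 : ℝ) - 0‖₊ / 2) ^ 2 : NNReal) : ℝ))) =
      Real.exp (-(2 * ε ^ 2) * n) := by
    congr 1
    simp
    field_simp
  rw [hexp] at h1 h2
  calc _ ≤ (Measure.pi fun _ : Fin n => Q).real
        ({ω | n * ε ≤ ∑ k, (g (ω k) - Q.real B)} ∪ {ω | n * ε ≤ ∑ k, -(g (ω k) - Q.real B)}) := by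
        refine measureReal_mono fun ω hω => ?_
        simp only [Set.mem_ofPred_eq, Set.mem_union] at hω ⊢
        have e : ∑ k, (g (ω k) - Q.real B) = n * (sampleMean g n ω - Q.real B) := by
          rw [sampleMean, Finset.sum_sub_distrib]
          simp only [Finset.sum_const, Finset.card_univ, Fintype.card_fin, nsmul_eq_mul]
          field_simp
        rw [Finset.sum_neg_distrib, e, ← mul_neg]
        rcases le_abs'.1 hω with h | h
        · right
          gcongr
          linarith
        · left
          gcongr
    _ ≤ _ := (measureReal_union_le _ _).trans (by linarith)

/-- Tests that are exponentially consistent against a family of probability measures that is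
separated from `Q₀` by finitely many events. -/
theorem exists_exponential_tests {Q₀ : Measure Ω} [IsProbabilityMeasure Q₀] {ℬ : Finset (Set Ω)}
    (hℬ : ∀ B ∈ ℬ, MeasurableSet B) {ε : ℝ} (hε : 0 < ε) :
    ∃ c > 0, ∃ C : ℝ, ∃ A : ∀ n : ℕ, Set (Fin n → Ω), (∀ n, MeasurableSet (A n)) ∧
      (∀ n, (Measure.pi fun _ : Fin n => Q₀).real (A n)ᶜ ≤ C * Real.exp (-c * n)) ∧
      ∀ Q : Measure Ω, IsProbabilityMeasure Q → (∃ B ∈ ℬ, ε ≤ |Q.real B - Q₀.real B|) →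
        ∀ n, (Measure.pi fun _ : Fin n => Q) (A n) ≤ ENNReal.ofReal (C * Real.exp (-c * n)) := by
  -- Accept `Q₀` when all empirical frequencies are within `ε / 2` of their values under `Q₀`. If
  -- `Q` differs by `ε` on some `B`, acceptance forces a deviation of at least `ε / 2` from `Q B`.
  -- The constant `C` covers the union bound under `Q₀` and the single event under `Q`.
  refine ⟨2 * (ε / 2) ^ 2, by positivity, 2 * ℬ.card + 2,
    fun n => ⋂ B ∈ ℬ, {ω | |sampleMean (B.indicator 1) n ω - Q₀.real B| < ε / 2}, ?_, ?_, ?_⟩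
  · intro n
    refine Finset.measurableSet_biInter _ fun B hB => measurableSet_lt ?_ measurable_const
    have : Measurable (sampleMean (B.indicator (1 : Ω → ℝ)) n) :=
      (Finset.measurable_fun_sum _ fun k _ =>
        (measurable_one.indicator (hℬ B hB)).comp (measurable_pi_apply k)).const_mul _
    exact (this.sub_const _).abs
  · intro n
    have h1 : (⋂ B ∈ ℬ, {ω : Fin n → Ω | |sampleMean (B.indicator 1) n ω - Q₀.real B| < ε / 2})ᶜ =
        ⋃ B ∈ ℬ, {ω | ε / 2 ≤ |sampleMean (B.indicator 1) n ω - Q₀.real B|} := by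
      ext ω
      simp
    rw [h1]
    calc _ ≤ ∑ B ∈ ℬ, (Measure.pi fun _ : Fin n => Q₀).real
          {ω | ε / 2 ≤ |sampleMean (B.indicator 1) n ω - Q₀.real B|} := measureReal_biUnion_finset_le _ _
      _ ≤ ∑ _B ∈ ℬ, 2 * Real.exp (-(2 * (ε / 2) ^ 2) * n) :=
          Finset.sum_le_sum fun B hB => measureReal_le_abs_sampleMean_sub (hℬ B hB) (half_pos hε).le n
      _ = (2 * ℬ.card) * Real.exp (-(2 * (ε / 2) ^ 2) * n) := by
          rw [Finset.sum_const, nsmul_eq_mul]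
          ring
      _ ≤ _ := by
          gcongr
          linarith
  · rintro Q hQ ⟨B, hB, hsep⟩ n
    have h1 := measureReal_le_abs_sampleMean_sub (Q := Q) (hℬ B hB) (half_pos hε).le n
    rw [← ENNReal.ofReal_toReal (measure_ne_top _ _)]
    refine ENNReal.ofReal_le_ofReal ?_
    calc _ ≤ (Measure.pi fun _ : Fin n => Q).real
          {ω | ε / 2 ≤ |sampleMean (B.indicator 1) n ω - Q.real B|} := by
          refine measureReal_mono fun ω hω => ?_
          have h2 : |sampleMean (B.indicator 1) n ω - Q₀.real B| < ε / 2 :=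
            Set.mem_iInter₂.1 hω B hB
          have h3 := abs_sub_abs_le_abs_sub (Q.real B - Q₀.real B)
            (sampleMean (B.indicator 1) n ω - Q₀.real B)
          rw [sub_sub_sub_cancel_right,
            abs_sub_comm (Q.real B) (sampleMean (B.indicator 1) n ω)] at h3
          show ε / 2 ≤ _
          linarith
      _ ≤ 2 * Real.exp (-(2 * (ε / 2) ^ 2) * n) := h1
      _ ≤ _ := by
          gcongr
          have : (0 : ℝ) ≤ ℬ.card := by positivity
          linarith

theorem tendsto_mul_exp_mul_log {c : ℝ} (hc : 0 < c) (C : ℝ) :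
    Tendsto (fun n : ℕ => C * Real.exp (-c * n) * Real.log n) atTop (𝓝 0) := by
  have h1 := (Real.tendsto_pow_mul_exp_neg_atTop_nhds_zero 1).comp
    (tendsto_natCast_atTop_atTop.const_mul_atTop hc)
  have h2 := h1.const_mul (|C| * c⁻¹)
  rw [mul_zero] at h2
  refine squeeze_zero_norm (fun n => ?_) h2
  rw [Real.norm_eq_abs, abs_mul, abs_mul, abs_of_pos (Real.exp_pos _),
    abs_of_nonneg (Real.log_natCast_nonneg n)]
  calc _ ≤ |C| * Real.exp (-c * n) * n := by
        gcongr
        exact Real.log_le_self (Nat.cast_nonneg n)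
    _ = _ := by
        simp only [Function.comp]
        rw [show -c * (n : ℝ) = -(c * n) by ring]
        field_simp

variable {d : ℕ} {X T : Type*} [MeasurableSpace X]

/-- An identified parameter is separated from the complement of each of its neighbourhoods by
finitely many events. -/
theorem IsIdentifiedAt.exists_finset [Fintype T] {μ : Measure X} {W : Set (Param d)}
    {g : Param d → X → T → ℝ} {w₀ : Param d} (h : IsIdentifiedAt μ W g w₀) {N : Set (Param d)}
    (hN : N ∈ 𝓝 w₀) :
    ∃ s : Finset (T × Set X), (∀ p ∈ s, MeasurableSet p.2) ∧ ∃ ε > 0, ∀ w ∈ W, w ∉ N →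
      ∃ p ∈ s, ε ≤ |∫ x in p.2, g w x p.1 ∂μ - ∫ x in p.2, g w₀ x p.1 ∂μ| := by
  classical
  set Φ : Param d → (T × {A : Set X // MeasurableSet A}) → ℝ :=
    fun w p => ∫ x in p.2.1, g w x p.1 ∂μ with hΦ
  -- This is the coarsest filter satisfying the premise of identification, so it contains `N`. A
  -- basic neighbourhood in the product topology restricts only finitely many coordinates, that is,
  -- finitely many events.
  have hl : N ∈ 𝓟 W ⊓ comap Φ (𝓝 (Φ w₀)) := by
    refine h (𝓟 W ⊓ comap Φ (𝓝 (Φ w₀))) inf_le_left (fun t A hA => ?_) hN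
    have h1 : Tendsto Φ (𝓟 W ⊓ comap Φ (𝓝 (Φ w₀))) (𝓝 (Φ w₀)) :=
      tendsto_comap.mono_left inf_le_right
    exact (tendsto_pi_nhds.1 h1) (t, ⟨A, hA⟩)
  rw [inf_comm, mem_inf_principal, nhds_pi,
    ((hasBasis_pi fun p => Metric.nhds_basis_ball (x := Φ w₀ p)).comap Φ).mem_iff] at hl
  obtain ⟨⟨I, ε⟩, ⟨hI, hε⟩, hsub⟩ := hl
  have hmin : ∃ ε₀ > 0, ∀ p ∈ I, ε₀ ≤ ε p := by
    rcases I.eq_empty_or_nonempty with rfl | hne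
    · exact ⟨1, one_pos, by simp⟩
    · obtain ⟨p, hp, hle⟩ := Set.exists_min_image I ε hI hne
      exact ⟨ε p, hε p hp, hle⟩
  obtain ⟨ε₀, hε₀, hle⟩ := hmin
  refine ⟨hI.toFinset.image fun p => (p.1, p.2.1), ?_, ε₀, hε₀, fun w hw hwN => ?_⟩
  · intro p hp
    obtain ⟨p', -, rfl⟩ := Finset.mem_image.1 hp
    exact p'.2.2
  · by_contra hcon
    push Not at hcon
    refine hwN (hsub ?_ hw)
    simp only [Set.mem_preimage, Set.mem_pi, Metric.mem_ball]
    intro p hp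
    have := hcon (p.1, p.2.1) (Finset.mem_image.2 ⟨p, hI.mem_toFinset.2 hp, rfl⟩)
    rw [Real.dist_eq]
    exact this.trans_le (hle p hp)

end Tests


/-! ### Second-order calculus of a function and of its logarithm -/

section Calculus

variable {d : ℕ}

theorem fderiv_apply_eq_sum (F : Param d → ℝ) (w u : Param d) :
    fderiv ℝ F w u = ∑ i, u i * partialDeriv i F w := by
  have h := (EuclideanSpace.basisFun (Fin d) ℝ).sum_repr u
  conv_lhs => rw [← h]
  simp [partialDeriv, map_sum]

theorem partialDeriv_congr {F F' : Param d → ℝ} {w : Param d} (h : F =ᶠ[𝓝 w] F') (i : Fin d) :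
    partialDeriv i F w = partialDeriv i F' w := by
  rw [partialDeriv, partialDeriv, h.fderiv_eq]

theorem contDiffOn_partialDeriv {F : Param d → ℝ} {s : Set (Param d)} (hs : IsOpen s)
    (hF : ContDiffOn ℝ 2 F s) (i : Fin d) : ContDiffOn ℝ 1 (partialDeriv i F) s :=
  (hF.fderiv_of_isOpen hs (by norm_num)).clm_apply contDiffOn_const

theorem continuousOn_partialDeriv {F : Param d → ℝ} {s : Set (Param d)} (hs : IsOpen s)
    (hF : ContDiffOn ℝ 1 F s) (i : Fin d) : ContinuousOn (partialDeriv i F) s :=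
  (hF.continuousOn_fderiv_of_isOpen hs le_rfl).clm_apply continuousOn_const

theorem continuousOn_partialDeriv_partialDeriv {F : Param d → ℝ} {s : Set (Param d)} (hs : IsOpen s)
    (hF : ContDiffOn ℝ 2 F s) (i j : Fin d) :
    ContinuousOn (partialDeriv i (partialDeriv j F)) s :=
  continuousOn_partialDeriv hs (contDiffOn_partialDeriv hs hF j) i

/-- Rolle's theorem twice: `K` is chosen so that `γ t - γ' 0 * t - K * t ^ 2` takes equal values at
`0` and `1`, and its derivative also vanishes at `0`. Continuity of `γ''` is not needed. -/
theorem exists_taylor_two_of_hasDerivAt {γ γ' γ'' : ℝ → ℝ}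
    (h1 : ∀ t ∈ Set.Icc (0 : ℝ) 1, HasDerivAt γ (γ' t) t)
    (h2 : ∀ t ∈ Set.Icc (0 : ℝ) 1, HasDerivAt γ' (γ'' t) t) :
    ∃ ξ ∈ Set.Ioo (0 : ℝ) 1, γ 1 = γ 0 + γ' 0 + 1 / 2 * γ'' ξ := by
  set K := γ 1 - γ 0 - γ' 0 with hK
  have e1 : ∀ t ∈ Set.Icc (0 : ℝ) 1,
      HasDerivAt (fun t => γ t - γ' 0 * t - K * t ^ 2) (γ' t - γ' 0 - K * (2 * t)) t := by
    intro t ht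
    have := ((h1 t ht).sub ((hasDerivAt_id t).const_mul (γ' 0))).sub
      ((hasDerivAt_pow 2 t).const_mul K)
    refine this.congr_deriv ?_
    simp
  obtain ⟨t₁, ht₁, h3⟩ := exists_hasDerivAt_eq_zero (f := fun t => γ t - γ' 0 * t - K * t ^ 2)
    zero_lt_one (fun t ht => (e1 t ht).continuousAt.continuousWithinAt)
    (by simp [hK]) fun t ht => e1 t (Set.Ioo_subset_Icc_self ht)
  have hsub : Set.Icc (0 : ℝ) t₁ ⊆ Set.Icc 0 1 := Set.Icc_subset_Icc_right ht₁.2.le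
  have e2 : ∀ t ∈ Set.Icc (0 : ℝ) t₁,
      HasDerivAt (fun t => γ' t - γ' 0 - K * (2 * t)) (γ'' t - 2 * K) t := by
    intro t ht
    have := ((h2 t (hsub ht)).sub_const (γ' 0)).sub (((hasDerivAt_id t).const_mul 2).const_mul K)
    refine this.congr_deriv ?_
    ring
  obtain ⟨ξ, hξ, h4⟩ := exists_hasDerivAt_eq_zero (f := fun t => γ' t - γ' 0 - K * (2 * t))
    ht₁.1 (fun t ht => (e2 t ht).continuousAt.continuousWithinAt)
    (by rw [h3]; ring) fun t ht => e2 t (Set.Ioo_subset_Icc_self ht)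
  exact ⟨ξ, ⟨hξ.1, hξ.2.trans ht₁.2⟩, by linarith⟩

/-- Taylor's formula of order two at the centre of a ball. -/
theorem exists_taylor_two {F : Param d → ℝ} {r : ℝ}
    (hF : ContDiffOn ℝ 2 F (Metric.ball 0 r)) {u : Param d} (hu : u ∈ Metric.ball (0 : Param d) r) :
    ∃ ξ ∈ Set.Ioo (0 : ℝ) 1, F u = F 0 + ∑ i, u i * partialDeriv i F 0 +
      1 / 2 * ∑ i, ∑ j, u i * u j * partialDeriv i (partialDeriv j F) (ξ • u) := by
  have hmem : ∀ t ∈ Set.Icc (0 : ℝ) 1, t • u ∈ Metric.ball (0 : Param d) r := by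
    intro t ht
    rw [mem_ball_zero_iff] at hu ⊢
    rw [norm_smul, Real.norm_eq_abs, abs_of_nonneg ht.1]
    exact (mul_le_of_le_one_left (norm_nonneg _) ht.2).trans_lt hu
  have hline : ∀ t : ℝ, HasDerivAt (fun t : ℝ => t • u) u t := fun t => by
    simpa using (hasDerivAt_id t).smul_const u
  have hchain : ∀ G : Param d → ℝ, ContDiffOn ℝ 1 G (Metric.ball 0 r) →
      ∀ t ∈ Set.Icc (0 : ℝ) 1, HasDerivAt (fun t : ℝ => G (t • u))
        (∑ i, u i * partialDeriv i G (t • u)) t := by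
    intro G hG t ht
    have h1 : DifferentiableAt ℝ G (t • u) :=
      (hG.differentiableOn one_ne_zero).differentiableAt (Metric.isOpen_ball.mem_nhds (hmem t ht))
    have h2 := h1.hasFDerivAt.comp_hasDerivAt t (hline t)
    rwa [fderiv_apply_eq_sum] at h2
  have h1 := hchain F (hF.of_le (by norm_num))
  have h2 : ∀ t ∈ Set.Icc (0 : ℝ) 1,
      HasDerivAt (fun t : ℝ => ∑ j, u j * partialDeriv j F (t • u))
        (∑ j, u j * ∑ i, u i * partialDeriv i (partialDeriv j F) (t • u)) t := fun t ht =>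
    HasDerivAt.fun_sum fun j _ =>
      (hchain _ (contDiffOn_partialDeriv Metric.isOpen_ball hF j) t ht).const_mul _
  obtain ⟨ξ, hξ, h3⟩ := exists_taylor_two_of_hasDerivAt h1 h2
  refine ⟨ξ, hξ, ?_⟩
  simp only [one_smul, zero_smul] at h3
  rw [h3, Finset.sum_comm]
  congr 2
  refine Finset.sum_congr rfl fun j _ => ?_
  rw [Finset.mul_sum]
  exact Finset.sum_congr rfl fun i _ => by ring

/-- The regularity of one density as a function of the parameter on a ball around the origin. -/
def IsRegularPath (r : ℝ) (F : Param d → ℝ) (h G : ℝ) : Prop :=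
  ContDiffOn ℝ 2 F (Metric.ball 0 r) ∧ ∀ w ∈ Metric.ball (0 : Param d) r,
    (F w = 0 ↔ F 0 = 0) ∧ ∀ i j, |partialDeriv i (partialDeriv j F) w| ≤ h ∧
      (F 0 ≠ 0 → |partialDeriv i (partialDeriv j fun v => Real.log (F v)) w| ≤ G)

namespace IsRegularPath

variable {r h G : ℝ} {F : Param d → ℝ}

/-- The support condition leaves two cases: the density has no zero on the ball, or it vanishes
identically there and `Real.log 0 = 0` makes the logarithm constant. -/
theorem contDiffOn_log (hF : IsRegularPath r F h G) :
    ContDiffOn ℝ 2 (fun w => Real.log (F w)) (Metric.ball 0 r) := by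
  by_cases h0 : F 0 = 0
  · refine (contDiffOn_const (c := (0 : ℝ))).congr fun w hw => ?_
    rw [((hF.2 w hw).1).2 h0, Real.log_zero]
  · exact hF.1.log fun w hw => fun hw0 => h0 (((hF.2 w hw).1).1 hw0)

theorem partialDeriv_eq (hF : IsRegularPath r F h G) {w : Param d}
    (hw : w ∈ Metric.ball (0 : Param d) r) (i : Fin d) :
    partialDeriv i F w = partialDeriv i (fun v => Real.log (F v)) w * F w := by
  have hnhds := Metric.isOpen_ball.mem_nhds hw
  by_cases h0 : F 0 = 0
  · have h1 : F =ᶠ[𝓝 w] fun _ => 0 := by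
      filter_upwards [hnhds] with v hv using ((hF.2 v hv).1).2 h0
    rw [partialDeriv_congr h1, h1.eq_of_nhds]
    simp [partialDeriv]
  · have hw0 : F w ≠ 0 := fun hw0 => h0 (((hF.2 w hw).1).1 hw0)
    have h1 : DifferentiableAt ℝ F w :=
      (hF.1.differentiableOn two_ne_zero).differentiableAt hnhds
    rw [partialDeriv, partialDeriv, fderiv.log h1 hw0]
    simp only [smul_apply, smul_eq_mul]
    field_simp

/-- Differentiate `∂ⱼ F = (∂ⱼ log F) F` once more. This is the pointwise form of the information
identity. -/
theorem partialDeriv_partialDeriv_eq (hF : IsRegularPath r F h G) (hr : 0 < r) (i j : Fin d) :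
    partialDeriv i (partialDeriv j F) 0 =
      (partialDeriv i (partialDeriv j fun v => Real.log (F v)) 0 +
        partialDeriv i (fun v => Real.log (F v)) 0 * partialDeriv j (fun v => Real.log (F v)) 0) *
      F 0 := by
  have h0 : (0 : Param d) ∈ Metric.ball (0 : Param d) r := Metric.mem_ball_self hr
  have hnhds := Metric.isOpen_ball.mem_nhds h0
  have h1 : partialDeriv j F =ᶠ[𝓝 0]
      fun w => partialDeriv j (fun v => Real.log (F v)) w * F w := by
    filter_upwards [hnhds] with w hw using hF.partialDeriv_eq hw j
  have d1 : DifferentiableAt ℝ F 0 := (hF.1.differentiableOn two_ne_zero).differentiableAt hnhds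
  have d2 : DifferentiableAt ℝ (partialDeriv j fun v => Real.log (F v)) 0 :=
    ((contDiffOn_partialDeriv Metric.isOpen_ball hF.contDiffOn_log j).differentiableOn
      one_ne_zero).differentiableAt hnhds
  have h2 := hF.partialDeriv_eq h0 i
  rw [partialDeriv_congr h1, partialDeriv, fderiv_fun_mul d2 d1]
  simp only [add_apply, smul_apply, smul_eq_mul]
  rw [show fderiv ℝ F 0 (EuclideanSpace.single i 1) = partialDeriv i F 0 from rfl, h2]
  simp only [partialDeriv]
  ring

/-- The remainder of the second-order Taylor polynomial of the logarithm. -/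
noncomputable def logRem (F : Param d → ℝ) (u : Param d) : ℝ :=
  Real.log (F u) - Real.log (F 0) - ∑ i, u i * partialDeriv i (fun v => Real.log (F v)) 0 -
    1 / 2 * ∑ i, ∑ j, u i * u j * partialDeriv i (partialDeriv j fun v => Real.log (F v)) 0

theorem continuousOn_logRem (hF : IsRegularPath r F h G) :
    ContinuousOn (logRem F) (Metric.ball 0 r) := by
  have h1 : ContinuousOn (fun u => Real.log (F u)) (Metric.ball 0 r) :=
    hF.contDiffOn_log.continuousOn
  have h2 : ContinuousOn (fun u : Param d =>
      Real.log (F 0) + ∑ i, u i * partialDeriv i (fun v => Real.log (F v)) 0 + 1 / 2 * ∑ i, ∑ j,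
        u i * u j * partialDeriv i (partialDeriv j fun v => Real.log (F v)) 0)
      (Metric.ball 0 r) := by
    refine Continuous.continuousOn ?_
    fun_prop
  refine (h1.sub h2).congr fun u _ => ?_
  simp only [logRem, Pi.sub_apply]
  ring

theorem abs_logRem_le_of_forall (hF : IsRegularPath r F h G) {δ ε : ℝ} (hδ : δ ≤ r)
    (hε : ∀ w ∈ Metric.ball (0 : Param d) δ, ∑ i, ∑ j,
      |partialDeriv i (partialDeriv j fun v => Real.log (F v)) w -
        partialDeriv i (partialDeriv j fun v => Real.log (F v)) 0| ≤ ε)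
    {u : Param d} (hu : u ∈ Metric.ball (0 : Param d) δ) : |logRem F u| ≤ 1 / 2 * ε * ‖u‖ ^ 2 := by
  obtain ⟨ξ, hξ, h1⟩ := exists_taylor_two hF.contDiffOn_log (Metric.ball_subset_ball hδ hu)
  have hmem : ξ • u ∈ Metric.ball (0 : Param d) δ := by
    rw [mem_ball_zero_iff] at hu ⊢
    rw [norm_smul, Real.norm_eq_abs, abs_of_pos hξ.1]
    exact (mul_le_of_le_one_left (norm_nonneg _) hξ.2.le).trans_lt hu
  have h2 : logRem F u = 1 / 2 * ∑ i, ∑ j, u i * u j *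
      (partialDeriv i (partialDeriv j fun v => Real.log (F v)) (ξ • u) -
        partialDeriv i (partialDeriv j fun v => Real.log (F v)) 0) := by
    simp_rw [mul_sub, Finset.sum_sub_distrib]
    rw [logRem, h1]
    ring
  rw [h2, abs_mul, abs_of_pos (by norm_num : (0 : ℝ) < 1 / 2), mul_assoc]
  gcongr
  refine (abs_quadratic_le u _).trans ?_
  gcongr
  exact hε _ hmem

/-- Each of the `d ^ 2` Hessian entries varies by at most `2 * G` on the ball. This is the majorant
for dominated convergence, while `exists_abs_logRem_le` supplies the pointwise limit. -/
theorem abs_logRem_le (hF : IsRegularPath r F h G) (hr : 0 < r) (h0 : F 0 ≠ 0) {u : Param d}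
    (hu : u ∈ Metric.ball (0 : Param d) r) :
    |logRem F u| ≤ 1 / 2 * (2 * d ^ 2 * G) * ‖u‖ ^ 2 := by
  refine hF.abs_logRem_le_of_forall le_rfl (fun w hw => ?_) hu
  calc _ ≤ ∑ _i : Fin d, ∑ _j : Fin d, (G + G) := by
        refine Finset.sum_le_sum fun i _ => Finset.sum_le_sum fun j _ => ?_
        exact (abs_sub _ _).trans (add_le_add (((hF.2 w hw).2 i j).2 h0)
          (((hF.2 0 (Metric.mem_ball_self hr)).2 i j).2 h0))
    _ = _ := by
        simp only [Finset.sum_const, Finset.card_univ, Fintype.card_fin, nsmul_eq_mul]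
        ring

theorem exists_abs_logRem_le (hF : IsRegularPath r F h G) (hr : 0 < r) {ε : ℝ} (hε : 0 < ε) :
    ∃ δ > 0, δ ≤ r ∧ ∀ u ∈ Metric.ball (0 : Param d) δ, |logRem F u| ≤ 1 / 2 * ε * ‖u‖ ^ 2 := by
  have hnhds := Metric.isOpen_ball.mem_nhds (Metric.mem_ball_self (x := (0 : Param d)) hr)
  have hc : ContinuousAt (fun w => ∑ i, ∑ j,
      |partialDeriv i (partialDeriv j fun v => Real.log (F v)) w -
        partialDeriv i (partialDeriv j fun v => Real.log (F v)) 0|) 0 := by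
    refine tendsto_finsetSum _ fun i _ => tendsto_finsetSum _ fun j _ => ?_
    exact (((continuousOn_partialDeriv_partialDeriv Metric.isOpen_ball hF.contDiffOn_log i
      j).continuousAt hnhds).sub continuousAt_const).abs
  have hlt : ∀ᶠ w in 𝓝 (0 : Param d), ∑ i, ∑ j,
      |partialDeriv i (partialDeriv j fun v => Real.log (F v)) w -
        partialDeriv i (partialDeriv j fun v => Real.log (F v)) 0| < ε :=
    hc.eventually_lt_const (by simpa using hε)
  obtain ⟨δ, hδ, hsub⟩ := Metric.mem_nhds_iff.1 hlt
  refine ⟨min δ r, lt_min hδ hr, min_le_right _ _, fun u hu => ?_⟩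
  exact hF.abs_logRem_le_of_forall (min_le_right _ _)
    (fun w hw => (hsub (Metric.ball_subset_ball (min_le_left _ _) hw)).le) hu

/-- The supremum of the relative Taylor remainder over a countable dense subset of a ball. -/
noncomputable def supRem (F : Param d → ℝ) (δ : ℝ) : ENNReal :=
  ⨆ n : ℕ, ENNReal.ofReal ((Metric.ball (0 : Param d) δ).indicator
    (fun v => 2 * |logRem F v| / ‖v‖ ^ 2) (TopologicalSpace.denseSeq (Param d) n))

theorem supRem_le {δ ε : ℝ} (hε : 0 ≤ ε)
    (h : ∀ u ∈ Metric.ball (0 : Param d) δ, |logRem F u| ≤ 1 / 2 * ε * ‖u‖ ^ 2) :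
    supRem F δ ≤ ENNReal.ofReal ε := by
  refine iSup_le fun n => ENNReal.ofReal_le_ofReal ?_
  by_cases hn : TopologicalSpace.denseSeq (Param d) n ∈ Metric.ball (0 : Param d) δ
  · rw [Set.indicator_of_mem hn]
    refine div_le_of_le_mul₀ (by positivity) hε ?_
    linarith [h _ hn]
  · rwa [Set.indicator_of_notMem hn]

/-- A countable supremum is measurable in the observation, and continuity in `u` loses nothing: the
set where the bound fails is open, so it would contain a point of the dense sequence. -/
theorem abs_logRem_le_supRem (hF : IsRegularPath r F h G) {δ : ℝ} (hδ : δ ≤ r)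
    (hfin : supRem F δ ≠ ⊤) {u : Param d} (hu : u ∈ Metric.ball (0 : Param d) δ) :
    |logRem F u| ≤ 1 / 2 * (supRem F δ).toReal * ‖u‖ ^ 2 := by
  by_contra hcon
  rw [not_le] at hcon
  have hcont : ContinuousOn (fun v => |logRem F v| - 1 / 2 * (supRem F δ).toReal * ‖v‖ ^ 2)
      (Metric.ball 0 δ) :=
    ((hF.continuousOn_logRem.mono (Metric.ball_subset_ball hδ)).abs).sub
      (Continuous.continuousOn (by fun_prop))
  have hopen := hcont.isOpen_inter_preimage Metric.isOpen_ball (isOpen_Ioi (a := (0 : ℝ)))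
  obtain ⟨v, ⟨hv1, hv2⟩, n, rfl⟩ := (TopologicalSpace.denseRange_denseSeq (Param d)).inter_open_nonempty _ hopen
    ⟨u, hu, by simpa using hcon⟩
  set v := TopologicalSpace.denseSeq (Param d) n with hv
  simp only [Set.mem_preimage, Set.mem_Ioi, sub_pos] at hv2
  have h1 : ENNReal.ofReal (2 * |logRem F v| / ‖v‖ ^ 2) ≤ supRem F δ := by
    have := le_iSup (fun n : ℕ => ENNReal.ofReal ((Metric.ball (0 : Param d) δ).indicator
      (fun v => 2 * |logRem F v| / ‖v‖ ^ 2) (TopologicalSpace.denseSeq (Param d) n))) n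
    rwa [Set.indicator_of_mem hv1] at this
  rw [ENNReal.ofReal_le_iff_le_toReal hfin] at h1
  rcases eq_or_ne v 0 with h0 | h0
  · rw [h0] at hv2
    simp [logRem] at hv2
  · have : 0 < ‖v‖ := norm_pos_iff.2 h0
    rw [div_le_iff₀ (by positivity)] at h1
    linarith

end IsRegularPath

end Calculus


/-! ### Scores and Hessians of a regular family of densities -/

section RegularFamily

variable {d : ℕ} {Ω : Type*} [MeasurableSpace Ω] {ν : Measure Ω}

theorem exists_seq_mem_ball {r : ℝ} {u : Param d} (hu : u ∈ Metric.ball (0 : Param d) r)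
    (a : Param d) : ∃ ε : ℕ → ℝ, (∀ k, 0 < ε k) ∧ Tendsto ε atTop (𝓝 0) ∧
      ∀ k, u + ε k • a ∈ Metric.ball (0 : Param d) r := by
  rw [mem_ball_zero_iff] at hu
  have hpos : 0 < r - ‖u‖ := sub_pos.2 hu
  have ha : 0 < ‖a‖ + 1 := by positivity
  refine ⟨fun k => (r - ‖u‖) / (‖a‖ + 1) * (1 / ((k : ℝ) + 1)), fun k => by positivity, ?_,
    fun k => ?_⟩
  · simpa using (tendsto_one_div_add_atTop_nhds_zero_nat (𝕜 := ℝ)).const_mul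
      ((r - ‖u‖) / (‖a‖ + 1))
  · rw [mem_ball_zero_iff]
    have h1 : (1 : ℝ) / ((k : ℝ) + 1) ≤ 1 := by
      rw [div_le_one (by positivity)]
      linarith [(Nat.cast_nonneg k : (0 : ℝ) ≤ k)]
    have h2 : (r - ‖u‖) / (‖a‖ + 1) * ‖a‖ < r - ‖u‖ := by
      rw [div_mul_eq_mul_div, div_lt_iff₀ ha]
      nlinarith
    calc _ ≤ ‖u‖ + ‖((r - ‖u‖) / (‖a‖ + 1) * (1 / ((k : ℝ) + 1))) • a‖ := norm_add_le _ _
      _ = ‖u‖ + (r - ‖u‖) / (‖a‖ + 1) * ‖a‖ * (1 / ((k : ℝ) + 1)) := by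
          rw [norm_smul, Real.norm_eq_abs, abs_of_pos (by positivity)]
          ring
      _ ≤ ‖u‖ + (r - ‖u‖) / (‖a‖ + 1) * ‖a‖ * 1 := by gcongr
      _ < r := by linarith

/-- The derivative is an almost everywhere limit of difference quotients along a sequence of steps
that stay in the ball. -/
theorem aemeasurable_partialDeriv {F : Param d → Ω → ℝ} {r : ℝ}
    (hm : ∀ v ∈ Metric.ball (0 : Param d) r, AEMeasurable (F v) ν) {u : Param d}
    (hu : u ∈ Metric.ball (0 : Param d) r)
    (hd : ∀ᵐ ω ∂ν, DifferentiableAt ℝ (fun v => F v ω) u) (i : Fin d) :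
    AEMeasurable (fun ω => partialDeriv i (fun v => F v ω) u) ν := by
  obtain ⟨ε, hε, hlim, hmem⟩ := exists_seq_mem_ball hu (EuclideanSpace.single i (1 : ℝ))
  refine aemeasurable_of_tendsto_metrizable_ae atTop
    (f := fun k ω => (ε k)⁻¹ * (F (u + ε k • EuclideanSpace.single i (1 : ℝ)) ω - F u ω))
    (fun k => ((hm _ (hmem k)).sub (hm _ hu)).const_mul _) ?_
  filter_upwards [hd] with ω hω
  have hc : Tendsto (fun k => ‖(ε k)⁻¹‖) atTop atTop := by
    refine tendsto_norm_atTop_atTop.comp ?_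
    exact tendsto_inv_nhdsGT_zero.comp
      (tendsto_nhdsWithin_iff.2 ⟨hlim, Eventually.of_forall hε⟩)
  simpa [partialDeriv] using hω.hasFDerivAt.lim (EuclideanSpace.single i (1 : ℝ)) hc

/-- A family of densities on `Ω` that is regular on the ball of radius `r` around the origin. -/
structure IsRegularFamily (ν : Measure Ω) (f : Param d → Ω → ℝ) (r : ℝ) (h G : Ω → ℝ) : Prop where
  pos : 0 < r
  measurable : ∀ u, Measurable (f u)
  nonneg : ∀ u ∈ Metric.ball (0 : Param d) r, ∀ ω, 0 ≤ f u ω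
  integral_eq_one : ∀ u ∈ Metric.ball (0 : Param d) r, ∫ ω, f u ω ∂ν = 1
  path : ∀ᵐ ω ∂ν, IsRegularPath r (fun u => f u ω) (h ω) (G ω)
  integrable_h : Integrable h ν
  integrable_G : Integrable (fun ω => G ω ^ 2 * f 0 ω) ν

/-- The score of a family of densities at the origin. -/
noncomputable def score (f : Param d → Ω → ℝ) (i : Fin d) (ω : Ω) : ℝ :=
  partialDeriv i (fun v => Real.log (f v ω)) 0

/-- The Hessian of the log density at the origin. -/
noncomputable def logHess (f : Param d → Ω → ℝ) (i j : Fin d) (ω : Ω) : ℝ :=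
  partialDeriv i (partialDeriv j fun v => Real.log (f v ω)) 0

namespace IsRegularFamily

variable {f : Param d → Ω → ℝ} {r : ℝ} {h G : Ω → ℝ}

theorem zero_mem (hf : IsRegularFamily ν f r h G) : (0 : Param d) ∈ Metric.ball (0 : Param d) r :=
  Metric.mem_ball_self hf.pos

theorem integrable (hf : IsRegularFamily ν f r h G) {u : Param d}
    (hu : u ∈ Metric.ball (0 : Param d) r) : Integrable (f u) ν := by
  by_contra hcon
  have := hf.integral_eq_one u hu
  rw [integral_undef hcon] at this
  exact zero_ne_one this

theorem aemeasurable_partialDeriv_log (hf : IsRegularFamily ν f r h G) {u : Param d}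
    (hu : u ∈ Metric.ball (0 : Param d) r) (i : Fin d) :
    AEMeasurable (fun ω => partialDeriv i (fun v => Real.log (f v ω)) u) ν := by
  refine aemeasurable_partialDeriv (F := fun v ω => Real.log (f v ω)) (r := r)
    (fun v _ => (Real.measurable_log.comp (hf.measurable v)).aemeasurable) hu ?_ i
  filter_upwards [hf.path] with ω hω
  exact (hω.contDiffOn_log.differentiableOn two_ne_zero).differentiableAt
    (Metric.isOpen_ball.mem_nhds hu)

theorem aemeasurable_score (hf : IsRegularFamily ν f r h G) (i : Fin d) :
    AEMeasurable (score f i) ν :=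
  hf.aemeasurable_partialDeriv_log hf.zero_mem i

theorem aemeasurable_logHess (hf : IsRegularFamily ν f r h G) (i j : Fin d) :
    AEMeasurable (logHess f i j) ν := by
  refine aemeasurable_partialDeriv
    (F := fun v ω => partialDeriv j (fun v => Real.log (f v ω)) v) (r := r)
    (fun v hv => hf.aemeasurable_partialDeriv_log hv j) hf.zero_mem ?_ i
  filter_upwards [hf.path] with ω hω
  exact ((contDiffOn_partialDeriv Metric.isOpen_ball hω.contDiffOn_log j).differentiableOn
    one_ne_zero).differentiableAt (Metric.isOpen_ball.mem_nhds hf.zero_mem)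

theorem aemeasurable_logRem (hf : IsRegularFamily ν f r h G) (u : Param d) :
    AEMeasurable (fun ω => IsRegularPath.logRem (fun v => f v ω) u) ν := by
  have h1 : ∀ u, AEMeasurable (fun ω => Real.log (f u ω)) ν := fun u =>
    (Real.measurable_log.comp (hf.measurable u)).aemeasurable
  refine (((h1 u).sub (h1 0)).sub ?_).sub (AEMeasurable.const_mul ?_ _)
  · exact Finset.aemeasurable_fun_sum _ fun i _ => (hf.aemeasurable_score i).const_mul _
  · exact Finset.aemeasurable_fun_sum _ fun i _ => Finset.aemeasurable_fun_sum _ fun j _ =>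
      (hf.aemeasurable_logHess i j).const_mul _

theorem aemeasurable_supRem (hf : IsRegularFamily ν f r h G) (δ : ℝ) :
    AEMeasurable (fun ω => IsRegularPath.supRem (fun v => f v ω) δ) ν := by
  refine AEMeasurable.iSup fun n => AEMeasurable.ennreal_ofReal ?_
  by_cases hn : TopologicalSpace.denseSeq (Param d) n ∈ Metric.ball (0 : Param d) δ
  · simp only [Set.indicator_of_mem hn]
    exact ((continuous_abs.measurable.comp_aemeasurable (hf.aemeasurable_logRem _)).const_mul
      _).div_const _
  · simp only [Set.indicator_of_notMem hn]
    exact aemeasurable_const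

/-- The first and second derivatives of the total mass vanish. -/
theorem integral_derivatives_eq_zero (hf : IsRegularFamily ν f r h G) (a : Param d) :
    (∫ ω, ∑ i, a i * partialDeriv i (fun v => f v ω) 0 ∂ν = 0) ∧
    Integrable (fun ω => ∑ i, ∑ j,
      a i * a j * partialDeriv i (partialDeriv j fun v => f v ω) 0) ν ∧
    ∫ ω, ∑ i, ∑ j, a i * a j * partialDeriv i (partialDeriv j fun v => f v ω) 0 ∂ν = 0 := by
  obtain ⟨ε, hε, hlim, hmem⟩ := exists_seq_mem_ball hf.zero_mem a
  simp only [zero_add] at hmem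
  set D : Ω → ℝ := fun ω => ∑ i, a i * partialDeriv i (fun v => f v ω) 0 with hD
  set Q : Param d → Ω → ℝ := fun u ω => ∑ i, ∑ j,
    a i * a j * partialDeriv i (partialDeriv j fun v => f v ω) u with hQ
  have hDm : AEMeasurable D ν := by
    refine Finset.aemeasurable_fun_sum _ fun i _ => AEMeasurable.const_mul ?_ _
    refine aemeasurable_partialDeriv (F := f) (r := r) (fun v _ => (hf.measurable v).aemeasurable)
      hf.zero_mem ?_ i
    filter_upwards [hf.path] with ω hω
    exact (hω.1.differentiableOn two_ne_zero).differentiableAt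
      (Metric.isOpen_ball.mem_nhds hf.zero_mem)
  -- Measurability is read off the formula in terms of scores and Hessians of the log density,
  -- already known to be measurable.
  have hQm : AEMeasurable (Q 0) ν := by
    have h1 : AEMeasurable (fun ω => ∑ i, ∑ j, a i * a j *
        ((logHess f i j ω + score f i ω * score f j ω) * f 0 ω)) ν :=
      Finset.aemeasurable_fun_sum _ fun i _ => Finset.aemeasurable_fun_sum _ fun j _ =>
        AEMeasurable.const_mul (((hf.aemeasurable_logHess i j).add
          ((hf.aemeasurable_score i).mul (hf.aemeasurable_score j))).mul
          (hf.measurable 0).aemeasurable) _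
    refine h1.congr ?_
    filter_upwards [hf.path] with ω hω
    simp only [hQ]
    refine Finset.sum_congr rfl fun i _ => Finset.sum_congr rfl fun j _ => ?_
    rw [hω.partialDeriv_partialDeriv_eq hf.pos i j]
    rfl
  set b : Ω → ℝ := fun ω => 1 / 2 * (d ^ 2 * h ω * ‖a‖ ^ 2) with hb
  have hbi : Integrable b ν := ((hf.integrable_h.const_mul _).mul_const _).const_mul _
  have hQb : ∀ᵐ ω ∂ν, ∀ u ∈ Metric.ball (0 : Param d) r, ‖1 / 2 * Q u ω‖ ≤ b ω := by
    filter_upwards [hf.path] with ω hω u hu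
    rw [norm_mul, Real.norm_eq_abs, Real.norm_eq_abs, abs_of_pos (by norm_num : (0 : ℝ) < 1 / 2)]
    simp only [hb]
    gcongr
    refine (abs_quadratic_le a _).trans ?_
    gcongr
    calc _ ≤ ∑ _i : Fin d, ∑ _j : Fin d, h ω :=
          Finset.sum_le_sum fun i _ => Finset.sum_le_sum fun j _ => ((hω.2 u hu).2 i j).1
      _ = _ := by
          simp only [Finset.sum_const, Finset.card_univ, Fintype.card_fin, nsmul_eq_mul]
          ring
  -- The second-order difference quotient with the first-order term removed. By Taylor it is `Q / 2`
  -- at an intermediate point, so it is dominated by `b` and tends to `Q 0 / 2`.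
  set R : ℕ → Ω → ℝ := fun k ω => (f (ε k • a) ω - f 0 ω - ε k * D ω) / ε k ^ 2 with hR
  have hRQ : ∀ᵐ ω ∂ν, ∀ k, ∃ ξ ∈ Set.Ioo (0 : ℝ) 1, R k ω = 1 / 2 * Q (ξ • ε k • a) ω := by
    filter_upwards [hf.path] with ω hω k
    obtain ⟨ξ, hξ, h1⟩ := exists_taylor_two hω.1 (hmem k)
    refine ⟨ξ, hξ, ?_⟩
    have e1 : ∑ i, (ε k • a) i * partialDeriv i (fun v => f v ω) 0 = ε k * D ω := by
      rw [hD, Finset.mul_sum]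
      exact Finset.sum_congr rfl fun i _ => by simp [mul_assoc]
    have e2 : ∑ i, ∑ j, (ε k • a) i * (ε k • a) j *
        partialDeriv i (partialDeriv j fun v => f v ω) (ξ • ε k • a) =
        ε k ^ 2 * Q (ξ • ε k • a) ω := by
      simp only [hQ, Finset.mul_sum]
      refine Finset.sum_congr rfl fun i _ => Finset.sum_congr rfl fun j _ => ?_
      simp only [PiLp.smul_apply, smul_eq_mul]
      ring
    rw [e1, e2] at h1
    have := (hε k).ne'
    simp only [hR]
    rw [h1]
    field_simp
    ring
  have hξmem : ∀ k, ∀ ξ ∈ Set.Ioo (0 : ℝ) 1, ξ • ε k • a ∈ Metric.ball (0 : Param d) r := by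
    intro k ξ hξ
    have := hmem k
    rw [mem_ball_zero_iff] at this ⊢
    rw [norm_smul, Real.norm_eq_abs, abs_of_pos hξ.1]
    exact (mul_le_of_le_one_left (norm_nonneg _) hξ.2.le).trans_lt this
  have hRm : ∀ k, AEStronglyMeasurable (R k) ν := fun k =>
    ((((hf.measurable _).sub (hf.measurable _)).aemeasurable.sub
      (hDm.const_mul _)).div_const _).aestronglyMeasurable
  have hRb : ∀ k, ∀ᵐ ω ∂ν, ‖R k ω‖ ≤ b ω := by
    intro k
    filter_upwards [hRQ, hQb] with ω h1 h2
    obtain ⟨ξ, hξ, h3⟩ := h1 k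
    rw [h3]
    exact h2 _ (hξmem k ξ hξ)
  have hRi : ∀ k, Integrable (R k) ν := fun k => hbi.mono' (hRm k) (hRb k)
  have hRlim : ∀ᵐ ω ∂ν, Tendsto (fun k => R k ω) atTop (𝓝 (1 / 2 * Q 0 ω)) := by
    filter_upwards [hRQ, hf.path] with ω h1 hω
    choose ξ hξ h2 using h1
    have hcont : ContinuousAt (fun u => 1 / 2 * Q u ω) 0 := by
      refine continuousAt_const.mul (tendsto_finsetSum _ fun i _ => tendsto_finsetSum _ fun j _ => ?_)
      exact continuousAt_const.mul ((continuousOn_partialDeriv_partialDeriv Metric.isOpen_ball hω.1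
        i j).continuousAt (Metric.isOpen_ball.mem_nhds hf.zero_mem))
    have hto : Tendsto (fun k => ξ k • ε k • a) atTop (𝓝 0) := by
      have h3 : Tendsto (fun k => ε k • a) atTop (𝓝 0) := by simpa using hlim.smul_const a
      refine squeeze_zero_norm (a := fun k => ‖ε k • a‖) (fun k => ?_) (by simpa using h3.norm)
      rw [norm_smul, Real.norm_eq_abs, abs_of_pos (hξ k).1]
      exact mul_le_of_le_one_left (norm_nonneg _) (hξ k).2.le
    exact (hcont.tendsto.comp hto).congr fun k => (h2 k).symm
  have hDCT := tendsto_integral_of_dominated_convergence b hRm hbi hRb hRlim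
  have hDi : Integrable D ν := by
    have h1 : Integrable (fun ω => (ε 0)⁻¹ * (f (ε 0 • a) ω - f 0 ω) - ε 0 * R 0 ω) ν :=
      (((hf.integrable (hmem 0)).sub (hf.integrable hf.zero_mem)).const_mul _).sub
        ((hRi 0).const_mul _)
    refine h1.congr (Eventually.of_forall fun ω => ?_)
    have := (hε 0).ne'
    simp only [hR]
    field_simp
    ring
  -- The total masses cancel. Letting `k → ∞` gives `∫ D = 0`; then every `∫ R k` is zero, and so is
  -- its limit `∫ Q 0 / 2`.
  have hRint : ∀ k, ε k * ∫ ω, R k ω ∂ν = - ∫ ω, D ω ∂ν := by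
    intro k
    simp only [hR]
    have i1 : Integrable (fun ω => f (ε k • a) ω - f 0 ω) ν :=
      (hf.integrable (hmem k)).sub (hf.integrable hf.zero_mem)
    rw [integral_div, integral_sub i1 (hDi.const_mul _), integral_sub (hf.integrable (hmem k)) (hf.integrable hf.zero_mem),
      hf.integral_eq_one _ (hmem k), hf.integral_eq_one _ hf.zero_mem, integral_const_mul]
    have := (hε k).ne'
    field_simp
    ring
  have hD0 : ∫ ω, D ω ∂ν = 0 := by
    have h1 := hlim.mul hDCT
    rw [zero_mul] at h1
    have h2 := tendsto_nhds_unique h1 (tendsto_const_nhds.congr fun k => (hRint k).symm)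
    linarith
  have hQi : Integrable (Q 0) ν := by
    have h1 : Integrable (fun ω => 1 / 2 * Q 0 ω) ν :=
      hbi.mono' (hQm.const_mul _).aestronglyMeasurable (hQb.mono fun ω hω => hω 0 hf.zero_mem)
    have h2 := h1.const_mul 2
    refine h2.congr (Eventually.of_forall fun ω => ?_)
    ring
  refine ⟨hD0, hQi, ?_⟩
  have h1 : ∀ k, ∫ ω, R k ω ∂ν = 0 := fun k => by
    have := hRint k
    rw [hD0, neg_zero] at this
    exact (mul_eq_zero.1 this).resolve_left (hε k).ne'
  simp_rw [h1] at hDCT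
  have h2 := tendsto_nhds_unique hDCT tendsto_const_nhds
  rw [integral_const_mul] at h2
  change ∫ ω, Q 0 ω ∂ν = 0
  linarith

theorem integral_score_mul_eq_zero (hf : IsRegularFamily ν f r h G) (i : Fin d) :
    ∫ ω, score f i ω * f 0 ω ∂ν = 0 := by
  rw [← (hf.integral_derivatives_eq_zero (EuclideanSpace.single i 1)).1]
  refine integral_congr_ae ?_
  filter_upwards [hf.path] with ω hω
  simp only [PiLp.single_apply, ite_mul, one_mul, zero_mul, Finset.sum_ite_eq',
    Finset.mem_univ, if_true]
  exact (hω.partialDeriv_eq hf.zero_mem i).symm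

/-- The information identity, for the quadratic forms. -/
theorem integral_logHess_add_eq_zero (hf : IsRegularFamily ν f r h G) (a : Param d) :
    Integrable (fun ω => ∑ i, ∑ j,
      a i * a j * ((logHess f i j ω + score f i ω * score f j ω) * f 0 ω)) ν ∧
    ∫ ω, ∑ i, ∑ j, a i * a j * ((logHess f i j ω + score f i ω * score f j ω) * f 0 ω) ∂ν = 0 := by
  obtain ⟨-, h1, h2⟩ := hf.integral_derivatives_eq_zero a
  have h3 : (fun ω => ∑ i, ∑ j, a i * a j * partialDeriv i (partialDeriv j fun v => f v ω) 0)
      =ᵐ[ν] fun ω => ∑ i, ∑ j,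
        a i * a j * ((logHess f i j ω + score f i ω * score f j ω) * f 0 ω) := by
    filter_upwards [hf.path] with ω hω
    refine Finset.sum_congr rfl fun i _ => Finset.sum_congr rfl fun j _ => ?_
    rw [hω.partialDeriv_partialDeriv_eq hf.pos i j]
    rfl
  exact ⟨h1.congr h3, by rw [← integral_congr_ae h3, h2]⟩

end IsRegularFamily

end RegularFamily


/-! ### Samples from a regular family with identity information matrix -/

section DensityMeasure

variable {d : ℕ} {Ω : Type*} [MeasurableSpace Ω] {ν : Measure Ω} {f : Param d → Ω → ℝ}

/-- The measure with density `f u`. -/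
noncomputable def densMeasure (ν : Measure Ω) (f : Param d → Ω → ℝ) (u : Param d) : Measure Ω :=
  ν.withDensity fun ω => ENNReal.ofReal (f u ω)

theorem isProbabilityMeasure_densMeasure {u : Param d} (h0 : ∀ ω, 0 ≤ f u ω)
    (h1 : ∫ ω, f u ω ∂ν = 1) : IsProbabilityMeasure (densMeasure ν f u) := by
  have hi : Integrable (f u) ν := by
    by_contra hcon
    rw [integral_undef hcon] at h1
    exact zero_ne_one h1
  constructor
  rw [densMeasure, withDensity_apply _ MeasurableSet.univ, Measure.restrict_univ,
    ← ofReal_integral_eq_lintegral_ofReal hi (Eventually.of_forall h0), h1, ENNReal.ofReal_one]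

theorem integral_densMeasure {u : Param d} (hm : Measurable (f u)) (h0 : ∀ ω, 0 ≤ f u ω)
    (F : Ω → ℝ) : ∫ ω, F ω ∂densMeasure ν f u = ∫ ω, F ω * f u ω ∂ν := by
  rw [densMeasure, integral_withDensity_eq_integral_toReal_smul hm.ennreal_ofReal
    (Eventually.of_forall fun _ => ENNReal.ofReal_lt_top)]
  refine integral_congr_ae (Eventually.of_forall fun ω => ?_)
  simp only [smul_eq_mul]
  rw [ENNReal.toReal_ofReal (h0 ω), mul_comm]

theorem integrable_densMeasure_iff {u : Param d} (hm : Measurable (f u)) (h0 : ∀ ω, 0 ≤ f u ω)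
    {F : Ω → ℝ} : Integrable F (densMeasure ν f u) ↔ Integrable (fun ω => F ω * f u ω) ν := by
  rw [densMeasure, integrable_withDensity_iff hm.ennreal_ofReal
    (Eventually.of_forall fun _ => ENNReal.ofReal_lt_top)]
  simp_rw [ENNReal.toReal_ofReal (h0 _)]

theorem densMeasure_absolutelyContinuous (u : Param d) : densMeasure ν f u ≪ ν :=
  withDensity_absolutelyContinuous _ _

theorem ae_densMeasure_pos {u : Param d} (hm : Measurable (f u)) :
    ∀ᵐ ω ∂densMeasure ν f u, 0 < f u ω := by
  rw [densMeasure, ae_withDensity_iff hm.ennreal_ofReal]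
  exact Eventually.of_forall fun ω h => by simpa using h

/-- Likelihood ratios bound the probabilities under the alternatives from below. -/
theorem setLIntegral_prod_ratio_le [SigmaFinite ν] {u w : Param d} (hmu : Measurable (f u))
    (hmw : Measurable (f w)) (hu : ∀ ω, 0 ≤ f u ω) (hw : ∀ ω, 0 ≤ f w ω) {n : ℕ}
    {A : Set (Fin n → Ω)} (hA : MeasurableSet A) :
    ∫⁻ ω in A, ENNReal.ofReal (∏ k, f u (ω k) / f w (ω k))
        ∂(Measure.pi fun _ : Fin n => densMeasure ν f w) ≤
      (Measure.pi fun _ : Fin n => densMeasure ν f u) A := by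
  have s1 := SigmaFinite.withDensity_ofReal (μ := ν) (f u)
  have s2 := SigmaFinite.withDensity_ofReal (μ := ν) (f w)
  simp only [densMeasure]
  rw [pi_withDensity hmu.ennreal_ofReal n, pi_withDensity hmw.ennreal_ofReal n,
    withDensity_apply _ hA]
  have m1 : Measurable fun ω : Fin n → Ω => ∏ k, ENNReal.ofReal (f w (ω k)) :=
    Finset.measurable_fun_prod _ fun k _ => (hmw.comp (measurable_pi_apply k)).ennreal_ofReal
  have m2 : Measurable fun ω : Fin n → Ω => ENNReal.ofReal (∏ k, f u (ω k) / f w (ω k)) :=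
    (Finset.measurable_fun_prod _ fun k _ => (hmu.comp (measurable_pi_apply k)).div
      (hmw.comp (measurable_pi_apply k))).ennreal_ofReal
  rw [setLIntegral_withDensity_eq_setLIntegral_mul _ m1 m2 hA]
  refine lintegral_mono fun ω => ?_
  simp only [Pi.mul_apply]
  rw [← ENNReal.ofReal_prod_of_nonneg fun k _ => hw (ω k),
    ← ENNReal.ofReal_prod_of_nonneg fun k _ => hu (ω k),
    ← ENNReal.ofReal_mul (Finset.prod_nonneg fun k _ => hw (ω k)), ← Finset.prod_mul_distrib]
  refine ENNReal.ofReal_le_ofReal (Finset.prod_le_prod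
    (fun k _ => mul_nonneg (hw _) (div_nonneg (hu _) (hw _))) fun k _ => ?_)
  -- Where `f w` vanishes the ratio has the default value `0`: mass of the alternative is lost
  -- there, hence only an inequality.
  rcases eq_or_ne (f w (ω k)) 0 with h | h
  · rw [h, zero_mul]
    exact hu _
  · rw [mul_div_cancel₀ _ h]

end DensityMeasure

/-! ### From a regular family with identity information to a standard model -/

section StandardModelOfRegular

variable {d : ℕ} {Ω : Type*} [MeasurableSpace Ω] {ν : Measure Ω} {f : Param d → Ω → ℝ} {r : ℝ}
  {h G : Ω → ℝ}

/-- Polarisation. A quadratic form determines only the symmetric part of its matrix, so the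
information identity is obtained for the symmetrised Hessian; symmetry of second derivatives is
never invoked. -/
theorem add_swap_eq_zero_of_quadratic_eq_zero {K : Fin d → Fin d → ℝ}
    (hK : ∀ a : Param d, ∑ i, ∑ j, a i * a j * K i j = 0) (i j : Fin d) : K i j + K j i = 0 := by
  have hs : ∀ k l : Fin d, ∑ i, ∑ j, (EuclideanSpace.single k (1 : ℝ)) i *
      (EuclideanSpace.single l (1 : ℝ)) j * K i j = K k l := by
    intro k l
    simp [PiLp.single_apply]
  have h1 := hK (EuclideanSpace.single i 1 + EuclideanSpace.single j 1)
  have h2 := hs i i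
  have h3 := hs j j
  rw [hK] at h2 h3
  simp only [PiLp.add_apply, add_mul, mul_add, Finset.sum_add_distrib] at h1
  rw [hs, hs, hs, hs] at h1
  linarith

namespace IsRegularFamily

theorem isProbabilityMeasure (hf : IsRegularFamily ν f r h G) :
    IsProbabilityMeasure (densMeasure ν f 0) :=
  isProbabilityMeasure_densMeasure (hf.nonneg 0 hf.zero_mem) (hf.integral_eq_one 0 hf.zero_mem)

/-- The Bochner integral of a non-integrable function is `0`, so a nonzero diagonal entry of the
information matrix already carries square integrability. -/
theorem memLp_score (hf : IsRegularFamily ν f r h G) {i : Fin d}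
    (hI : ∫ ω, score f i ω * score f i ω * f 0 ω ∂ν ≠ 0) :
    MemLp (score f i) 2 (densMeasure ν f 0) := by
  rw [memLp_two_iff_integrable_sq ((hf.aemeasurable_score i).mono_ac
    (densMeasure_absolutelyContinuous 0)).aestronglyMeasurable,
    integrable_densMeasure_iff (hf.measurable 0) (hf.nonneg 0 hf.zero_mem)]
  simp_rw [sq]
  by_contra hcon
  exact hI (integral_undef hcon)

theorem memLp_of_abs_le (hf : IsRegularFamily ν f r h G) {F : Ω → ℝ} (hF : AEMeasurable F ν) {c : ℝ}
    (hb : ∀ᵐ ω ∂densMeasure ν f 0, |F ω| ≤ c * G ω) : MemLp F 2 (densMeasure ν f 0) := by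
  have hm := (hF.mono_ac (densMeasure_absolutelyContinuous (f := f) 0)).aestronglyMeasurable
  rw [memLp_two_iff_integrable_sq hm]
  have hG : Integrable (fun ω => G ω ^ 2) (densMeasure ν f 0) :=
    (integrable_densMeasure_iff (hf.measurable 0) (hf.nonneg 0 hf.zero_mem)).2 hf.integrable_G
  refine (hG.const_mul (c ^ 2)).mono' (hm.pow 2) ?_
  filter_upwards [hb] with ω hω
  rw [Real.norm_eq_abs, abs_of_nonneg (sq_nonneg _), ← mul_pow, ← sq_abs]
  gcongr

theorem memLp_logHess (hf : IsRegularFamily ν f r h G) (i j : Fin d) :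
    MemLp (logHess f i j) 2 (densMeasure ν f 0) := by
  refine hf.memLp_of_abs_le (hf.aemeasurable_logHess i j) (c := 1) ?_
  filter_upwards [ae_densMeasure_pos (hf.measurable 0),
    (densMeasure_absolutelyContinuous (ν := ν) (f := f) 0).ae_le hf.path] with ω h1 h2
  rw [one_mul]
  exact ((h2.2 0 hf.zero_mem).2 i j).2 h1.ne'

/-- Here `K` is the expected Hessian plus the identity information matrix; the second-order identity
says that its quadratic form vanishes. -/
theorem integral_logHess_add_swap (hf : IsRegularFamily ν f r h G)
    (hI : ∀ i j, ∫ ω, score f i ω * score f j ω * f 0 ω ∂ν = if i = j then 1 else 0) (i j : Fin d) :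
    ∫ ω, logHess f i j ω ∂densMeasure ν f 0 + ∫ ω, logHess f j i ω ∂densMeasure ν f 0 =
      if i = j then -2 else 0 := by
  have hprob := hf.isProbabilityMeasure
  have hm0 := hf.measurable 0
  have h00 := hf.nonneg 0 hf.zero_mem
  have hs : ∀ i, MemLp (score f i) 2 (densMeasure ν f 0) := fun i =>
    hf.memLp_score (by rw [hI i i]; simp)
  have hss : ∀ i j, Integrable (fun ω => score f i ω * score f j ω) (densMeasure ν f 0) :=
    fun i j => (hs i).integrable_mul (hs j)
  have hh : ∀ i j, Integrable (logHess f i j) (densMeasure ν f 0) := fun i j =>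
    (hf.memLp_logHess i j).integrable one_le_two
  set K : Fin d → Fin d → ℝ := fun i j =>
    ∫ ω, logHess f i j ω ∂densMeasure ν f 0 + if i = j then 1 else 0 with hKdef
  have hK : ∀ a : Param d, ∑ i, ∑ j, a i * a j * K i j = 0 := by
    intro a
    rw [← (hf.integral_logHess_add_eq_zero a).2]
    have hint : ∀ i j, Integrable
        (fun ω => (logHess f i j ω + score f i ω * score f j ω) * f 0 ω) ν := fun i j =>
      (integrable_densMeasure_iff hm0 h00).1 ((hh i j).add (hss i j))
    rw [integral_finsetSum _ fun i _ => integrable_finsetSum _ fun j _ => (hint i j).const_mul _]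
    refine Finset.sum_congr rfl fun i _ => ?_
    rw [integral_finsetSum _ fun j _ => (hint i j).const_mul _]
    refine Finset.sum_congr rfl fun j _ => ?_
    rw [integral_const_mul, ← integral_densMeasure hm0 h00
      (fun ω => logHess f i j ω + score f i ω * score f j ω), integral_add (hh i j) (hss i j),
      integral_densMeasure hm0 h00 (fun ω => score f i ω * score f j ω), hI]
  have := add_swap_eq_zero_of_quadratic_eq_zero hK i j
  simp only [hKdef] at this
  by_cases hij : i = j
  · subst hij
    simp only [if_true] at this ⊢
    linarith
  · simp only [if_neg hij, if_neg (Ne.symm hij)] at this ⊢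
    linarith

theorem ae_supRem_le (hf : IsRegularFamily ν f r h G) {δ : ℝ} (hδ : δ ≤ r) :
    ∀ᵐ ω ∂densMeasure ν f 0, 0 ≤ 2 * d ^ 2 * G ω ∧
      IsRegularPath.supRem (fun v => f v ω) δ ≤ ENNReal.ofReal (2 * d ^ 2 * G ω) := by
  filter_upwards [(densMeasure_absolutelyContinuous (ν := ν) (f := f) 0).ae_le hf.path,
    ae_densMeasure_pos (hf.measurable 0)] with ω h1 h2
  have h3 : 0 ≤ 2 * d ^ 2 * G ω := by
    -- `G` is nonnegative because it bounds an absolute value; for `d = 0` there is no entry to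
    -- bound, but the factor `d ^ 2` vanishes.
    rcases Nat.eq_zero_or_pos d with hd | hd
    · simp [hd]
    · have i : Fin d := ⟨0, hd⟩
      have := (abs_nonneg _).trans (((h1.2 0 hf.zero_mem).2 i i).2 h2.ne')
      positivity
  exact ⟨h3, IsRegularPath.supRem_le h3 fun u hu =>
    h1.abs_logRem_le hf.pos h2.ne' (Metric.ball_subset_ball hδ hu)⟩

theorem ae_abs_toReal_supRem_le (hf : IsRegularFamily ν f r h G) {δ : ℝ} (hδ : δ ≤ r) :
    ∀ᵐ ω ∂densMeasure ν f 0,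
      |(IsRegularPath.supRem (fun v => f v ω) δ).toReal| ≤ 2 * d ^ 2 * G ω := by
  filter_upwards [hf.ae_supRem_le hδ] with ω h1
  rw [abs_of_nonneg ENNReal.toReal_nonneg]
  exact ENNReal.toReal_le_of_le_ofReal h1.1 h1.2

theorem _root_.LatentBayes.IsRegularPath.tendsto_toReal_supRem {F : Param d → ℝ} {a b : ℝ}
    (hF : IsRegularPath r F a b) (hr : 0 < r) {δ : ℕ → ℝ} (hδ : Tendsto δ atTop (𝓝 0)) :
    Tendsto (fun k => (IsRegularPath.supRem F (δ k)).toReal) atTop (𝓝 0) := by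
  refine tendsto_order.2 ⟨fun y hy => Eventually.of_forall fun k =>
    hy.trans_le ENNReal.toReal_nonneg, fun y hy => ?_⟩
  obtain ⟨δ', hδ', -, h2⟩ := hF.exists_abs_logRem_le hr (half_pos hy)
  filter_upwards [hδ.eventually (eventually_le_nhds hδ')] with k hk
  have h3 : IsRegularPath.supRem F (δ k) ≤ ENNReal.ofReal (y / 2) :=
    IsRegularPath.supRem_le (half_pos hy).le fun u hu => h2 u (Metric.ball_subset_ball hk hu)
  exact (ENNReal.toReal_le_of_le_ofReal (half_pos hy).le h3).trans_lt (half_lt_self hy)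

/-- Dominated convergence. The majorant uses `G ≤ 1 + G ^ 2`, because integrability is given for the
square, with no measurability of `G` itself. -/
theorem tendsto_integral_supRem (hf : IsRegularFamily ν f r h G) {δ : ℕ → ℝ}
    (hδr : ∀ k, δ k ≤ r) (hδ : Tendsto δ atTop (𝓝 0)) :
    Tendsto (fun k => ∫ ω, (IsRegularPath.supRem (fun v => f v ω) (δ k)).toReal
      ∂densMeasure ν f 0) atTop (𝓝 0) := by
  have hprob := hf.isProbabilityMeasure
  have hG2 : Integrable (fun ω => G ω ^ 2) (densMeasure ν f 0) :=
    (integrable_densMeasure_iff (hf.measurable 0) (hf.nonneg 0 hf.zero_mem)).2 hf.integrable_G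
  have hb : Integrable (fun ω => 2 * (d : ℝ) ^ 2 * (1 + G ω ^ 2)) (densMeasure ν f 0) :=
    ((integrable_const (1 : ℝ)).add hG2).const_mul (2 * (d : ℝ) ^ 2)
  have hm : ∀ k, AEStronglyMeasurable
      (fun ω => (IsRegularPath.supRem (fun v => f v ω) (δ k)).toReal) (densMeasure ν f 0) :=
    fun k => ((hf.aemeasurable_supRem (δ k)).ennreal_toReal.mono_ac
      (densMeasure_absolutelyContinuous 0)).aestronglyMeasurable
  have hlim : ∀ᵐ ω ∂densMeasure ν f 0,
      Tendsto (fun k => (IsRegularPath.supRem (fun v => f v ω) (δ k)).toReal) atTop (𝓝 0) := by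
    filter_upwards [(densMeasure_absolutelyContinuous (ν := ν) (f := f) 0).ae_le hf.path]
      with ω h1
    exact h1.tendsto_toReal_supRem hf.pos hδ
  have hbd : ∀ k, ∀ᵐ ω ∂densMeasure ν f 0,
      ‖(IsRegularPath.supRem (fun v => f v ω) (δ k)).toReal‖ ≤ 2 * (d : ℝ) ^ 2 * (1 + G ω ^ 2) := by
    intro k
    filter_upwards [hf.ae_abs_toReal_supRem_le (hδr k)] with ω hω
    refine hω.trans ?_
    have : G ω ≤ 1 + G ω ^ 2 := by nlinarith [sq_nonneg (G ω - 1), sq_nonneg (G ω)]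
    exact mul_le_mul_of_nonneg_left this (by positivity)
  have := tendsto_integral_of_dominated_convergence _ hm hb hbd hlim
  rwa [integral_zero] at this

theorem exists_integral_supRem_le (hf : IsRegularFamily ν f r h G) {ε : ℝ} (hε : 0 < ε) :
    ∃ δ > 0, δ ≤ r ∧ MemLp (fun ω => (IsRegularPath.supRem (fun v => f v ω) δ).toReal) 2
        (densMeasure ν f 0) ∧
      ∫ ω, (IsRegularPath.supRem (fun v => f v ω) δ).toReal ∂densMeasure ν f 0 ≤ ε ∧
      ∀ᵐ ω ∂densMeasure ν f 0, IsRegularPath.supRem (fun v => f v ω) δ ≠ ⊤ := by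
  have hδr : ∀ k : ℕ, r * (1 / ((k : ℝ) + 1)) ≤ r := fun k => by
    refine mul_le_of_le_one_right hf.pos.le ?_
    rw [div_le_one (by positivity)]
    linarith [(Nat.cast_nonneg k : (0 : ℝ) ≤ k)]
  have hδlim : Tendsto (fun k : ℕ => r * (1 / ((k : ℝ) + 1))) atTop (𝓝 0) := by
    have := (tendsto_one_div_add_atTop_nhds_zero_nat (𝕜 := ℝ)).const_mul r
    rw [mul_zero] at this
    exact this
  obtain ⟨k, hk⟩ := ((hf.tendsto_integral_supRem hδr hδlim).eventually
    (eventually_le_nhds hε)).exists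
  refine ⟨r * (1 / ((k : ℝ) + 1)), mul_pos hf.pos (by positivity), hδr k, ?_, hk, ?_⟩
  · exact hf.memLp_of_abs_le (hf.aemeasurable_supRem _).ennreal_toReal
      (hf.ae_abs_toReal_supRem_le (hδr k))
  · filter_upwards [hf.ae_supRem_le (hδr k)] with ω hω
    exact ne_top_of_le_ne_top ENNReal.ofReal_ne_top hω.2

/-- The likelihood ratios of a regular family with identity information matrix at the origin,
identified there by finitely many events, form a standard model. -/
theorem exists_isStandardModel [SigmaFinite ν] (hf : IsRegularFamily ν f r h G)
    (hI : ∀ i j, ∫ ω, score f i ω * score f j ω * f 0 ω ∂ν = if i = j then 1 else 0)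
    (hm : Measurable (Function.uncurry f)) {W : Set (Param d)}
    (hnonneg : ∀ u ∈ W, ∀ ω, 0 ≤ f u ω) (hone : ∀ u ∈ W, ∫ ω, f u ω ∂ν = 1)
    {π : Measure (Param d)} (hπW : ∀ᵐ u ∂π, u ∈ W) {φ₀ : ℝ} (hφ₀ : 0 < φ₀)
    (hπ : ∀ φm φp, 0 < φm → φm < φ₀ → φ₀ < φp → ∃ δ > 0,
      ENNReal.ofReal φm • (volume.restrict (Metric.ball (0 : Param d) δ)) ≤ π ∧
      π.restrict (Metric.ball (0 : Param d) δ) ≤ ENNReal.ofReal φp • volume)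
    (hsep : ∀ δ > 0, ∃ ℬ : Finset (Set Ω), (∀ B ∈ ℬ, MeasurableSet B) ∧ ∃ ε > 0,
      ∀ u ∈ W, δ ≤ ‖u‖ → ∃ B ∈ ℬ,
        ε ≤ |(densMeasure ν f u).real B - (densMeasure ν f 0).real B|) :
    ∃ τ H, IsStandardModel (densMeasure ν f 0) π (fun u ω => f u ω / f 0 ω) τ H φ₀ := by
  have hprob := hf.isProbabilityMeasure
  have hm0 := hf.measurable 0
  have h00 := hf.nonneg 0 hf.zero_mem
  have hac : densMeasure ν f 0 ≪ ν := densMeasure_absolutelyContinuous 0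
  have hs : ∀ i, MemLp (score f i) 2 (densMeasure ν f 0) := fun i =>
    hf.memLp_score (by rw [hI i i]; simp)
  have hτ : ∀ i, score f i =ᵐ[densMeasure ν f 0] (hf.aemeasurable_score i).mk := fun i =>
    hac.ae_eq (hf.aemeasurable_score i).ae_eq_mk
  -- The score is replaced by a measurable version, as the central limit argument requires; the
  -- Hessian is symmetrised so that its mean is exactly minus the identity.
  refine ⟨fun i => (hf.aemeasurable_score i).mk,
    fun i j ω => 1 / 2 * (logHess f i j ω + logHess f j i ω), ?_⟩
  have hpos : ∀ᵐ ω ∂densMeasure ν f 0, 0 < f 0 ω := ae_densMeasure_pos hm0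
  refine
    { measurable := ?_
      nonneg := ?_
      lintegral_le := ?_
      density_pos := hφ₀
      density := hπ
      score_measurable := fun i => (hf.aemeasurable_score i).measurable_mk
      score_memLp := fun i => (hs i).ae_eq (hτ i)
      score_mean := fun i => ?_
      score_sq := fun i => ?_
      hess_memLp := fun i j => ((hf.memLp_logHess i j).add (hf.memLp_logHess j i)).const_mul _
      hess_mean := fun i j => ?_
      taylor := fun ε hε => ?_
      tests := fun δ hδ => ?_ }
  · exact hm.div (hm0.comp measurable_snd)
  · filter_upwards [hπW] with u hu ω using div_nonneg (hnonneg u hu ω) (h00 ω)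
  · filter_upwards [hπW] with u hu
    have hQ := isProbabilityMeasure_densMeasure (hnonneg u hu) (hone u hu)
    have hpiu := setLIntegral_prod_ratio_le (ν := ν) (hm.comp measurable_prodMk_left) hm0
      (hnonneg u hu) h00 (n := 1) MeasurableSet.univ
    have h1 := lintegral_pi_prod (μ := densMeasure ν f 0) (n := 1)
      (fun _ ω => ENNReal.ofReal (f u ω / f 0 ω)) fun _ =>
        ((hm.comp measurable_prodMk_left).div hm0).ennreal_ofReal.aemeasurable
    simp only [Finset.univ_unique, Finset.prod_singleton, Measure.restrict_univ,
      measure_univ] at hpiu h1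
    rw [h1] at hpiu
    exact hpiu
  · rw [← integral_congr_ae (hτ i), integral_densMeasure hm0 h00, hf.integral_score_mul_eq_zero i]
  · have h1 : (fun ω => score f i ω ^ 2) =ᵐ[densMeasure ν f 0]
        fun ω => (hf.aemeasurable_score i).mk _ ω ^ 2 := by
      filter_upwards [hτ i] with ω hω
      rw [hω]
    rw [← integral_congr_ae h1, integral_densMeasure hm0 h00]
    simp_rw [sq]
    rw [hI i i, if_pos rfl]
  · rw [integral_const_mul, integral_add ((hf.memLp_logHess i j).integrable one_le_two)
      ((hf.memLp_logHess j i).integrable one_le_two), hf.integral_logHess_add_swap hI i j]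
    split_ifs <;> norm_num
  · obtain ⟨δ, hδ, hδr, hmem, hmean, hfin⟩ := hf.exists_integral_supRem_le hε
    refine ⟨δ, hδ, _, hmem, hmean, ?_⟩
    filter_upwards [hfin, hac.ae_le hf.path, hpos, ae_all_iff.2 hτ] with ω h1 h2 h3 h4 u hu
    have hur := Metric.ball_subset_ball hδr hu
    have hfu : 0 < f u ω := lt_of_le_of_ne (hf.nonneg u hur ω) fun hcon =>
      h3.ne' (((h2.2 u hur).1).1 hcon.symm)
    refine ⟨div_pos hfu h3, ?_⟩
    have h5 := h2.abs_logRem_le_supRem hδr h1 hu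
    convert h5 using 2
    rw [IsRegularPath.logRem, Real.log_div hfu.ne' h3.ne']
    congr 1
    · congr 1
      exact Finset.sum_congr rfl fun i _ => by rw [← h4 i]; rfl
    · congr 1
      -- Symmetrising the Hessian does not change its quadratic form, so the Taylor polynomial is
      -- the same.
      have e1 : ∑ i, ∑ j, u i * u j * (1 / 2 * (logHess f i j ω + logHess f j i ω)) =
          1 / 2 * ∑ i, ∑ j, u i * u j * logHess f i j ω +
          1 / 2 * ∑ i, ∑ j, u i * u j * logHess f j i ω := by
        simp_rw [Finset.mul_sum, ← Finset.sum_add_distrib]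
        exact Finset.sum_congr rfl fun i _ => Finset.sum_congr rfl fun j _ => by ring
      have e2 : ∑ i, ∑ j, u i * u j * logHess f j i ω = ∑ i, ∑ j, u i * u j * logHess f i j ω := by
        rw [Finset.sum_comm]
        exact Finset.sum_congr rfl fun i _ => Finset.sum_congr rfl fun j _ => by ring
      rw [e1, e2]
      change _ = ∑ i, ∑ j, u i * u j * logHess f i j ω
      ring
  · obtain ⟨ℬ, hℬ, ε, hε, hsep⟩ := hsep δ hδ
    obtain ⟨c, hc, C, A, hA, hA0, hA1⟩ :=
      exists_exponential_tests (Q₀ := densMeasure ν f 0) hℬ hε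
    refine ⟨c, hc, C, A, hA, ?_, fun n => ?_⟩
    · refine squeeze_zero (fun n => mul_nonneg measureReal_nonneg (Real.log_natCast_nonneg n))
        (fun n => ?_) (tendsto_mul_exp_mul_log hc C)
      exact mul_le_mul_of_nonneg_right (hA0 n) (Real.log_natCast_nonneg n)
    · filter_upwards [hπW] with u hu hδu
      exact (setLIntegral_prod_ratio_le (hm.comp measurable_prodMk_left) hm0 (hnonneg u hu) h00
        (hA n)).trans (hA1 _ (isProbabilityMeasure_densMeasure (hnonneg u hu) (hone u hu))
          (hsep u hu hδu) n)

end IsRegularFamily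

end StandardModelOfRegular


/-! ### Affine changes of the parameter -/

section Whitening

variable {d : ℕ}

theorem partialDeriv_comp_add (F : Param d → ℝ) (w₀ : Param d) (i : Fin d) :
    partialDeriv i (fun v => F (w₀ + v)) = fun v => partialDeriv i F (w₀ + v) := by
  funext v
  rw [partialDeriv, partialDeriv, fderiv_comp_add_left]

/-- The entries of a linear map in the standard basis. -/
noncomputable def entry (A : Param d ≃L[ℝ] Param d) (k i : Fin d) : ℝ := A (EuclideanSpace.single i 1) k

theorem partialDeriv_comp_linear {F : Param d → ℝ} (A : Param d ≃L[ℝ] Param d) (i : Fin d)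
    (u : Param d) :
    partialDeriv i (fun v => F (A v)) u = ∑ k, entry A k i * partialDeriv k F (A u) := by
  have h : fderiv ℝ (fun v => F (A v)) u = (fderiv ℝ F (A u)).comp (A : Param d →L[ℝ] Param d) :=
    A.comp_right_fderiv
  rw [partialDeriv, h, ContinuousLinearMap.comp_apply, fderiv_apply_eq_sum]
  rfl

theorem partialDeriv_partialDeriv_comp_linear {F : Param d → ℝ} (A : Param d ≃L[ℝ] Param d)
    {s : Set (Param d)} (hs : IsOpen s) (hF : ContDiffOn ℝ 2 F s) (i j : Fin d) {u : Param d}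
    (hu : A u ∈ s) :
    partialDeriv i (partialDeriv j fun v => F (A v)) u =
      ∑ k, entry A k j * ∑ l, entry A l i * partialDeriv l (partialDeriv k F) (A u) := by
  have h1 : (partialDeriv j fun v => F (A v)) =
      fun v => ∑ k, entry A k j * partialDeriv k F (A v) :=
    funext fun v => partialDeriv_comp_linear A j v
  have hd : ∀ k, DifferentiableAt ℝ (fun v => partialDeriv k F (A v)) u := fun k =>
    (((contDiffOn_partialDeriv hs hF k).differentiableOn one_ne_zero).differentiableAt
      (hs.mem_nhds hu)).comp u A.differentiableAt
  rw [h1, partialDeriv, fderiv_fun_sum fun k _ => (hd k).const_mul _, sum_apply]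
  refine Finset.sum_congr rfl fun k _ => ?_
  rw [fderiv_const_mul (hd k), smul_apply, smul_eq_mul]
  congr 1
  exact partialDeriv_comp_linear (F := partialDeriv k F) A i u

/-- The sum of the absolute values of the entries of a linear map. -/
noncomputable def entrySum (A : Param d ≃L[ℝ] Param d) : ℝ := ∑ k, ∑ i, |entry A k i|

theorem sum_abs_entry_le (A : Param d ≃L[ℝ] Param d) (i : Fin d) :
    ∑ k, |entry A k i| ≤ entrySum A :=
  Finset.sum_le_sum fun k _ => Finset.single_le_sum (f := fun i => |entry A k i|)
    (fun _ _ => abs_nonneg _) (Finset.mem_univ i)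

theorem abs_sum_entry_mul_le (A : Param d ≃L[ℝ] Param d) (i : Fin d) {z : Fin d → ℝ} {b : ℝ}
    (hb : 0 ≤ b) (hz : ∀ k, |z k| ≤ b) : |∑ k, entry A k i * z k| ≤ entrySum A * b := by
  refine (Finset.abs_sum_le_sum_abs _ _).trans ?_
  calc _ ≤ ∑ k, |entry A k i| * b := Finset.sum_le_sum fun k _ => by
        rw [abs_mul]
        exact mul_le_mul_of_nonneg_left (hz k) (abs_nonneg _)
    _ = (∑ k, |entry A k i|) * b := by rw [Finset.sum_mul]
    _ ≤ _ := mul_le_mul_of_nonneg_right (sum_abs_entry_le A i) hb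

theorem abs_partialDeriv_partialDeriv_comp_linear_le {F : Param d → ℝ} (A : Param d ≃L[ℝ] Param d)
    {s : Set (Param d)} (hs : IsOpen s) (hF : ContDiffOn ℝ 2 F s) {u : Param d} (hu : A u ∈ s)
    {b : ℝ} (hb : ∀ i j, |partialDeriv i (partialDeriv j F) (A u)| ≤ b) (i j : Fin d) :
    |partialDeriv i (partialDeriv j fun v => F (A v)) u| ≤ entrySum A ^ 2 * b := by
  have hb0 : 0 ≤ b := (abs_nonneg _).trans (hb i i)
  have hA : 0 ≤ entrySum A := Finset.sum_nonneg fun k _ => Finset.sum_nonneg fun l _ => abs_nonneg _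
  rw [partialDeriv_partialDeriv_comp_linear A hs hF i j hu, sq, mul_assoc]
  exact abs_sum_entry_mul_le A j (mul_nonneg hA hb0) fun k =>
    abs_sum_entry_mul_le A i hb0 fun l => hb l k

theorem IsRegularPath.comp_linear {F : Param d → ℝ} {r r' h G : ℝ} (hF : IsRegularPath r F h G)
    (A : Param d ≃L[ℝ] Param d)
    (hA : ∀ u ∈ Metric.ball (0 : Param d) r', A u ∈ Metric.ball (0 : Param d) r) :
    IsRegularPath r' (fun u => F (A u)) (entrySum A ^ 2 * h) (entrySum A ^ 2 * G) := by
  refine ⟨hF.1.comp A.contDiff.contDiffOn hA, fun w hw => ⟨?_, fun i j => ⟨?_, fun h0 => ?_⟩⟩⟩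
  · simpa only [map_zero] using (hF.2 _ (hA w hw)).1
  · exact abs_partialDeriv_partialDeriv_comp_linear_le A Metric.isOpen_ball hF.1 (hA w hw)
      (fun i j => ((hF.2 _ (hA w hw)).2 i j).1) i j
  · simp only [map_zero] at h0
    exact abs_partialDeriv_partialDeriv_comp_linear_le (F := fun v => Real.log (F v)) A
      Metric.isOpen_ball hF.contDiffOn_log (hA w hw)
      (fun i j => ((hF.2 _ (hA w hw)).2 i j).2 h0) i j

theorem score_comp_linear {Ω : Type*} (f : Param d → Ω → ℝ) (A : Param d ≃L[ℝ] Param d) (i : Fin d)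
    (ω : Ω) : score (fun u => f (A u)) i ω = ∑ k, entry A k i * score f k ω := by
  rw [score, partialDeriv_comp_linear (F := fun v => Real.log (f v ω)), map_zero]
  rfl

theorem IsRegularFamily.comp_linear {Ω : Type*} [MeasurableSpace Ω] {ν : Measure Ω}
    {f : Param d → Ω → ℝ} {r : ℝ} {h G : Ω → ℝ} (hf : IsRegularFamily ν f r h G)
    (A : Param d ≃L[ℝ] Param d) :
    ∃ r', IsRegularFamily ν (fun u => f (A u)) r' (fun ω => entrySum A ^ 2 * h ω)
      fun ω => entrySum A ^ 2 * G ω := by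
  have h1 : ∀ᶠ u in 𝓝 (0 : Param d), A u ∈ Metric.ball (0 : Param d) r :=
    A.continuous.continuousAt.eventually_mem (by
      rw [map_zero]
      exact Metric.ball_mem_nhds _ hf.pos)
  obtain ⟨r', hr', h2⟩ := Metric.eventually_nhds_iff_ball.1 h1
  refine ⟨r', hr', fun u => hf.measurable _, fun u hu => hf.nonneg _ (h2 u hu),
    fun u hu => hf.integral_eq_one _ (h2 u hu), ?_, hf.integrable_h.const_mul _, ?_⟩
  · filter_upwards [hf.path] with ω hω using hω.comp_linear A h2
  · rw [map_zero]
    simp_rw [mul_pow, mul_assoc]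
    exact hf.integrable_G.const_mul _

theorem integral_score_comp_linear {Ω : Type*} [MeasurableSpace Ω] {ν : Measure Ω}
    {f : Param d → Ω → ℝ} (A : Param d ≃L[ℝ] Param d)
    (hint : ∀ k l, Integrable (fun ω => score f k ω * score f l ω * f 0 ω) ν) (i j : Fin d) :
    ∫ ω, score (fun u => f (A u)) i ω * score (fun u => f (A u)) j ω * f (A 0) ω ∂ν =
      ∑ k, ∑ l, entry A k i * entry A l j * ∫ ω, score f k ω * score f l ω * f 0 ω ∂ν := by
  have h1 : ∀ ω, score (fun u => f (A u)) i ω * score (fun u => f (A u)) j ω * f (A 0) ω =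
      ∑ k, ∑ l, entry A k i * entry A l j * (score f k ω * score f l ω * f 0 ω) := by
    intro ω
    rw [map_zero, score_comp_linear, score_comp_linear, Finset.sum_mul_sum, Finset.sum_mul]
    refine Finset.sum_congr rfl fun k _ => ?_
    rw [Finset.sum_mul]
    exact Finset.sum_congr rfl fun l _ => by ring
  simp_rw [h1]
  rw [integral_finsetSum _ fun k _ => integrable_finsetSum _ fun l _ => (hint k l).const_mul _]
  refine Finset.sum_congr rfl fun k _ => ?_
  rw [integral_finsetSum _ fun l _ => (hint k l).const_mul _]
  exact Finset.sum_congr rfl fun l _ => integral_const_mul _ _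

open scoped MatrixOrder ComplexOrder in
/-- A linear change of the parameter that turns a positive definite information matrix into the
identity. -/
theorem exists_whitening {I : Matrix (Fin d) (Fin d) ℝ} (hI : I.PosDef) :
    ∃ A : Param d ≃L[ℝ] Param d,
      (∀ i j, ∑ k, ∑ l, entry A k i * entry A l j * I k l = if i = j then 1 else 0) ∧
      Real.log |LinearMap.det (A : Param d →ₗ[ℝ] Param d)| = -(1 / 2 * Real.log I.det) := by
  -- Factor `I = Bᵀ B` and take `A = B⁻¹`; then `Aᵀ I A = 1` and `|det A| = (det I) ^ (-1/2)`.
  obtain ⟨B, hB⟩ := CStarAlgebra.nonneg_iff_eq_star_mul_self.mp hI.posSemidef.nonneg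
  rw [Matrix.star_eq_conjTranspose, Matrix.conjTranspose_eq_transpose_of_trivial] at hB
  have hdet : I.det = B.det ^ 2 := by rw [hB, Matrix.det_mul, Matrix.det_transpose, sq]
  have hB0 : B.det ≠ 0 := by
    intro h
    have := hI.det_pos
    rw [hdet, h] at this
    simp at this
  have hu : IsUnit B.det := isUnit_iff_ne_zero.2 hB0
  set C := B⁻¹ with hC
  have hC0 : C.det ≠ 0 := (Matrix.isUnit_nonsing_inv_det B hu).ne_zero
  have hlin : LinearMap.det (C.toLpLin 2 2) = C.det := LinearMap.det_toLpLin 2 C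
  set A : Param d ≃L[ℝ] Param d :=
    ((C.toLpLin 2 2).equivOfDetNeZero (by rwa [hlin])).toContinuousLinearEquiv with hA
  have hent : ∀ k i, entry A k i = C k i := by
    intro k i
    simp [entry, hA]
  refine ⟨A, fun i j => ?_, ?_⟩
  · have h1 : C.transpose * I * C = 1 := by
      rw [hB, hC, Matrix.mul_assoc, Matrix.mul_assoc, Matrix.mul_nonsing_inv _ hu, Matrix.mul_one,
        ← Matrix.transpose_mul, Matrix.mul_nonsing_inv _ hu, Matrix.transpose_one]
    have h2 := congrFun (congrFun h1 i) j
    rw [Matrix.one_apply] at h2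
    rw [← h2]
    simp only [Matrix.mul_apply, Matrix.transpose_apply, hent, Finset.sum_mul]
    rw [Finset.sum_comm]
    exact Finset.sum_congr rfl fun l _ => Finset.sum_congr rfl fun k _ => by ring
  · have h3 : LinearMap.det (A : Param d →ₗ[ℝ] Param d) = C.det := by
      rw [← hlin]
      rfl
    rw [h3, hdet, hC, Matrix.det_nonsing_inv, Ring.inverse_eq_inv', abs_inv, Real.log_inv,
      Real.log_abs, Real.log_pow]
    push_cast
    ring

end Whitening


/-! ### Families of densities with a discrete label -/

section LabelledFamilies

variable {d : ℕ} {X T : Type*} [MeasurableSpace X] [Fintype T] [MeasurableSpace T]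
  [MeasurableSingletonClass T] {μ : Measure X} [SigmaFinite μ] {W : Set (Param d)}
  {g : Param d → X → T → ℝ} {w₀ : Param d}

/-- A nonzero Bochner integral certifies integrability, and nonnegative summands inherit it from
their sum. This applies to densities and to diagonal information entries alike. -/
theorem integrable_prod_count_of_integral_ne_zero {F : X → T → ℝ}
    (hm : ∀ t, AEMeasurable (fun x => F x t) μ) (h0 : ∀ x t, 0 ≤ F x t)
    (h1 : ∫ x, ∑ t, F x t ∂μ ≠ 0) :
    Integrable (fun ω : X × T => F ω.1 ω.2) (μ.prod Measure.count) := by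
  refine integrable_prod_count_iff.2 fun t => ?_
  have h2 : Integrable (fun x => ∑ t, F x t) μ := by
    by_contra h
    exact h1 (integral_undef h)
  refine h2.mono' (hm t).aestronglyMeasurable (Eventually.of_forall fun x => ?_)
  rw [Real.norm_eq_abs, abs_of_nonneg (h0 x t)]
  exact Finset.single_le_sum (f := fun t => F x t) (fun s _ => h0 x s) (Finset.mem_univ t)

namespace IsDensityFamily

omit [MeasurableSpace T] [MeasurableSingletonClass T] [SigmaFinite μ] in
theorem measurable_apply (hg : IsDensityFamily μ W g) (w : Param d) (t : T) :
    Measurable fun x => g w x t :=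
  (hg.measurable t).comp measurable_prodMk_left

omit [SigmaFinite μ] in
theorem measurable_uncurry (hg : IsDensityFamily μ W g) :
    Measurable fun a : Param d × (X × T) => g a.1 a.2.1 a.2.2 := by
  have : Measurable fun b : (Param d × X) × T => g b.1.1 b.1.2 b.2 :=
    measurable_from_prod_countable_left hg.measurable
  exact this.comp ((measurable_fst.prodMk measurable_snd.fst).prodMk measurable_snd.snd)

theorem integrable (hg : IsDensityFamily μ W g) {w : Param d} (hw : w ∈ W) :
    Integrable (fun ω : X × T => g w ω.1 ω.2) (μ.prod Measure.count) :=
  integrable_prod_count_of_integral_ne_zero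
    (fun t => (hg.measurable_apply w t).aemeasurable) (hg.nonneg w hw)
    (by rw [hg.integral_eq_one w hw]; exact one_ne_zero)

theorem integral_prod_count_eq_one (hg : IsDensityFamily μ W g) {w : Param d} (hw : w ∈ W) :
    ∫ ω : X × T, g w ω.1 ω.2 ∂μ.prod Measure.count = 1 := by
  rw [integral_prod_count (hg.integrable hw), hg.integral_eq_one w hw]

/-- The parameter is recentred at `w₀`, and the regularity ball is shrunk into `W`, where the
functions are densities. -/
theorem exists_isRegularFamily (hg : IsDensityFamily μ W g) (hw₀ : w₀ ∈ interior W)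
    (hreg : IsRegularAt μ g w₀) :
    ∃ r h G, IsRegularFamily (μ.prod Measure.count) (fun v (ω : X × T) => g (w₀ + v) ω.1 ω.2)
      r h G := by
  obtain ⟨r₁, hr₁, h, G, hh, hG, hpath⟩ := hreg
  obtain ⟨r₂, hr₂, hball⟩ := Metric.mem_nhds_iff.1 (mem_interior_iff_mem_nhds.1 hw₀)
  have hmem : ∀ u ∈ Metric.ball (0 : Param d) (min r₁ r₂), w₀ + u ∈ W := fun u hu => hball (by
    rw [mem_ball_zero_iff] at hu
    rw [mem_ball_iff_norm, add_sub_cancel_left]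
    exact hu.trans_le (min_le_right _ _))
  have hmem' : ∀ u ∈ Metric.ball (0 : Param d) (min r₁ r₂), w₀ + u ∈ Metric.ball w₀ r₁ :=
    fun u hu => by
      rw [mem_ball_zero_iff] at hu
      rw [mem_ball_iff_norm, add_sub_cancel_left]
      exact hu.trans_le (min_le_left _ _)
  refine ⟨min r₁ r₂, fun ω => h ω.1 ω.2, fun ω => G ω.1 ω.2, lt_min hr₁ hr₂,
    fun u => hg.measurable_uncurry.comp measurable_prodMk_left,
    fun u hu ω => hg.nonneg _ (hmem u hu) _ _,
    fun u hu => hg.integral_prod_count_eq_one (hmem u hu),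
    ae_prod_count_iff.2 fun t => ?_, integrable_prod_count_iff.2 hh, ?_⟩
  · filter_upwards [hpath t] with x hx
    refine ⟨hx.1.comp (contDiff_const.add contDiff_id).contDiffOn hmem', fun u hu => ?_⟩
    have h2 := hx.2 _ (hmem' u hu)
    refine ⟨by simpa only [add_zero] using h2.1, fun i j => ⟨?_, fun h0 => ?_⟩⟩
    · rw [partialDeriv_comp_add (fun w => g w x t), partialDeriv_comp_add]
      exact (h2.2 i j).1
    · simp only [add_zero] at h0
      rw [partialDeriv_comp_add (fun w => Real.log (g w x t)), partialDeriv_comp_add]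
      exact (h2.2 i j).2 h0
  · refine integrable_prod_count_iff.2 fun t => ?_
    simpa only [add_zero] using hG t

/-- Positive definiteness makes the diagonal entries nonzero, so the scores are square integrable;
the mixed products follow by Cauchy-Schwarz. -/
theorem integrable_score_mul_and_integral_eq (hg : IsDensityFamily μ W g) (hw₀ : w₀ ∈ W)
    {r : ℝ} {h G : X × T → ℝ}
    (hf : IsRegularFamily (μ.prod Measure.count) (fun v (ω : X × T) => g (w₀ + v) ω.1 ω.2) r h G)
    (hI : (fisherInfo μ (g w₀) g w₀).PosDef) (i j : Fin d) :
    Integrable (fun ω => score (fun v (ω : X × T) => g (w₀ + v) ω.1 ω.2) i ω *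
      score (fun v (ω : X × T) => g (w₀ + v) ω.1 ω.2) j ω * g (w₀ + 0) ω.1 ω.2)
      (μ.prod Measure.count) ∧
    ∫ ω, score (fun v (ω : X × T) => g (w₀ + v) ω.1 ω.2) i ω *
      score (fun v (ω : X × T) => g (w₀ + v) ω.1 ω.2) j ω * g (w₀ + 0) ω.1 ω.2
      ∂(μ.prod Measure.count) = fisherInfo μ (g w₀) g w₀ i j := by
  set f : Param d → X × T → ℝ := fun v ω => g (w₀ + v) ω.1 ω.2 with hfdef
  have hsc : ∀ i x t, score f i (x, t) =
      partialDeriv i (fun v => Real.log (g v x t)) w₀ := by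
    intro i x t
    have := congrFun (partialDeriv_comp_add (fun v => Real.log (g v x t)) w₀ i) 0
    rwa [add_zero] at this
  have hdiag : ∀ i, MemLp (score f i) 2 (densMeasure (μ.prod Measure.count) f 0) := by
    intro i
    have hne : fisherInfo μ (g w₀) g w₀ i i ≠ 0 := (hI.diag_pos).ne'
    have h1 : Integrable (fun ω : X × T => score f i (ω.1, ω.2) * score f i (ω.1, ω.2) *
        g w₀ ω.1 ω.2) (μ.prod Measure.count) := by
      refine integrable_prod_count_of_integral_ne_zero
        (F := fun x t => score f i (x, t) * score f i (x, t) * g w₀ x t) (fun t => ?_)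
        (fun x t => mul_nonneg (mul_self_nonneg _) (hg.nonneg _ hw₀ _ _)) ?_
      · have h2 : AEMeasurable (fun x => score f i (x, t)) μ := by
          have h3 := hf.aemeasurable_score i
          obtain ⟨s, hs, h4⟩ := h3
          exact ⟨fun x => s (x, t), hs.comp measurable_prodMk_right, ae_prod_count_iff.1 h4 t⟩
        exact (h2.mul h2).mul (hg.measurable_apply _ _).aemeasurable
      · simp_rw [hsc]
        exact hne
    rw [memLp_two_iff_integrable_sq ((hf.aemeasurable_score i).mono_ac
      (densMeasure_absolutelyContinuous 0)).aestronglyMeasurable,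
      integrable_densMeasure_iff (hf.measurable 0) (hf.nonneg 0 hf.zero_mem)]
    refine h1.congr (Eventually.of_forall fun ω => ?_)
    simp only [hfdef, add_zero, sq]
  have hint : Integrable (fun ω => score f i ω * score f j ω * g (w₀ + 0) ω.1 ω.2)
      (μ.prod Measure.count) :=
    (integrable_densMeasure_iff (f := f) (hf.measurable 0) (hf.nonneg 0 hf.zero_mem)).1
      ((hdiag i).integrable_mul (hdiag j))
  refine ⟨hint, ?_⟩
  rw [integral_prod_count hint]
  simp_rw [hsc, add_zero]
  rfl

end IsDensityFamily

theorem measureReal_densMeasure_prod_singleton {f : Param d → X × T → ℝ} {u : Param d}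
    (hm : ∀ t, Measurable fun x => f u (x, t)) (h0 : ∀ ω, 0 ≤ f u ω) {A : Set X}
    (hA : MeasurableSet A) (t : T) :
    (densMeasure (μ.prod Measure.count) f u).real (A ×ˢ {t}) = ∫ x in A, f u (x, t) ∂μ := by
  classical
  have hB : MeasurableSet (A ×ˢ ({t} : Set T)) := hA.prod (measurableSet_singleton t)
  rw [Measure.real, densMeasure, withDensity_apply _ hB, ← lintegral_indicator hB,
    lintegral_prod_count, Finset.sum_eq_single t,
    integral_eq_lintegral_of_nonneg_ae (Eventually.of_forall fun x => h0 _)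
      (hm t).aestronglyMeasurable, ← lintegral_indicator hA]
  · congr 1
    refine lintegral_congr fun x => ?_
    by_cases hx : x ∈ A <;> simp [Set.indicator, hx]
  · intro s _ hs
    have : ∀ x, (A ×ˢ ({t} : Set T)).indicator (fun ω => ENNReal.ofReal (f u ω)) (x, s) = 0 := by
      intro x
      simp [Set.indicator, hs]
    simp [this]
  · simp

/-- The prior as a measure, in the coordinates `u` with `w = w₀ + A u`. -/
noncomputable def localPrior (W : Set (Param d)) (φ : Param d → ℝ) (w₀ : Param d)
    (A : Param d ≃L[ℝ] Param d) : Measure (Param d) :=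
  ((volume.restrict W).withDensity fun w => ENNReal.ofReal (φ w)).map fun w => A.symm (w - w₀)

/-! ### The prior in local coordinates -/

section Prior

variable {φ : Param d → ℝ} {A : Param d ≃L[ℝ] Param d}

theorem measurable_chart (w₀ : Param d) (A : Param d ≃L[ℝ] Param d) :
    Measurable fun w : Param d => A.symm (w - w₀) :=
  A.symm.continuous.measurable.comp (measurable_id.sub_const w₀)

theorem IsPrior.integrableOn (hφ : IsPrior W φ) : IntegrableOn φ W := by
  by_contra h
  have := hφ.integral_eq_one
  rw [integral_undef h] at this
  exact zero_ne_one this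

theorem IsPrior.isProbabilityMeasure_localPrior (hφ : IsPrior W φ) (hW : MeasurableSet W) :
    IsProbabilityMeasure (localPrior W φ w₀ A) := by
  constructor
  rw [localPrior, Measure.map_apply (measurable_chart w₀ A) MeasurableSet.univ, Set.preimage_univ,
    withDensity_apply _ MeasurableSet.univ, Measure.restrict_univ,
    ← ofReal_integral_eq_lintegral_ofReal hφ.integrableOn
      (ae_restrict_of_forall_mem hW hφ.nonneg), hφ.integral_eq_one, ENNReal.ofReal_one]

theorem ae_localPrior_mem (hW : MeasurableSet W) :
    ∀ᵐ u ∂localPrior W φ w₀ A, w₀ + A u ∈ W := by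
  have hc : Measurable fun u : Param d => w₀ + A u := A.continuous.measurable.const_add w₀
  rw [localPrior, ae_map_iff (measurable_chart w₀ A).aemeasurable (hc hW)]
  refine (withDensity_absolutelyContinuous _ _).ae_le ?_
  filter_upwards [ae_restrict_mem hW] with w hw
  simpa using hw

theorem lintegral_localPrior (hφ : IsPrior W φ) {F : Param d → ENNReal} (hF : Measurable F) :
    ∫⁻ u, F u ∂localPrior W φ w₀ A =
      ∫⁻ w in W, ENNReal.ofReal (φ w) * F (A.symm (w - w₀)) := by
  rw [localPrior, lintegral_map hF (measurable_chart w₀ A),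
    lintegral_withDensity_eq_lintegral_mul₀ hφ.integrableOn.aemeasurable.ennreal_ofReal
      (g := fun w => F (A.symm (w - w₀))) (hF.comp (measurable_chart w₀ A)).aemeasurable]
  rfl

/-- The Jacobian behind the factor `|det A|` in the prior density at the origin. -/
theorem volume_preimage_chart (s : Set (Param d)) :
    volume ((fun w : Param d => A.symm (w - w₀)) ⁻¹' s) =
      ENNReal.ofReal |LinearMap.det (A : Param d →ₗ[ℝ] Param d)| * volume s := by
  have h1 : (fun w : Param d => A.symm (w - w₀)) ⁻¹' s =
      (fun w => w - w₀) ⁻¹' (A.symm ⁻¹' s) := rfl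
  rw [h1, (measurePreserving_sub_right volume w₀).measure_preimage_emb
    (MeasurableEquiv.subRight w₀).measurableEmbedding, Measure.addHaar_preimage_continuousLinearEquiv]
  rfl

theorem localPrior_apply {s : Set (Param d)} (hs : MeasurableSet s)
    (hsW : (fun w : Param d => A.symm (w - w₀)) ⁻¹' s ⊆ W) :
    localPrior W φ w₀ A s =
      ∫⁻ w in (fun w : Param d => A.symm (w - w₀)) ⁻¹' s, ENNReal.ofReal (φ w) := by
  have hm := measurable_chart w₀ A hs
  rw [localPrior, Measure.map_apply (measurable_chart w₀ A) hs, withDensity_apply _ hm,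
    Measure.restrict_restrict hm, Set.inter_eq_left.2 hsW]

/-- Near the origin the local prior has a density close to `φ w₀ |det A|`. -/
theorem localPrior_density (hw₀ : w₀ ∈ interior W)
    (hφc : ContinuousAt φ w₀) {φm φp : ℝ}
    (hm : φm < φ w₀ * |LinearMap.det (A : Param d →ₗ[ℝ] Param d)|)
    (hp : φ w₀ * |LinearMap.det (A : Param d →ₗ[ℝ] Param d)| < φp) :
    ∃ δ > 0,
      ENNReal.ofReal φm • (volume.restrict (Metric.ball (0 : Param d) δ)) ≤ localPrior W φ w₀ A ∧
      (localPrior W φ w₀ A).restrict (Metric.ball (0 : Param d) δ) ≤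
        ENNReal.ofReal φp • volume := by
  set D := |LinearMap.det (A : Param d →ₗ[ℝ] Param d)| with hD
  have hD0 : 0 < D := abs_pos.2 (LinearEquiv.isUnit_det' A.toLinearEquiv).ne_zero
  have h1 : ∀ᶠ u in 𝓝 (0 : Param d), w₀ + A u ∈ W ∧ φ (w₀ + A u) ∈ Set.Icc (φm / D) (φp / D) := by
    have hc : Tendsto (fun u : Param d => w₀ + A u) (𝓝 0) (𝓝 w₀) := by
      have : ContinuousAt (fun u : Param d => w₀ + A u) 0 :=
        (continuous_const.add A.continuous).continuousAt
      simpa [ContinuousAt] using this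
    have hWn : ∀ᶠ w in 𝓝 w₀, w ∈ W := mem_interior_iff_mem_nhds.1 hw₀
    exact hc.eventually (hWn.and (hφc.eventually
      (Icc_mem_nhds ((div_lt_iff₀ hD0).2 hm) ((lt_div_iff₀ hD0).2 hp))))
  obtain ⟨δ, hδ, h2⟩ := Metric.eventually_nhds_iff_ball.1 h1
  have h3 : ∀ s ⊆ Metric.ball (0 : Param d) δ,
      ∀ w ∈ (fun w : Param d => A.symm (w - w₀)) ⁻¹' s,
        w ∈ W ∧ φ w ∈ Set.Icc (φm / D) (φp / D) := by
    intro s hs w hw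
    have := h2 _ (hs hw)
    simpa using this
  have h4 : ∀ {s : Set (Param d)}, MeasurableSet s → s ⊆ Metric.ball 0 δ → ∀ c : ℝ,
      ∫⁻ _ in (fun w : Param d => A.symm (w - w₀)) ⁻¹' s, ENNReal.ofReal (c / D) =
        ENNReal.ofReal c * volume s := by
    intro s hs hsub c
    rw [setLIntegral_const, volume_preimage_chart, ← mul_assoc, ← hD,
      ← ENNReal.ofReal_mul' hD0.le, div_mul_cancel₀ _ hD0.ne']
  refine ⟨δ, hδ, Measure.le_iff.2 fun s hs => ?_, Measure.le_iff.2 fun s hs => ?_⟩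
  · have hs' := hs.inter (Metric.isOpen_ball (x := (0 : Param d)) (ε := δ)).measurableSet
    rw [Measure.smul_apply, Measure.restrict_apply hs, smul_eq_mul]
    refine le_trans ?_ (measure_mono (Set.inter_subset_left (t := Metric.ball 0 δ)))
    have h5 := h3 _ (Set.inter_subset_right (s := s) (t := Metric.ball 0 δ))
    rw [localPrior_apply hs' fun w hw => (h5 w hw).1, ← h4 hs' Set.inter_subset_right]
    exact setLIntegral_mono' (measurable_chart w₀ A hs') fun w hw =>
      ENNReal.ofReal_le_ofReal (h5 w hw).2.1
  · have hs' := hs.inter (Metric.isOpen_ball (x := (0 : Param d)) (ε := δ)).measurableSet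
    rw [Measure.smul_apply, Measure.restrict_apply hs, smul_eq_mul]
    refine le_trans ?_ (mul_le_mul_right (measure_mono
      (Set.inter_subset_left (t := Metric.ball 0 δ))) _)
    have h5 := h3 _ (Set.inter_subset_right (s := s) (t := Metric.ball 0 δ))
    rw [localPrior_apply hs' fun w hw => (h5 w hw).1, ← h4 hs' Set.inter_subset_right]
    exact setLIntegral_mono' (measurable_chart w₀ A hs') fun w hw =>
      ENNReal.ofReal_le_ofReal (h5 w hw).2.2

end Prior

namespace IsDensityFamily

/-- The neighbourhood of `w₀` is the image of a ball in the coordinate `u`; an event `E` for the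
label `t` becomes the event `E ×ˢ {t}` of the sample space. -/
theorem exists_separating_sets (hg : IsDensityFamily μ W g) (hw₀ : w₀ ∈ W)
    (hid : IsIdentifiedAt μ W g w₀) (A : Param d ≃L[ℝ] Param d) {δ : ℝ} (hδ : 0 < δ) :
    ∃ ℬ : Finset (Set (X × T)), (∀ B ∈ ℬ, MeasurableSet B) ∧ ∃ ε > 0,
      ∀ u, w₀ + A u ∈ W → δ ≤ ‖u‖ → ∃ B ∈ ℬ,
        ε ≤ |(densMeasure (μ.prod Measure.count)
              (fun u (ω : X × T) => g (w₀ + A u) ω.1 ω.2) u).real B -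
            (densMeasure (μ.prod Measure.count)
              (fun u (ω : X × T) => g (w₀ + A u) ω.1 ω.2) 0).real B| := by
  classical
  have hN : {w : Param d | ‖A.symm (w - w₀)‖ < δ} ∈ 𝓝 w₀ := by
    refine IsOpen.mem_nhds (isOpen_lt ?_ continuous_const) ?_
    · exact (A.symm.continuous.comp (continuous_id.sub continuous_const)).norm
    · simpa using hδ
  obtain ⟨s, hs, ε, hε, h⟩ := hid.exists_finset hN
  refine ⟨s.image fun p => p.2 ×ˢ {p.1}, fun B hB => ?_, ε, hε, fun u hu hδu => ?_⟩
  · obtain ⟨p, hp, rfl⟩ := Finset.mem_image.1 hB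
    exact (hs p hp).prod (measurableSet_singleton _)
  · obtain ⟨p, hp, h1⟩ := h _ hu (by simpa using hδu)
    refine ⟨_, Finset.mem_image_of_mem _ hp, ?_⟩
    rw [measureReal_densMeasure_prod_singleton (fun t => hg.measurable_apply _ t)
        (fun ω => hg.nonneg _ hu _ _) (hs p hp),
      measureReal_densMeasure_prod_singleton (fun t => hg.measurable_apply _ t)
        (fun ω => hg.nonneg _ (by simpa using hw₀) _ _) (hs p hp)]
    simpa using h1

/-- In suitable coordinates the likelihood ratios of a regular, identified family are locally
normal. -/
theorem exists_isLocallyNormal (hg : IsDensityFamily μ W g) (hW : MeasurableSet W)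
    {φ : Param d → ℝ} (hw₀ : w₀ ∈ interior W)
    (hφc : ContinuousAt φ w₀) (hφpos : 0 < φ w₀) (hreg : IsRegularAt μ g w₀)
    (hI : (fisherInfo μ (g w₀) g w₀).PosDef) (hid : IsIdentifiedAt μ W g w₀) :
    ∃ (A : Param d ≃L[ℝ] Param d) (S : _) (φ₀ : ℝ),
      IsLocallyNormal
        (fun n => Measure.pi fun _ : Fin n => (μ.prod (Measure.count : Measure T)).withDensity
          fun ω => ENNReal.ofReal (g w₀ ω.1 ω.2))
        (localPrior W φ w₀ A)
        (fun n u ω => ∏ k : Fin n, g (w₀ + A u) (ω k).1 (ω k).2 / g w₀ (ω k).1 (ω k).2) S φ₀ ∧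
      Real.log φ₀ = Real.log (φ w₀) - 1 / 2 * Real.log (fisherInfo μ (g w₀) g w₀).det := by
  have hw₀W := interior_subset hw₀
  obtain ⟨r, h, G, hf⟩ := hg.exists_isRegularFamily hw₀ hreg
  obtain ⟨A, hA, hdet⟩ := exists_whitening hI
  obtain ⟨r', hf'⟩ := hf.comp_linear A
  have hscore := hg.integrable_score_mul_and_integral_eq hw₀W hf hI
  have hD0 : 0 < |LinearMap.det (A : Param d →ₗ[ℝ] Param d)| :=
    abs_pos.2 (LinearEquiv.isUnit_det' A.toLinearEquiv).ne_zero
  have hφ₀ : 0 < φ w₀ * |LinearMap.det (A : Param d →ₗ[ℝ] Param d)| := mul_pos hφpos hD0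
  obtain ⟨τ, H, hstd⟩ := hf'.exists_isStandardModel
    (fun i j => by
      rw [integral_score_comp_linear (f := fun v (ω : X × T) => g (w₀ + v) ω.1 ω.2) A
        (fun k l => (hscore k l).1), ← hA i j]
      exact Finset.sum_congr rfl fun k _ => Finset.sum_congr rfl fun l _ => by
        rw [← (hscore k l).2])
    (W := {u | w₀ + A u ∈ W}) (π := localPrior W φ w₀ A)
    (hg.measurable_uncurry.comp (((A.continuous.measurable.const_add w₀).comp
      measurable_fst).prodMk measurable_snd))
    (fun u hu ω => hg.nonneg _ hu _ _) (fun u hu => hg.integral_prod_count_eq_one hu)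
    (ae_localPrior_mem hW) hφ₀ (fun φm φp _ h2 h3 => localPrior_density hw₀ hφc h2 h3)
    (fun δ hδ => hg.exists_separating_sets hw₀W hid A hδ)
  have hprob := hf'.isProbabilityMeasure
  have hloc := hstd.isLocallyNormal
  refine ⟨A, sampleScore τ, φ w₀ * |LinearMap.det (A : Param d →ₗ[ℝ] Param d)|, ?_, ?_⟩
  · simpa only [densMeasure, map_zero, add_zero] using hloc
  · rw [Real.log_mul hφpos.ne' hD0.ne', hdet]
    ring

end IsDensityFamily

end LabelledFamilies


/-! ### The evidence of the complete data -/

section CompleteData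

variable {d : ℕ} {X T : Type*} [MeasurableSpace X] [Fintype T] [MeasurableSpace T]
  [MeasurableSingletonClass T] {μ : Measure X} [SigmaFinite μ]

/-- The distribution of `(x, t)` with density `q` with respect to `μ ⊗ count`. -/
noncomputable def labelledMeasure (μ : Measure X) (q : X → T → ℝ) : Measure (X × T) :=
  (μ.prod Measure.count).withDensity fun ω => ENNReal.ofReal (q ω.1 ω.2)

variable {q : X → T → ℝ}

theorem measurable_uncurry_of_forall (hm : ∀ t, Measurable fun x => q x t) :
    Measurable fun ω : X × T => q ω.1 ω.2 :=
  measurable_from_prod_countable_left hm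

theorem pi_labelledMeasure (hm : ∀ t, Measurable fun x => q x t) (h0 : ∀ x t, 0 ≤ q x t) (n : ℕ) :
    (Measure.pi fun _ : Fin n => labelledMeasure μ q) =
      (Measure.pi fun _ : Fin n => μ.prod Measure.count).withDensity fun ω : Fin n → X × T =>
        ENNReal.ofReal (∏ k, q (ω k).1 (ω k).2) := by
  have hs := SigmaFinite.withDensity_ofReal (μ := μ.prod Measure.count)
    (fun ω : X × T => q ω.1 ω.2)
  simp only [labelledMeasure]
  rw [pi_withDensity (measurable_uncurry_of_forall hm).ennreal_ofReal n]
  congr 1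
  funext ω
  rw [ENNReal.ofReal_prod_of_nonneg fun k _ => h0 _ _]

theorem measurable_prod_labelled (hm : ∀ t, Measurable fun x => q x t) (n : ℕ) :
    Measurable fun ω : Fin n → X × T => ∏ k, q (ω k).1 (ω k).2 :=
  Finset.measurable_fun_prod _ fun k _ =>
    (measurable_uncurry_of_forall hm).comp (measurable_pi_apply k)

theorem ae_pi_of_ae_pi_labelledMeasure (hm : ∀ t, Measurable fun x => q x t)
    (h0 : ∀ x t, 0 ≤ q x t) {n : ℕ} {p : (Fin n → X × T) → Prop}
    (h : ∀ᵐ ω ∂(Measure.pi fun _ : Fin n => labelledMeasure μ q), p ω) (y : Fin n → T) :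
    ∀ᵐ x ∂(Measure.pi fun _ : Fin n => μ), 0 < ∏ k, q (x k) (y k) → p fun k => (x k, y k) := by
  rw [pi_labelledMeasure hm h0, ae_withDensity_iff (measurable_prod_labelled hm n).ennreal_ofReal]
    at h
  have h1 := (measurePreserving_pi_prod_count (μ := μ) (T := T) n).symm.quasiMeasurePreserving.ae h
  filter_upwards [ae_prod_count_iff.1 h1 y] with x hx hpos
  exact hx (ENNReal.ofReal_pos.2 hpos).ne'

theorem integral_pi_labelledMeasure (hm : ∀ t, Measurable fun x => q x t)
    (h0 : ∀ x t, 0 ≤ q x t) {n : ℕ} {F : (Fin n → X × T) → ℝ}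
    (hF : Integrable F (Measure.pi fun _ : Fin n => labelledMeasure μ q)) :
    (∀ y : Fin n → T, Integrable (fun x => F (fun k => (x k, y k)) * ∏ k, q (x k) (y k))
      (Measure.pi fun _ : Fin n => μ)) ∧
    ∫ ω, F ω ∂(Measure.pi fun _ : Fin n => labelledMeasure μ q) =
      ∫ x, ∑ y : Fin n → T, F (fun k => (x k, y k)) * ∏ k, q (x k) (y k)
        ∂(Measure.pi fun _ : Fin n => μ) := by
  have hmp := (measurePreserving_pi_prod_count (μ := μ) (T := T) n).symm
  have hemb := (MeasurableEquiv.arrowProdEquivProdArrow X T (Fin n)).symm.measurableEmbedding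
  have hnn : ∀ ω : Fin n → X × T, 0 ≤ ∏ k, q (ω k).1 (ω k).2 := fun ω =>
    Finset.prod_nonneg fun k _ => h0 _ _
  rw [pi_labelledMeasure hm h0] at hF ⊢
  rw [integrable_withDensity_iff (measurable_prod_labelled hm n).ennreal_ofReal
    (Eventually.of_forall fun _ => ENNReal.ofReal_lt_top)] at hF
  simp_rw [ENNReal.toReal_ofReal (hnn _)] at hF
  have h1 := (hmp.integrable_comp_emb hemb).2 hF
  refine ⟨fun y => integrable_prod_count_iff.1 h1 y, ?_⟩
  rw [integral_withDensity_eq_integral_toReal_smul (measurable_prod_labelled hm n).ennreal_ofReal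
    (Eventually.of_forall fun _ => ENNReal.ofReal_lt_top)]
  simp_rw [ENNReal.toReal_ofReal (hnn _), smul_eq_mul, mul_comm (∏ k, q _ _) (F _)]
  rw [← hmp.integral_comp hemb]
  exact integral_prod_count h1

theorem ae_pi_labelledMeasure_pos (hm : ∀ t, Measurable fun x => q x t)
    (h0 : ∀ x t, 0 ≤ q x t) (n : ℕ) :
    ∀ᵐ ω ∂(Measure.pi fun _ : Fin n => labelledMeasure μ q), 0 < ∏ k, q (ω k).1 (ω k).2 := by
  rw [pi_labelledMeasure hm h0, ae_withDensity_iff (measurable_prod_labelled hm n).ennreal_ofReal]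
  exact Eventually.of_forall fun ω h => by simpa using h

end CompleteData

/-! ### The expected loss of the Bayes mixture for complete data -/

section JointEvidence

variable {d K L : ℕ} {X : Type*} [MeasurableSpace X] {μ : Measure X} [SigmaFinite μ]
  {W : Set (Param d)} {g : Param d → X → Label K L → ℝ} {w₀ : Param d} {φ : Param d → ℝ}

omit [SigmaFinite μ] in
-- Undoing the chart turns the abstract evidence, an average of likelihood ratios, into the mixture
-- density divided by the true density.
theorem lintegral_prod_ratio_localPrior (hg : IsDensityFamily μ W g) (hW : MeasurableSet W)
    (hφ : IsPrior W φ) (A : Param d ≃L[ℝ] Param d) {n : ℕ} (x : Fin n → X)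
    (y : Fin n → Label K L) (hpos : 0 < ∏ k, g w₀ (x k) (y k)) :
    (∫⁻ u, ENNReal.ofReal (∏ k, g (w₀ + A u) (x k) (y k) / g w₀ (x k) (y k))
        ∂localPrior W φ w₀ A).toReal =
      jointEvidence W g φ x y / ∏ k, g w₀ (x k) (y k) := by
  have hgm : ∀ k, Measurable fun w => g w (x k) (y k) := fun k =>
    (hg.measurable (y k)).comp measurable_prodMk_right
  have hc : Measurable fun u : Param d => w₀ + A u := A.continuous.measurable.const_add w₀
  have hF : Measurable fun u => ENNReal.ofReal
      (∏ k, g (w₀ + A u) (x k) (y k) / g w₀ (x k) (y k)) :=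
    (Finset.measurable_fun_prod _ fun k _ => ((hgm k).comp hc).div_const _).ennreal_ofReal
  rw [lintegral_localPrior hφ hF, jointEvidence, ← integral_div, integral_eq_lintegral_of_nonneg_ae]
  · congr 1
    refine setLIntegral_congr_fun hW fun w hw => ?_
    simp only [ContinuousLinearEquiv.apply_symm_apply, add_sub_cancel]
    rw [← ENNReal.ofReal_mul (hφ.nonneg w hw), Finset.prod_div_distrib]
    congr 1
    ring
  · filter_upwards [ae_restrict_mem hW] with w hw
    exact div_nonneg (mul_nonneg (Finset.prod_nonneg fun k _ => hg.nonneg w hw _ _)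
      (hφ.nonneg w hw)) hpos.le
  · exact (((Finset.measurable_fun_prod _ fun k _ => hgm k).aemeasurable.mul
      hφ.integrableOn.aemeasurable).div_const _).aestronglyMeasurable

/-- The logarithmic loss of the Bayesian predictive distribution of the complete data. -/
noncomputable def evidenceLoss (W : Set (Param d)) (g : Param d → X → Label K L → ℝ)
    (φ : Param d → ℝ) (w₀ : Param d) {n : ℕ} (x : Fin n → X) (y : Fin n → Label K L) : ℝ :=
  (∏ k, g w₀ (x k) (y k)) * Real.log ((∏ k, g w₀ (x k) (y k)) / jointEvidence W g φ x y)

omit [MeasurableSpace X] in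
theorem evidenceLoss_zero (hφ : IsPrior W φ) (x : Fin 0 → X) (y : Fin 0 → Label K L) :
    evidenceLoss W g φ w₀ x y = 0 := by
  simp [evidenceLoss, jointEvidence, hφ.integral_eq_one]

omit [MeasurableSpace X] in
theorem jointEvidence_zero (hφ : IsPrior W φ) (x : Fin 0 → X) (y : Fin 0 → Label K L) :
    jointEvidence W g φ x y = 1 := by
  simp [jointEvidence, hφ.integral_eq_one]

/-- The expected logarithmic loss of a regular, identified family of dimension `d` is finite and
equals `d / 2 * log n` up to a constant, which involves the information matrix. -/
theorem evidenceLoss_asymptotics (hg : IsDensityFamily μ W g) (hW : MeasurableSet W)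
    (hφ : IsPrior W φ) (hw₀ : w₀ ∈ interior W)
    (hφc : ContinuousAt φ w₀) (hφpos : 0 < φ w₀) (hreg : IsRegularAt μ g w₀)
    (hI : (fisherInfo μ (g w₀) g w₀).PosDef) (hid : IsIdentifiedAt μ W g w₀) :
    (∀ n : ℕ, ∀ y : Fin n → Label K L,
      Integrable (fun x => evidenceLoss W g φ w₀ x y) (Measure.pi fun _ : Fin n => μ) ∧
      ∀ᵐ x ∂(Measure.pi fun _ : Fin n => μ), 0 < ∏ k, g w₀ (x k) (y k) →
        0 < jointEvidence W g φ x y) ∧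
    Tendsto (fun n : ℕ => (d : ℝ) / 2 * Real.log n -
      ∫ x, ∑ y, evidenceLoss W g φ w₀ x y ∂(Measure.pi fun _ : Fin n => μ)) atTop
      (𝓝 (Real.log (φ w₀) - 1 / 2 * Real.log (fisherInfo μ (g w₀) g w₀).det +
        (d : ℝ) / 2 * Real.log (2 * Real.pi) + d / 2)) := by
  have hw₀W := interior_subset hw₀
  have hm : ∀ t, Measurable fun x => g w₀ x t := fun t => hg.measurable_apply w₀ t
  have h0 : ∀ x t, 0 ≤ g w₀ x t := hg.nonneg w₀ hw₀W
  obtain ⟨A, S, φ₀, hloc, hlog⟩ := hg.exists_isLocallyNormal hW hw₀ hφc hφpos hreg hI hid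
  have hprob : IsProbabilityMeasure (labelledMeasure μ (g w₀)) :=
    isProbabilityMeasure_densMeasure (f := fun _ : Param d => fun ω : X × Label K L => g w₀ ω.1 ω.2)
      (u := 0) (fun ω => h0 _ _) (hg.integral_prod_count_eq_one hw₀W)
  have hπ : IsProbabilityMeasure (localPrior W φ w₀ A) := hφ.isProbabilityMeasure_localPrior hW
  change IsLocallyNormal (fun n => Measure.pi fun _ : Fin n => labelledMeasure μ (g w₀)) _ _ _ _
    at hloc
  have hpos := fun n => ae_pi_labelledMeasure_pos (μ := μ) hm h0 n
  have hZ : ∀ {n : ℕ} (ω : Fin n → X × Label K L), 0 < ∏ k, g w₀ (ω k).1 (ω k).2 →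
      (∫⁻ u, ENNReal.ofReal (∏ k, g (w₀ + A u) (ω k).1 (ω k).2 / g w₀ (ω k).1 (ω k).2)
        ∂localPrior W φ w₀ A).toReal =
      jointEvidence W g φ (fun k => (ω k).1) (fun k => (ω k).2) / ∏ k, g w₀ (ω k).1 (ω k).2 :=
    fun ω h => lintegral_prod_ratio_localPrior hg hW hφ A _ _ h
  have hloss : ∀ {n : ℕ} (x : Fin n → X) (y : Fin n → Label K L),
      Real.log (∫⁻ u, ENNReal.ofReal (∏ k, g (w₀ + A u) (x k) (y k) / g w₀ (x k) (y k))
        ∂localPrior W φ w₀ A).toReal * ∏ k, g w₀ (x k) (y k) = -evidenceLoss W g φ w₀ x y := by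
    intro n x y
    rcases (Finset.prod_nonneg fun k _ => h0 (x k) (y k) :
      0 ≤ ∏ k, g w₀ (x k) (y k)).eq_or_lt with h | h
    · rw [evidenceLoss, ← h]
      simp
    · rw [hZ (fun k => (x k, y k)) h, evidenceLoss, ← inv_div, Real.log_inv]
      ring
  have hmain : ∀ n : ℕ, 1 ≤ n →
      (∀ y : Fin n → Label K L,
        Integrable (fun x => evidenceLoss W g φ w₀ x y) (Measure.pi fun _ : Fin n => μ)) ∧
      ∫ ω : Fin n → X × Label K L, Real.log (∫⁻ u, ENNReal.ofReal
        (∏ k, g (w₀ + A u) (ω k).1 (ω k).2 / g w₀ (ω k).1 (ω k).2) ∂localPrior W φ w₀ A).toReal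
        ∂(Measure.pi fun _ : Fin n => labelledMeasure μ (g w₀)) =
      -∫ x, ∑ y, evidenceLoss W g φ w₀ x y ∂(Measure.pi fun _ : Fin n => μ) := by
    intro n hn
    obtain ⟨h1, h2⟩ := integral_pi_labelledMeasure hm h0
      (hloc.ae_evidence_pos_and_integrable_log hn).2
    simp only [hloss] at h1 h2
    refine ⟨fun y => by simpa using (h1 y).neg, ?_⟩
    rw [h2]
    simp only [Finset.sum_neg_distrib]
    rw [integral_neg]
  refine ⟨fun n y => ?_, ?_⟩
  -- The local theory starts at `n = 1`; for the empty sample the mixture is `1` and the loss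
  -- vanishes.
  · rcases Nat.eq_zero_or_pos n with rfl | hn
    · simp only [evidenceLoss_zero hφ, jointEvidence_zero hφ]
      exact ⟨integrable_zero _ _ _, Eventually.of_forall fun _ _ => one_pos⟩
    · refine ⟨(hmain n hn).1 y, ?_⟩
      filter_upwards [ae_pi_of_ae_pi_labelledMeasure hm h0
        (hloc.ae_evidence_pos_and_integrable_log hn).1 y] with x hx hq
      have h1 := hx hq
      rw [hZ (fun k => (x k, y k)) hq] at h1
      exact (div_pos_iff_of_pos_right hq).1 h1
  · rw [← hlog]
    refine hloc.tendsto_log_evidence.congr' ?_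
    filter_upwards [eventually_ge_atTop 1] with n hn
    rw [(hmain n hn).2]
    ring

end JointEvidence


/-! ### The conditional distribution of the labels given the observations -/

section KullbackLeibler

variable {S : Type*} [Fintype S] {a b : S → ℝ}

/-- The chain rule for relative entropy, multiplied by the total mass. Terms with `a s = 0` vanish
on both sides; otherwise both totals are positive and the logarithms split. -/
theorem klSum_normalize_mul (ha : ∀ s, 0 ≤ a s) (hb : ∀ s, 0 ≤ b s)
    (hab : ∀ s, 0 < a s → 0 < b s) :
    klSum (fun s => a s / ∑ t, a t) (fun s => b s / ∑ t, b t) * ∑ t, a t =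
      klSum a b - (∑ t, a t) * Real.log ((∑ t, a t) / ∑ t, b t) := by
  rw [klSum, klSum, Finset.sum_mul, Finset.sum_mul, ← Finset.sum_sub_distrib]
  refine Finset.sum_congr rfl fun s _ => ?_
  rcases (ha s).eq_or_lt with h | h
  · simp [← h]
  · have hA : 0 < ∑ t, a t := h.trans_le
      (Finset.single_le_sum (fun t _ => ha t) (Finset.mem_univ s))
    have hB : 0 < ∑ t, b t := (hab s h).trans_le
      (Finset.single_le_sum (fun t _ => hb t) (Finset.mem_univ s))
    rw [Real.log_div (div_pos h hA).ne' (div_pos (hab s h) hB).ne', Real.log_div h.ne' hA.ne',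
      Real.log_div (hab s h).ne' hB.ne', Real.log_div h.ne' (hab s h).ne',
      Real.log_div hA.ne' hB.ne']
    field_simp
    ring

/-- This is `log z ≤ z - 1` at `z = y / x`. It yields nonnegativity of relative entropy and the
lower bound for the observed loss. -/
theorem sub_le_mul_log_div {x y : ℝ} (hx : 0 ≤ x) (hy : 0 ≤ y) (hxy : 0 < x → 0 < y) :
    x - y ≤ x * Real.log (x / y) := by
  rcases hx.eq_or_lt with h | h
  · simp [← h, hy]
  · have h1 := Real.log_le_sub_one_of_pos (div_pos (hxy h) h)
    rw [← inv_div, Real.log_inv, inv_div] at h1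
    have h2 : y / x * x = y := div_mul_cancel₀ _ h.ne'
    nlinarith

/-- The log sum inequality. -/
theorem sum_mul_log_le_klSum (ha : ∀ s, 0 ≤ a s) (hb : ∀ s, 0 ≤ b s)
    (hab : ∀ s, 0 < a s → 0 < b s) :
    (∑ t, a t) * Real.log ((∑ t, a t) / ∑ t, b t) ≤ klSum a b := by
  rw [← sub_nonneg, ← klSum_normalize_mul ha hb hab]
  have hA : 0 ≤ ∑ t, a t := Finset.sum_nonneg fun t _ => ha t
  have hB : 0 ≤ ∑ t, b t := Finset.sum_nonneg fun t _ => hb t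
  refine mul_nonneg ?_ hA
  rcases hA.eq_or_lt with h | h
  · simp [klSum, ← h]
  · obtain ⟨s, -, hs⟩ := Finset.exists_lt_of_sum_lt (f := fun _ : S => (0 : ℝ)) (by simpa using h)
    have hB' : 0 < ∑ t, b t := (hab s hs).trans_le
      (Finset.single_le_sum (fun t _ => hb t) (Finset.mem_univ s))
    calc 0 = ∑ s, (a s / ∑ t, a t - b s / ∑ t, b t) := by
          rw [Finset.sum_sub_distrib, ← Finset.sum_div, ← Finset.sum_div, div_self h.ne',
            div_self hB'.ne', sub_self]
      _ ≤ _ := Finset.sum_le_sum fun s _ => sub_le_mul_log_div (div_nonneg (ha s) hA)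
          (div_nonneg (hb s) hB) fun hs => div_pos (hab s ((div_pos_iff_of_pos_right h).1 hs)) hB'

end KullbackLeibler

/-! ### The evidence and the loss of the observations -/

section Observations

variable {d K L : ℕ} {X : Type*} [MeasurableSpace X] {μ : Measure X} [SigmaFinite μ]
  {W : Set (Param d)} {g : Param d → X → Label K L → ℝ} {w₀ : Param d} {φ : Param d → ℝ}

omit [MeasurableSpace X] in
theorem prod_sum_eq_sum_prod (q : X → Label K L → ℝ) {n : ℕ} (x : Fin n → X) :
    ∏ i, ∑ y, q (x i) y = ∑ y : Fin n → Label K L, ∏ i, q (x i) (y i) := by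
  classical
  rw [Finset.prod_univ_sum, Fintype.piFinset_univ]

/-- By Tonelli the total mass is at most that of the prior. Fubini then shows that for almost every
`x` the integrals defining the evidences converge, so that they are not default values. -/
theorem integrable_evidence_integrand (hg : IsDensityFamily μ W g) (hW : MeasurableSet W)
    (hφ : IsPrior W φ) (n : ℕ) :
    Integrable (fun a : (Fin n → X) × Param d => (∏ i, ∑ y, g a.2 (a.1 i) y) * φ a.2)
      ((Measure.pi fun _ : Fin n => μ).prod (volume.restrict W)) := by
  have hmp : Measurable fun a : Param d × X => ∑ y, g a.1 a.2 y :=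
    Finset.measurable_fun_sum _ fun y _ => hg.measurable y
  have hm : Measurable fun a : (Fin n → X) × Param d => ∏ i, ∑ y, g a.2 (a.1 i) y :=
    Finset.measurable_fun_prod _ fun i _ =>
      hmp.comp (measurable_snd.prodMk ((measurable_pi_apply i).comp measurable_fst))
  have hφm : AEMeasurable (fun a : (Fin n → X) × Param d => φ a.2)
      ((Measure.pi fun _ : Fin n => μ).prod (volume.restrict W)) :=
    hφ.integrableOn.aemeasurable.comp_quasiMeasurePreserving Measure.quasiMeasurePreserving_snd
  have hm2 : AEMeasurable (fun a : (Fin n → X) × Param d => (∏ i, ∑ y, g a.2 (a.1 i) y) * φ a.2)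
      ((Measure.pi fun _ : Fin n => μ).prod (volume.restrict W)) := hm.aemeasurable.mul hφm
  refine ⟨hm2.aestronglyMeasurable, ?_⟩
  rw [hasFiniteIntegral_iff_enorm, lintegral_prod_symm _ hm2.enorm]
  refine lt_of_le_of_lt (b := ∫⁻ w in W, ENNReal.ofReal (φ w)) ?_ ?_
  · refine setLIntegral_mono' hW fun w hw => ?_
    have h1 : ∀ x : Fin n → X, ‖(∏ i, ∑ y, g w (x i) y) * φ w‖ₑ =
        (∏ i, ENNReal.ofReal (∑ y, g w (x i) y)) * ENNReal.ofReal (φ w) := by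
      intro x
      have h2 : ∀ i, 0 ≤ ∑ y, g w (x i) y := fun i => Finset.sum_nonneg fun y _ => hg.nonneg w hw _ _
      rw [Real.enorm_of_nonneg (mul_nonneg (Finset.prod_nonneg fun i _ => h2 i) (hφ.nonneg w hw)),
        ENNReal.ofReal_mul (Finset.prod_nonneg fun i _ => h2 i),
        ENNReal.ofReal_prod_of_nonneg fun i _ => h2 i]
    have hmw : Measurable fun x => ∑ y, g w x y :=
      Finset.measurable_fun_sum _ fun y _ => hg.measurable_apply w y
    have h3 : ∫⁻ x, ENNReal.ofReal (∑ y, g w x y) ∂μ = 1 := by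
      rw [← ofReal_integral_eq_lintegral_ofReal, hg.integral_eq_one w hw, ENNReal.ofReal_one]
      · by_contra h
        have := hg.integral_eq_one w hw
        rw [integral_undef h] at this
        exact zero_ne_one this
      · exact Eventually.of_forall fun x => Finset.sum_nonneg fun y _ => hg.nonneg w hw _ _
    simp_rw [h1]
    rw [lintegral_mul_const' _ _ ENNReal.ofReal_ne_top,
      lintegral_pi_prod (fun _ x => ENNReal.ofReal (∑ y, g w x y))
        fun _ => hmw.ennreal_ofReal.aemeasurable]
    simp [h3]
  · exact hφ.integrableOn.lintegral_lt_top

theorem integrable_evidence (hg : IsDensityFamily μ W g) (hW : MeasurableSet W)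
    (hφ : IsPrior W φ) (n : ℕ) :
    Integrable (fun x : Fin n → X => evidence W g φ x) (Measure.pi fun _ : Fin n => μ) :=
  (integrable_evidence_integrand hg hW hφ n).integral_prod_left

theorem ae_integrableOn_jointEvidence (hg : IsDensityFamily μ W g) (hW : MeasurableSet W)
    (hφ : IsPrior W φ) (n : ℕ) :
    ∀ᵐ x ∂(Measure.pi fun _ : Fin n => μ), ∀ y : Fin n → Label K L,
      IntegrableOn (fun w => (∏ i, g w (x i) (y i)) * φ w) W := by
  filter_upwards [(integrable_evidence_integrand hg hW hφ n).prod_right_ae] with x hx y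
  refine hx.mono' ((Finset.measurable_fun_prod _ fun i _ => (hg.measurable (y i)).comp
    measurable_prodMk_right).aemeasurable.mul hφ.integrableOn.aemeasurable).aestronglyMeasurable ?_
  filter_upwards [ae_restrict_mem hW] with w hw
  have h1 : 0 ≤ ∏ i, g w (x i) (y i) := Finset.prod_nonneg fun i _ => hg.nonneg w hw _ _
  rw [Real.norm_eq_abs, abs_of_nonneg (mul_nonneg h1 (hφ.nonneg w hw))]
  refine mul_le_mul_of_nonneg_right (Finset.prod_le_prod (fun i _ => hg.nonneg w hw _ _)
    fun i _ => ?_) (hφ.nonneg w hw)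
  exact Finset.single_le_sum (f := fun y => g w (x i) y) (fun y _ => hg.nonneg w hw _ _)
    (Finset.mem_univ _)

theorem ae_evidence_eq_sum (hg : IsDensityFamily μ W g) (hW : MeasurableSet W)
    (hφ : IsPrior W φ) (n : ℕ) :
    ∀ᵐ x ∂(Measure.pi fun _ : Fin n => μ),
      evidence W g φ x = ∑ y : Fin n → Label K L, jointEvidence W g φ x y := by
  filter_upwards [ae_integrableOn_jointEvidence hg hW hφ n] with x hx
  simp only [evidence, jointEvidence]
  rw [← integral_finsetSum _ fun y _ => hx y]
  refine integral_congr_ae (Eventually.of_forall fun w => ?_)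
  simp only
  rw [prod_sum_eq_sum_prod (g w), Finset.sum_mul]

omit [SigmaFinite μ] in
theorem jointEvidence_nonneg (hg : IsDensityFamily μ W g) (hW : MeasurableSet W)
    (hφ : IsPrior W φ) {n : ℕ} (x : Fin n → X) (y : Fin n → Label K L) :
    0 ≤ jointEvidence W g φ x y :=
  setIntegral_nonneg hW fun w hw =>
    mul_nonneg (Finset.prod_nonneg fun _ _ => hg.nonneg w hw _ _) (hφ.nonneg w hw)

/-- The logarithmic loss of the Bayesian predictive distribution of the observations. -/
noncomputable def observedLoss (W : Set (Param d)) (g : Param d → X → Label K L → ℝ)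
    (φ : Param d → ℝ) (w₀ : Param d) {n : ℕ} (x : Fin n → X) : ℝ :=
  (∏ i, ∑ y, g w₀ (x i) y) * Real.log ((∏ i, ∑ y, g w₀ (x i) y) / evidence W g φ x)

omit [MeasurableSpace X] in
-- The chain rule with `a = Q(x, ·)` and `b = Z(x, ·)`. The observed loss lies between `Q(x) - Z(x)`
-- and, by the log sum inequality, the complete-data loss; both are integrable, which settles its
-- integrability without any regularity of the observed model.
theorem jointIntegrand_eq {n : ℕ} {x : Fin n → X}
    (h0 : ∀ x y, 0 ≤ g w₀ x y) (hZ0 : ∀ y : Fin n → Label K L, 0 ≤ jointEvidence W g φ x y)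
    (hpos : ∀ y : Fin n → Label K L, 0 < ∏ k, g w₀ (x k) (y k) → 0 < jointEvidence W g φ x y)
    (hZ : evidence W g φ x = ∑ y : Fin n → Label K L, jointEvidence W g φ x y) :
    jointIntegrand W g φ (g w₀) n x =
      ∑ y, evidenceLoss W g φ w₀ x y - observedLoss W g φ w₀ x ∧
    observedLoss W g φ w₀ x ≤ ∑ y, evidenceLoss W g φ w₀ x y ∧
    (∏ i, ∑ y, g w₀ (x i) y) - evidence W g φ x ≤ observedLoss W g φ w₀ x := by
  have hq0 : ∀ y : Fin n → Label K L, 0 ≤ ∏ k, g w₀ (x k) (y k) := fun y =>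
    Finset.prod_nonneg fun k _ => h0 _ _
  have h1 : truePosterior (g w₀) x = fun y => (∏ k, g w₀ (x k) (y k)) /
      ∑ t : Fin n → Label K L, ∏ k, g w₀ (x k) (t k) := by
    funext y
    rw [truePosterior, Finset.prod_div_distrib, prod_sum_eq_sum_prod (g w₀)]
  have h2 : estPosterior W g φ x = fun y => jointEvidence W g φ x y /
      ∑ t : Fin n → Label K L, jointEvidence W g φ x t := by
    funext y
    rw [estPosterior, hZ]
  rw [jointIntegrand, h1, h2, observedLoss, prod_sum_eq_sum_prod (g w₀), hZ]
  refine ⟨klSum_normalize_mul hq0 hZ0 hpos, sum_mul_log_le_klSum hq0 hZ0 hpos,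
    sub_le_mul_log_div (Finset.sum_nonneg fun y _ => hq0 y) (Finset.sum_nonneg fun y _ => hZ0 y)
      fun h => ?_⟩
  obtain ⟨y, -, hy⟩ := Finset.exists_lt_of_sum_lt
    (f := fun _ : Fin n → Label K L => (0 : ℝ)) (by simpa using h)
  exact (hpos y hy).trans_le (Finset.single_le_sum (fun y _ => hZ0 y) (Finset.mem_univ y))

theorem integrable_prod_sum (hg : IsDensityFamily μ W g) (hw₀ : w₀ ∈ W) (n : ℕ) :
    Integrable (fun x : Fin n → X => ∏ i, ∑ y, g w₀ (x i) y) (Measure.pi fun _ : Fin n => μ) := by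
  refine Integrable.fintype_prod (f := fun _ x => ∑ y, g w₀ x y) fun _ => ?_
  by_contra h
  have := hg.integral_eq_one w₀ hw₀
  rw [integral_undef h] at this
  exact zero_ne_one this

theorem integrable_observedLoss_and_jointIntegrand_ae_eq
    (hg : IsDensityFamily μ W g) (hW : MeasurableSet W) (hφ : IsPrior W φ) (hw₀ : w₀ ∈ W) (n : ℕ)
    (hloss : ∀ y : Fin n → Label K L,
      Integrable (fun x => evidenceLoss W g φ w₀ x y) (Measure.pi fun _ : Fin n => μ) ∧
      ∀ᵐ x ∂(Measure.pi fun _ : Fin n => μ), 0 < ∏ k, g w₀ (x k) (y k) →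
        0 < jointEvidence W g φ x y) :
    Integrable (fun x : Fin n → X => observedLoss W g φ w₀ x) (Measure.pi fun _ : Fin n => μ) ∧
    jointIntegrand W g φ (g w₀) n =ᵐ[Measure.pi fun _ : Fin n => μ] fun x =>
      ∑ y, evidenceLoss W g φ w₀ x y - observedLoss W g φ w₀ x := by
  have hae : ∀ᵐ x ∂(Measure.pi fun _ : Fin n => μ),
      jointIntegrand W g φ (g w₀) n x =
        ∑ y, evidenceLoss W g φ w₀ x y - observedLoss W g φ w₀ x ∧
      observedLoss W g φ w₀ x ≤ ∑ y, evidenceLoss W g φ w₀ x y ∧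
      (∏ i, ∑ y, g w₀ (x i) y) - evidence W g φ x ≤ observedLoss W g φ w₀ x := by
    filter_upwards [ae_all_iff.2 fun y => (hloss y).2, ae_evidence_eq_sum hg hW hφ n] with x h1 h2
    exact jointIntegrand_eq (hg.nonneg w₀ hw₀) (jointEvidence_nonneg hg hW hφ x) h1 h2
  have hQ := integrable_prod_sum hg hw₀ n
  have hZ := integrable_evidence hg hW hφ n
  refine ⟨?_, hae.mono fun x hx => hx.1⟩
  refine integrable_of_le_of_le (g₁ := fun x => (∏ i, ∑ y, g w₀ (x i) y) - evidence W g φ x)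
    (g₂ := fun x => ∑ y, evidenceLoss W g φ w₀ x y) ?_ (hae.mono fun x hx => hx.2.2)
    (hae.mono fun x hx => hx.2.1) (hQ.sub hZ) (integrable_finsetSum _ fun y _ => (hloss y).1)
  exact (hQ.aemeasurable.mul (Real.measurable_log.comp_aemeasurable
    (hQ.aemeasurable.div hZ.aemeasurable))).aestronglyMeasurable

end Observations


/-! ### The marginal over the nuisance labels -/

section Marginal

variable {d Kt Kn L : ℕ} {X : Type*}

theorem sum_append_eq_sum {M : Type*} [AddCommMonoid M] (f : Label (Kt + Kn) L → M) :
    ∑ y : Label Kt L, ∑ z : Label Kn L, f (Fin.append y z) = ∑ t, f t := by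
  rw [← Fintype.sum_prod_type']
  exact Fintype.sum_equiv (Fin.appendEquiv Kt Kn) _ _ fun _ => rfl

theorem sum_margLabel (q : X → Label (Kt + Kn) L → ℝ) (x : X) :
    ∑ y, margLabel q x y = ∑ t, q x t :=
  sum_append_eq_sum (q x)

theorem prod_margLabel (q : X → Label (Kt + Kn) L → ℝ) {n : ℕ} (x : Fin n → X)
    (y : Fin n → Label Kt L) :
    ∏ i, margLabel q (x i) (y i) =
      ∑ z : Fin n → Label Kn L, ∏ i, q (x i) (Fin.append (y i) (z i)) := by
  classical
  simp only [margLabel]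
  rw [Finset.prod_univ_sum, Fintype.piFinset_univ]

theorem margSeq_truePosterior (q : X → Label (Kt + Kn) L → ℝ) {n : ℕ} (x : Fin n → X) :
    margSeq (truePosterior q x) = truePosterior (margLabel q) x := by
  funext y
  simp only [margSeq, truePosterior, Finset.prod_div_distrib, sum_margLabel]
  rw [← Finset.sum_div, prod_margLabel]

theorem evidence_margLabel (W : Set (Param d)) (p : Param d → X → Label (Kt + Kn) L → ℝ)
    (φ : Param d → ℝ) {n : ℕ} (x : Fin n → X) :
    evidence W (fun w => margLabel (p w)) φ x = evidence W p φ x := by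
  simp only [evidence, sum_margLabel]

variable [MeasurableSpace X] {μ : Measure X} {W : Set (Param d)}
  {p : Param d → X → Label (Kt + Kn) L → ℝ} {w₀ : Param d} {φ : Param d → ℝ}

theorem IsDensityFamily.margLabel (hp : IsDensityFamily μ W p) :
    IsDensityFamily μ W fun w => margLabel (p w) where
  measurable _ := Finset.measurable_fun_sum _ fun _ _ => hp.measurable _
  nonneg w hw _ _ := Finset.sum_nonneg fun _ _ => hp.nonneg w hw _ _
  integral_eq_one w hw := by simpa only [sum_margLabel] using hp.integral_eq_one w hw

theorem IsDensityFamily.integrable_apply [SigmaFinite μ] (hp : IsDensityFamily μ W p)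
    {w : Param d} (hw : w ∈ W) (t : Label (Kt + Kn) L) : Integrable (fun x => p w x t) μ :=
  integrable_prod_count_iff.1 (hp.integrable hw) t

/-- Convergence for the full labels implies convergence of the finite sums over the nuisance labels,
so identification by the marginal is the stronger property. -/
theorem IsIdentifiedAt.of_margLabel [SigmaFinite μ] (hp : IsDensityFamily μ W p) (hw₀ : w₀ ∈ W)
    (hid : IsIdentifiedAt μ W (fun w => margLabel (p w)) w₀) : IsIdentifiedAt μ W p w₀ := by
  intro l hl h
  have h1 : ∀ w ∈ W, ∀ (y : Label Kt L) (A : Set X),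
      ∫ x in A, margLabel (p w) x y ∂μ = ∑ z : Label Kn L, ∫ x in A, p w x (Fin.append y z) ∂μ :=
    fun w hw y A => integral_finsetSum _ fun z _ => (hp.integrable_apply hw _).integrableOn
  refine hid l hl fun y A hA => ?_
  simp only
  rw [h1 w₀ hw₀]
  refine (tendsto_finsetSum _ fun z _ => h (Fin.append y z) A hA).congr' ?_
  filter_upwards [le_principal_iff.1 hl] with w hw using (h1 w hw y A).symm

/-- Summing over the nuisance labels commutes with the product over the sample and with the prior
integral, the latter wherever the integrals converge. The marginal-type error is thus a joint-type
error of the marginal family. -/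
theorem margIntegrand_ae_eq [SigmaFinite μ] (hp : IsDensityFamily μ W p) (hW : MeasurableSet W)
    (hφ : IsPrior W φ) (q : X → Label (Kt + Kn) L → ℝ) (n : ℕ) :
    margIntegrand W p φ q n =ᵐ[Measure.pi fun _ : Fin n => μ]
      jointIntegrand W (fun w => margLabel (p w)) φ (margLabel q) n := by
  filter_upwards [ae_integrableOn_jointEvidence hp hW hφ n] with x hx
  have h1 : margSeq (estPosterior W p φ x) = estPosterior W (fun w => margLabel (p w)) φ x := by
    funext y
    simp only [margSeq, estPosterior]
    rw [evidence_margLabel, ← Finset.sum_div]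
    congr 1
    simp only [jointEvidence, prod_margLabel, Finset.sum_mul]
    rw [integral_finsetSum]
    exact fun z _ => hx fun i => Fin.append (y i) (z i)
  simp only [margIntegrand, jointIntegrand]
  rw [margSeq_truePosterior, h1]
  simp only [sum_margLabel]

end Marginal

/-! ### Replacing the true density by the model density at the true parameter -/

section Replace

variable {d K L : ℕ} {X : Type*} [MeasurableSpace X] {μ : Measure X}
  {q q' : X → Label K L → ℝ}

theorem fisherInfo_congr (h : ∀ᵐ x ∂μ, q x = q' x) (g : Param d → X → Label K L → ℝ)
    (w : Param d) : fisherInfo μ q g w = fisherInfo μ q' g w := by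
  ext i j
  refine integral_congr_ae ?_
  filter_upwards [h] with x hx
  rw [hx]

theorem ae_pi_forall [SigmaFinite μ] {r : X → Prop} (h : ∀ᵐ x ∂μ, r x) (n : ℕ) :
    ∀ᵐ x ∂(Measure.pi fun _ : Fin n => μ), ∀ i, r (x i) :=
  ae_all_iff.2 fun i => (Measure.quasiMeasurePreserving_eval (fun _ : Fin n => μ) i).ae h

theorem jointIntegrand_congr [SigmaFinite μ] (h : ∀ᵐ x ∂μ, q x = q' x) (W : Set (Param d))
    (g : Param d → X → Label K L → ℝ) (φ : Param d → ℝ) (n : ℕ) :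
    jointIntegrand W g φ q n =ᵐ[Measure.pi fun _ : Fin n => μ] jointIntegrand W g φ q' n := by
  filter_upwards [ae_pi_forall h n] with x hx
  have h1 : truePosterior q x = truePosterior q' x := by
    funext y
    simp only [truePosterior, hx]
  simp only [jointIntegrand, h1, hx]

end Replace

end LatentBayes

/-! ### The difference of the two errors -/

open LatentBayes
theorem mainTheorem7 {X : Type*} [MeasurableSpace X] (μ : Measure X) [SigmaFinite μ]
    {d Kt Kn L : ℕ} (hKn : 0 < Kn)
    (W : Set (Param d)) (hW : MeasurableSet W)
    (p : Param d → X → Label (Kt + Kn) L → ℝ) (hp : IsDensityFamily μ W p)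
    (φ : Param d → ℝ) (hφ : IsPrior W φ)
    (q : X → Label (Kt + Kn) L → ℝ)
    (w₀ : Param d) (hw₀ : w₀ ∈ interior W)
    (hq : ∀ y, ∀ᵐ x ∂μ, p w₀ x y = q x y)
    (hφc : ContinuousAt φ w₀) (hφpos : 0 < φ w₀)
    (hregXY : IsRegularAt μ p w₀)
    (hregXY11 : IsRegularAt μ (fun w => margLabel (p w)) w₀)
    (hposXY : (fisherInfo μ q p w₀).PosDef)
    (hposXY11 : (fisherInfo μ (margLabel q) (fun w => margLabel (p w)) w₀).PosDef)
    (hid : IsIdentifiedAt μ W (fun w => margLabel (p w)) w₀) :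
    (∀ n : ℕ,
      Integrable (jointIntegrand W p φ q n) (Measure.pi fun _ : Fin n => μ) ∧
      Integrable (margIntegrand W p φ q n) (Measure.pi fun _ : Fin n => μ)) ∧
    (fun n : ℕ => jointError μ W p φ q n - margError μ W p φ q n -
        1 / (2 * (n : ℝ)) * Real.log (fisherInfo μ q p w₀ *
          (fisherInfo μ (margLabel q) (fun w => margLabel (p w)) w₀)⁻¹).det)
      =o[atTop] fun n : ℕ => 1 / (n : ℝ) := by
  have hw₀W := interior_subset hw₀
  have hqp : ∀ᵐ x ∂μ, q x = p w₀ x := by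
    filter_upwards [ae_all_iff.2 hq] with x hx using (funext hx).symm
  have hqm : ∀ᵐ x ∂μ, margLabel q x = margLabel (p w₀) x := by
    filter_upwards [hqp] with x hx
    funext y
    simp only [margLabel, hx]
  have hI := fisherInfo_congr hqp p w₀
  have hI' := fisherInfo_congr hqm (fun w => margLabel (p w)) w₀
  have hm := hp.margLabel
  obtain ⟨hlp, hTp⟩ := evidenceLoss_asymptotics hp hW hφ hw₀ hφc hφpos hregXY (hI ▸ hposXY)
    (hid.of_margLabel hp hw₀W)
  obtain ⟨hlm, hTm⟩ := evidenceLoss_asymptotics hm hW hφ hw₀ hφc hφpos hregXY11 (hI' ▸ hposXY11) hid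
  have hJp := fun n => integrable_observedLoss_and_jointIntegrand_ae_eq hp hW hφ hw₀W n (hlp n)
  have hJm := fun n => integrable_observedLoss_and_jointIntegrand_ae_eq hm hW hφ hw₀W n (hlm n)
  -- The decisive cancellation: both families have the same distribution of the observations, hence
  -- the same observed loss.
  have hobs : ∀ (n : ℕ) (x : Fin n → X),
      observedLoss W (fun w => margLabel (p w)) φ w₀ x = observedLoss W p φ w₀ x := by
    intro n x
    simp only [observedLoss, evidence_margLabel, sum_margLabel]
  simp only [hobs] at hJm
  have hEp := fun n => (jointIntegrand_congr hqp W p φ n).trans (hJp n).2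
  have hEm := fun n => (margIntegrand_ae_eq hp hW hφ q n).trans
    ((jointIntegrand_congr hqm W (fun w => margLabel (p w)) φ n).trans (hJm n).2)
  have hSp := fun n => integrable_finsetSum Finset.univ fun y _ => (hlp n y).1
  have hSm := fun n => integrable_finsetSum Finset.univ fun y _ => (hlm n y).1
  refine ⟨fun n => ⟨((hSp n).sub (hJp n).1).congr (hEp n).symm,
    ((hSm n).sub (hJm n).1).congr (hEm n).symm⟩, ?_⟩
  have hlogdet : Real.log (fisherInfo μ q p w₀ *
      (fisherInfo μ (margLabel q) (fun w => margLabel (p w)) w₀)⁻¹).det =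
      Real.log (fisherInfo μ (p w₀) p w₀).det -
      Real.log (fisherInfo μ (margLabel (p w₀)) (fun w => margLabel (p w)) w₀).det := by
    rw [Matrix.det_mul, Matrix.det_nonsing_inv, Ring.inverse_eq_inv', ← div_eq_mul_inv,
      Real.log_div hposXY.det_pos.ne' hposXY11.det_pos.ne', hI, hI']
  -- In the difference of the two expansions `log n`, the prior density, `log 2π` and `d / 2`
  -- cancel; subtracting half the difference of the log determinants leaves the limit `0`.
  have hlim := ((hTm.sub hTp).sub_const (1 / 2 *
    (Real.log (fisherInfo μ (p w₀) p w₀).det -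
      Real.log (fisherInfo μ (margLabel (p w₀)) (fun w => margLabel (p w)) w₀).det)))
  rw [isLittleO_iff_tendsto' (by
    filter_upwards [eventually_ge_atTop 1] with n hn h
    have : (0 : ℝ) < n := by exact_mod_cast hn
    exact absurd h (one_div_pos.2 this).ne')]
  refine (hlim.congr' ?_).trans (le_of_eq (congrArg 𝓝 (by ring)))
  filter_upwards [eventually_ge_atTop 1] with n hn
  have hn0 : (n : ℝ) ≠ 0 := by
    have : (0 : ℝ) < n := by exact_mod_cast hn
    exact this.ne'
  rw [jointError, margError, integral_congr_ae (hEp n), integral_congr_ae (hEm n),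
    integral_sub (hSp n) (hJp n).1, integral_sub (hSm n) (hJm n).1, hlogdet]
  field_simp
  ring
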